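/- **Setting.** Let $\Gamma=[0,1]^2$, $T>0$, and let $P:[0,\infty)\to(0,\infty)$ satisfy: (A1) there are constants $p_0,p_1,z_0>0$ with $P(z)\ge p_0$ for all $z\ge 0$ and $P(z)\le p_1$ for $0\le z\le z_0$; (A2) $P$ is continuously differentiable with $0\le P'(z)\le L$ for $z\ge 0$. Let $u:\Gamma\times[0,T]\to\mathbb R$ be a classical solution of $$\partial_t^2u+P\Big(\int_\Gamma|\Delta u|^2\,d\mathbf x\Big)\,\partial_t u+\Delta^2u=f\quad\text{on }\Gamma\times[0,T],$$ $$u(\cdot,0)=u_0,\qquad \partial_tu(\cdot,0)=u_1,\qquad u=\Delta u=0\ \text{ on }\partial\Gamma\times(0,T],$$ and put $v=\Delta u$. Assume that for some constant $Q$, on $\Gamma\times[0,T]$ and for $k=x,y$: (A4) $|\partial_t^4u|\le Q$, $|\partial_t^3\partial_k^2u|\le Q$, $|\partial_k^6u|\le Q$, $|\partial_t\partial_k^4u|\le Q$; (A4$'$) $|\partial_t\partial_k^6u|\le Q$, $|\partial_k^6v|\le Q$. Here each listed derivative is understood to exist classically and to be continuous on $\Gamma\times[0,T]$, together with all the lower-order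 ones. **Scheme.** Let $J_1,J_2,N\ge 1$ be integers, $h_1=\frac1{2J_1}$, $h_2=\frac1{2J_2}$, $h=\max(h_1,h_2)$, $x_i=ih_1$, $y_j=jh_2$, and let $\tau>0$ with $(N+1)\tau\le T$, $t_n=n\tau$. Write $w_{ij}^n=w(x_i,y_j,t_n)$ for $w=u,v,f$. For grid functions put $$\delta_tW^n=\tfrac{W^n-W^{n-1}}{\tau},\quad \delta_t^{(2)}W^n=\delta_t(\delta_tW^{n+1}),\quad \bar\delta_tW^n=\tfrac{W^{n+1}-W^{n-1}}{2\tau},\quad \widetilde W^n=\tfrac{W^{n+1}+W^{n-1}}2,$$ $$\delta_x\delta_{\bar x}W_{ij}=\tfrac{W_{i+1,j}-2W_{ij}+W_{i-1,j}}{h_1^2},\qquad \delta_y\delta_{\bar y}W_{ij}=\tfrac{W_{i,j+1}-2W_{ij}+W_{i,j-1}}{h_2^2},$$ $$\mathcal AW_{ij}=\tfrac{W_{i+1,j}+10W_{ij}+W_{i-1,j}}{12}\ (1\le i\le 2J_1-1),\qquad \mathcal AW_{ij}=W_{ij}\ (i=0,2J_1),$$ $$\mathcal BW_{ij}=\tfrac{W_{i,j+1}+10W_{ij}+W_{i,j-1}}{12}\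 (1\le j\le 2J_2-1),\qquad \mathcal BW_{ij}=W_{ij}\ (j=0,2J_2),$$ $$\mathcal H=\mathcal A\mathcal B,\qquad \Phi=\mathcal B\,\delta_x\delta_{\bar x}+\mathcal A\,\delta_y\delta_{\bar y},\qquad \|W\|^2=h_1h_2\sum_{i=1}^{2J_1-1}\sum_{j=1}^{2J_2-1}W_{ij}^2,$$ $$\|W\|_E=\tfrac23\Big(h_1h_2\sum_{i=1}^{J_1}\sum_{j=1}^{J_2}\big(W_{2i-2,2j-1}^2+W_{2i-1,2j-2}^2+3W_{2i-1,2j-1}^2\big)\Big)^{1/2},\qquad \|W\|_F^2=\tfrac49\|W\|^2+\|W\|_E^2 .$$ (For $W$ vanishing on the boundary of the grid, $\|W\|_F^2$ is the composite two-dimensional Simpson rule for $W^2$.) Let $(U,V)$ be a solution of the fully discrete compact scheme: for $1\le i\le 2J_1-1$, $1\le j\le 2J_2-1$ and $1\le n\le N$, $$\mathcal H\delta_t^{(2)}U_{ij}^n+P(\|V^n\|_F^2)\,\mathcal H\bar\delta_tU_{ij}^n+\Phi\widetilde V_{ij}^n=\mathcal Hf_{ij}^n,\qquad \mathcal H\bar\delta_tV_{ij}^n=\Phi\bar\delta_tU_{ij}^n;$$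 $U^n$ and $V^n$ vanish at the boundary grid points for $0\le n\le N+1$; and at the interior grid points $$U^0=u_0,\qquad \delta_tU^1=u_1+\tfrac\tau2u_2,\qquad V^0=\Delta u_0,\qquad V^1=\Delta\big(u_0+\tau u_1+\tfrac{\tau^2}2u_2\big),$$ where $u_2=-P\big(\int_\Gamma|\Delta u_0|^2\big)u_1-\Delta^2u_0+f(\cdot,0)$, which equals $\partial_t^2u(\cdot,0)$. **Theorem 4.2.** There is a constant $\mathcal Q(T)>0$, independent of the discretization parameters $J_1,J_2,N,\tau$, such that for all such $J_1,J_2,N,\tau$ and all such $(U,V)$, $$\sqrt{\|\delta_t(u^{n+1}-U^{n+1})\|^2+\|v^{n+1}-V^{n+1}\|^2+\|v^n-V^n\|^2}\ \le\ \mathcal Q(T)\,(\tau^2+h^4),\qquad 1\le n\le N .$$ -/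

import Mathlib

open Set

namespace PlateScheme

noncomputable section

/-! ### The continuous problem

Functions on the square are `g : ℝ → ℝ → ℝ`, evaluated as `g x y`; space-time functions are
`u : ℝ → ℝ → ℝ → ℝ`, evaluated as `u t x y`. Only the values for `t ∈ [0, T]` and
`x, y ∈ [0, 1]` matter: all derivatives are taken within these intervals, so they are one-sided
at the end points. -/

/-- `∂ₓ g` on the closed unit square. -/
def dX (g : ℝ → ℝ → ℝ) : ℝ → ℝ → ℝ :=
  fun x y => derivWithin (fun s => g s y) (Icc 0 1) x

/-- `∂_y g` on the closed unit square. -/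
def dY (g : ℝ → ℝ → ℝ) : ℝ → ℝ → ℝ :=
  fun x y => derivWithin (fun s => g x s) (Icc 0 1) y

/-- The Laplacian `Δ g = ∂ₓ² g + ∂_y² g`. -/
def lap (g : ℝ → ℝ → ℝ) : ℝ → ℝ → ℝ :=
  fun x y => dX (dX g) x y + dY (dY g) x y

/-- `∂ₜ u` on the time interval `[0, T]`. -/
def dT (T : ℝ) (u : ℝ → ℝ → ℝ → ℝ) : ℝ → ℝ → ℝ → ℝ :=
  fun t x y => derivWithin (fun s => u s x y) (Icc 0 T) t

/-- The closed space-time cylinder `[0, T] × [0, 1]²`. -/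
def cylinder (T : ℝ) : Set (ℝ × ℝ × ℝ) :=
  Icc 0 T ×ˢ Icc 0 1 ×ˢ Icc 0 1

/-- The partial derivative `∂ₜᵃ ∂ₓᵇ ∂_yᶜ u`. -/
def partialDeriv (T : ℝ) (a b c : ℕ) (u : ℝ → ℝ → ℝ → ℝ) : ℝ → ℝ → ℝ → ℝ :=
  (dT T)^[a] (fun t => dX^[b] (dY^[c] (u t)))

/-- The partial derivative `∂ₜᵃ ∂ₓᵇ ∂_yᶜ u` exists (in the classical sense, together with all the
lower ones, so that no value of `derivWithin` is a junk value), all these derivatives are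
continuous on the closed cylinder, and `|∂ₜᵃ ∂ₓᵇ ∂_yᶜ u| ≤ Q` there. -/
structure PartialBound (T Q : ℝ) (a b c : ℕ) (u : ℝ → ℝ → ℝ → ℝ) : Prop where
  diff_y : ∀ c' < c, ∀ t ∈ Icc 0 T, ∀ x ∈ Icc (0 : ℝ) 1, ∀ y ∈ Icc (0 : ℝ) 1,
    DifferentiableWithinAt ℝ (fun s => partialDeriv T 0 0 c' u t x s) (Icc 0 1) y
  diff_x : ∀ b' < b, ∀ c' ≤ c, ∀ t ∈ Icc 0 T, ∀ x ∈ Icc (0 : ℝ) 1, ∀ y ∈ Icc (0 : ℝ) 1,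
    DifferentiableWithinAt ℝ (fun s => partialDeriv T 0 b' c' u t s y) (Icc 0 1) x
  diff_t : ∀ a' < a, ∀ b' ≤ b, ∀ c' ≤ c,
    ∀ t ∈ Icc 0 T, ∀ x ∈ Icc (0 : ℝ) 1, ∀ y ∈ Icc (0 : ℝ) 1,
    DifferentiableWithinAt ℝ (fun s => partialDeriv T a' b' c' u s x y) (Icc 0 T) t
  cont : ∀ a' ≤ a, ∀ b' ≤ b, ∀ c' ≤ c,
    ContinuousOn (fun p : ℝ × ℝ × ℝ => partialDeriv T a' b' c' u p.1 p.2.1 p.2.2) (cylinder T)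
  bound : ∀ t ∈ Icc 0 T, ∀ x ∈ Icc (0 : ℝ) 1, ∀ y ∈ Icc (0 : ℝ) 1,
    |partialDeriv T a b c u t x y| ≤ Q

/-- `∫_Γ |g|²` over the unit square. -/
def sqIntegral (g : ℝ → ℝ → ℝ) : ℝ :=
  ∫ p in (Icc (0 : ℝ) 1 ×ˢ Icc (0 : ℝ) 1 : Set (ℝ × ℝ)), |g p.1 p.2| ^ 2

/-- `(x, y)` lies on the boundary of the unit square. -/
def OnBoundary (x y : ℝ) : Prop :=
  (x ∈ Icc (0 : ℝ) 1 ∧ y ∈ Icc (0 : ℝ) 1) ∧ (x = 0 ∨ x = 1 ∨ y = 0 ∨ y = 1)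

/-- `u` is a solution of the hinged plate problem
`∂ₜ² u + P(∫_Γ |Δu|²) ∂ₜ u + Δ² u = f`, `u(0) = u₀`, `∂ₜ u(0) = u₁`, `u = Δu = 0` on `∂Γ`. -/
structure IsPlateSolution (P : ℝ → ℝ) (T : ℝ) (f : ℝ → ℝ → ℝ → ℝ) (u₀ u₁ : ℝ → ℝ → ℝ)
    (u : ℝ → ℝ → ℝ → ℝ) : Prop where
  equation : ∀ t ∈ Icc 0 T, ∀ x ∈ Icc (0 : ℝ) 1, ∀ y ∈ Icc (0 : ℝ) 1,
    dT T (dT T u) t x y + P (sqIntegral (lap (u t))) * dT T u t x y + lap (lap (u t)) x y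
      = f t x y
  init : ∀ x ∈ Icc (0 : ℝ) 1, ∀ y ∈ Icc (0 : ℝ) 1, u 0 x y = u₀ x y
  init_deriv : ∀ x ∈ Icc (0 : ℝ) 1, ∀ y ∈ Icc (0 : ℝ) 1, dT T u 0 x y = u₁ x y
  hinged : ∀ t ∈ Ioc 0 T, ∀ x y : ℝ, OnBoundary x y → u t x y = 0 ∧ lap (u t) x y = 0

/-- Bounds on `P`: `P ≤ p₁` on `[0, z₀]` and `P ≥ p₀` on `[0, ∞)`, with `p₀, p₁ > 0`. -/
def DampingBounds (P : ℝ → ℝ) (p₀ p₁ z₀ : ℝ) : Prop :=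
  0 < p₀ ∧ 0 < p₁ ∧ 0 < z₀ ∧ (∀ z, 0 ≤ z → z ≤ z₀ → P z ≤ p₁) ∧ (∀ z, 0 ≤ z → p₀ ≤ P z)

/-- `P` is continuously differentiable on `[0, ∞)` with `0 ≤ P' ≤ L`. -/
def DampingSlope (P : ℝ → ℝ) (L : ℝ) : Prop :=
  ContDiffOn ℝ 1 P (Ici 0) ∧
    ∀ z, 0 ≤ z → 0 ≤ derivWithin P (Ici 0) z ∧ derivWithin P (Ici 0) z ≤ L

/-- Bounds by `Q` for `∂ₜ⁴u`, `∂ₜ³∂ₖ²u`, `∂ₖ⁶u`, `∂ₜ∂ₖ⁴u`, `k = x, y`. -/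
structure SolutionBounds (T Q : ℝ) (u : ℝ → ℝ → ℝ → ℝ) : Prop where
  tttt : PartialBound T Q 4 0 0 u
  ttt_xx : PartialBound T Q 3 2 0 u
  ttt_yy : PartialBound T Q 3 0 2 u
  x6 : PartialBound T Q 0 6 0 u
  y6 : PartialBound T Q 0 0 6 u
  t_x4 : PartialBound T Q 1 4 0 u
  t_y4 : PartialBound T Q 1 0 4 u

/-- Bounds by `Q` for `∂ₜ∂ₖ⁶u` and `∂ₖ⁶v`, where `v = Δu` and `k = x, y`. -/
structure CompactBounds (T Q : ℝ) (u : ℝ → ℝ → ℝ → ℝ) : Prop where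
  t_x6 : PartialBound T Q 1 6 0 u
  t_y6 : PartialBound T Q 1 0 6 u
  lap_x6 : PartialBound T Q 0 6 0 (fun t => lap (u t))
  lap_y6 : PartialBound T Q 0 0 6 (fun t => lap (u t))

/-! ### Grid functions

A grid function is `w : ℕ → ℕ → ℝ`, `w i j` being the value at `(i h₁, j h₂)`, with
`0 ≤ i ≤ 2 J₁`, `0 ≤ j ≤ 2 J₂`, `h₁ = 1 / (2 J₁)`, `h₂ = 1 / (2 J₂)`. -/

/-- The step size `1 / (2 J)`. -/
def step (J : ℕ) : ℝ := 1 / (2 * (J : ℝ))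

/-- The restriction of a function on the square to the grid. -/
def onGrid (J₁ J₂ : ℕ) (g : ℝ → ℝ → ℝ) : ℕ → ℕ → ℝ :=
  fun i j => g (i * step J₁) (j * step J₂)

/-- Forward difference quotient `δₓ`. -/
def fwdX (J₁ : ℕ) (w : ℕ → ℕ → ℝ) : ℕ → ℕ → ℝ :=
  fun i j => (w (i + 1) j - w i j) / step J₁

/-- Backward difference quotient `δ_x̄` (used for `i ≥ 1`). -/
def bwdX (J₁ : ℕ) (w : ℕ → ℕ → ℝ) : ℕ → ℕ → ℝ :=
  fun i j => (w i j - w (i - 1) j) / step J₁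

/-- `δₓ δ_x̄` (used for `1 ≤ i ≤ 2 J₁ - 1`). -/
def secX (J₁ : ℕ) (w : ℕ → ℕ → ℝ) : ℕ → ℕ → ℝ :=
  fun i j => (fwdX J₁ w i j - bwdX J₁ w i j) / step J₁

/-- Forward difference quotient `δ_y`. -/
def fwdY (J₂ : ℕ) (w : ℕ → ℕ → ℝ) : ℕ → ℕ → ℝ :=
  fun i j => (w i (j + 1) - w i j) / step J₂

/-- Backward difference quotient `δ_ȳ` (used for `j ≥ 1`). -/
def bwdY (J₂ : ℕ) (w : ℕ → ℕ → ℝ) : ℕ → ℕ → ℝ :=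
  fun i j => (w i j - w i (j - 1)) / step J₂

/-- `δ_y δ_ȳ` (used for `1 ≤ j ≤ 2 J₂ - 1`). -/
def secY (J₂ : ℕ) (w : ℕ → ℕ → ℝ) : ℕ → ℕ → ℝ :=
  fun i j => (fwdY J₂ w i j - bwdY J₂ w i j) / step J₂

/-- The averaging operator `𝓐` in `x`. -/
def opA (J₁ : ℕ) (w : ℕ → ℕ → ℝ) : ℕ → ℕ → ℝ :=
  fun i j => if 1 ≤ i ∧ i + 1 ≤ 2 * J₁ then (w (i + 1) j + 10 * w i j + w (i - 1) j) / 12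
    else w i j

/-- The averaging operator `𝓑` in `y`. -/
def opB (J₂ : ℕ) (w : ℕ → ℕ → ℝ) : ℕ → ℕ → ℝ :=
  fun i j => if 1 ≤ j ∧ j + 1 ≤ 2 * J₂ then (w i (j + 1) + 10 * w i j + w i (j - 1)) / 12
    else w i j

/-- `𝓗 = 𝓐 𝓑`. -/
def opH (J₁ J₂ : ℕ) (w : ℕ → ℕ → ℝ) : ℕ → ℕ → ℝ := opA J₁ (opB J₂ w)

/-- `Φ = 𝓑 δₓ δ_x̄ + 𝓐 δ_y δ_ȳ`. -/
def opPhi (J₁ J₂ : ℕ) (w : ℕ → ℕ → ℝ) : ℕ → ℕ → ℝ :=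
  fun i j => opB J₂ (secX J₁ w) i j + opA J₁ (secY J₂ w) i j

/-- The discrete inner product over the interior grid points. -/
def gridInner (J₁ J₂ : ℕ) (w z : ℕ → ℕ → ℝ) : ℝ :=
  step J₁ * step J₂ *
    ∑ i ∈ Finset.Icc 1 (2 * J₁ - 1), ∑ j ∈ Finset.Icc 1 (2 * J₂ - 1), w i j * z i j

/-- The discrete `L²` norm. -/
def gridNorm (J₁ J₂ : ℕ) (w : ℕ → ℕ → ℝ) : ℝ := √(gridInner J₁ J₂ w w)

/-- The norm `‖·‖_E`. -/
def normE (J₁ J₂ : ℕ) (w : ℕ → ℕ → ℝ) : ℝ :=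
  2 / 3 * √(step J₁ * step J₂ *
    ∑ i ∈ Finset.Icc 1 J₁, ∑ j ∈ Finset.Icc 1 J₂,
      (w (2 * i - 2) (2 * j - 1) ^ 2 + w (2 * i - 1) (2 * j - 2) ^ 2
        + 3 * w (2 * i - 1) (2 * j - 1) ^ 2))

/-- The norm `‖·‖_F`; its square is the composite two-dimensional Simpson rule for `w²` when `w`
vanishes on the boundary. -/
def normF (J₁ J₂ : ℕ) (w : ℕ → ℕ → ℝ) : ℝ :=
  √(4 / 9 * gridNorm J₁ J₂ w ^ 2 + normE J₁ J₂ w ^ 2)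

/-! ### Time differences

A sequence of grid functions is `W : ℕ → ℕ → ℕ → ℝ`, `W n i j` being the value at time `n τ`. -/

/-- `δₜ Wⁿ = (Wⁿ - Wⁿ⁻¹) / τ` (used for `n ≥ 1`). -/
def dt (τ : ℝ) (W : ℕ → ℕ → ℕ → ℝ) (n : ℕ) : ℕ → ℕ → ℝ :=
  fun i j => (W n i j - W (n - 1) i j) / τ

/-- `δₜ⁽²⁾ Wⁿ = δₜ (δₜ Wⁿ⁺¹)`. -/
def dt2 (τ : ℝ) (W : ℕ → ℕ → ℕ → ℝ) (n : ℕ) : ℕ → ℕ → ℝ :=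
  dt τ (dt τ W) (n + 1)

/-- `(Wⁿ⁺¹ - Wⁿ⁻¹) / (2 τ)` (used for `n ≥ 1`). -/
def dtBar (τ : ℝ) (W : ℕ → ℕ → ℕ → ℝ) (n : ℕ) : ℕ → ℕ → ℝ :=
  fun i j => (W (n + 1) i j - W (n - 1) i j) / (2 * τ)

/-- `(Wⁿ⁺¹ + Wⁿ⁻¹) / 2` (used for `n ≥ 1`). -/
def avg (W : ℕ → ℕ → ℕ → ℝ) (n : ℕ) : ℕ → ℕ → ℝ :=
  fun i j => (W (n + 1) i j + W (n - 1) i j) / 2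

/-- The values of a space-time function at the grid points, at the times `n τ`. -/
def sample (J₁ J₂ : ℕ) (τ : ℝ) (w : ℝ → ℝ → ℝ → ℝ) : ℕ → ℕ → ℕ → ℝ :=
  fun n => onGrid J₁ J₂ (w (n * τ))

/-! ### The fully discrete scheme -/

/-- The value of `∂ₜ² u` at `t = 0` read off from the data:
`u₂ = f(0) - P(∫_Γ |Δu₀|²) u₁ - Δ² u₀`. -/
def secondInit (P : ℝ → ℝ) (f : ℝ → ℝ → ℝ → ℝ) (u₀ u₁ : ℝ → ℝ → ℝ) : ℝ → ℝ → ℝ :=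
  fun x y => -P (sqIntegral (lap u₀)) * u₁ x y - lap (lap u₀) x y + f 0 x y

/-- The starting function `u₀ + τ u₁ + (τ² / 2) u₂`, whose grid values are `U¹`. -/
def firstStep (P : ℝ → ℝ) (f : ℝ → ℝ → ℝ → ℝ) (u₀ u₁ : ℝ → ℝ → ℝ) (τ : ℝ) : ℝ → ℝ → ℝ :=
  fun x y => u₀ x y + τ * u₁ x y + τ ^ 2 / 2 * secondInit P f u₀ u₁ x y

/-- `(U, V)` solves the fully discrete compact difference scheme with parameters
`J₁, J₂, N, τ`. -/
structure IsSchemeSolution (P : ℝ → ℝ) (f : ℝ → ℝ → ℝ → ℝ) (u₀ u₁ : ℝ → ℝ → ℝ)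
    (J₁ J₂ N : ℕ) (τ : ℝ) (U V : ℕ → ℕ → ℕ → ℝ) : Prop where
  eqU : ∀ n ∈ Finset.Icc 1 N, ∀ i ∈ Finset.Icc 1 (2 * J₁ - 1), ∀ j ∈ Finset.Icc 1 (2 * J₂ - 1),
    opH J₁ J₂ (dt2 τ U n) i j + P (normF J₁ J₂ (V n) ^ 2) * opH J₁ J₂ (dtBar τ U n) i j
      + opPhi J₁ J₂ (avg V n) i j = opH J₁ J₂ (sample J₁ J₂ τ f n) i j
  eqV : ∀ n ∈ Finset.Icc 1 N, ∀ i ∈ Finset.Icc 1 (2 * J₁ - 1), ∀ j ∈ Finset.Icc 1 (2 * J₂ - 1),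
    opH J₁ J₂ (dtBar τ V n) i j = opPhi J₁ J₂ (dtBar τ U n) i j
  bdry_x : ∀ n ≤ N + 1, ∀ j ≤ 2 * J₂,
    U n 0 j = 0 ∧ U n (2 * J₁) j = 0 ∧ V n 0 j = 0 ∧ V n (2 * J₁) j = 0
  bdry_y : ∀ n ≤ N + 1, ∀ i ≤ 2 * J₁,
    U n i 0 = 0 ∧ U n i (2 * J₂) = 0 ∧ V n i 0 = 0 ∧ V n i (2 * J₂) = 0
  initU0 : ∀ i ∈ Finset.Icc 1 (2 * J₁ - 1), ∀ j ∈ Finset.Icc 1 (2 * J₂ - 1),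
    U 0 i j = onGrid J₁ J₂ u₀ i j
  initU1 : ∀ i ∈ Finset.Icc 1 (2 * J₁ - 1), ∀ j ∈ Finset.Icc 1 (2 * J₂ - 1),
    dt τ U 1 i j = onGrid J₁ J₂ u₁ i j + τ / 2 * onGrid J₁ J₂ (secondInit P f u₀ u₁) i j
  initV0 : ∀ i ∈ Finset.Icc 1 (2 * J₁ - 1), ∀ j ∈ Finset.Icc 1 (2 * J₂ - 1),
    V 0 i j = onGrid J₁ J₂ (lap u₀) i j
  initV1 : ∀ i ∈ Finset.Icc 1 (2 * J₁ - 1), ∀ j ∈ Finset.Icc 1 (2 * J₂ - 1),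
    V 1 i j = onGrid J₁ J₂ (lap (firstStep P f u₀ u₁ τ)) i j

end

end PlateScheme

namespace PlateScheme

noncomputable section

/-! ### Grid functions vanishing on the boundary and nine-point stencils -/

/-! Let e = u − U and η = v − V at the grid points. If the first error equation is tested with the
mean velocity of e and the second with the mean of η, the coupling terms cancel, because Φ is
symmetric on grid functions that vanish on the boundary (`gridInner_opPhi_comm`), and the damping
term has a favourable sign because P > 0. What remains controls the growth of ⟨𝓗δₜe, δₜe⟩ + ½⟨𝓗ηⁿ⁺¹,
ηⁿ⁺¹⟩ + ½⟨𝓗ηⁿ, ηⁿ⟩. As 𝓗 is positive definite uniformly in the mesh (`gridNorm_sq_le_innerH`), this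
energy dominates the three norms to be estimated.

Consistency in space is of fourth order, by the choice of the compact weights
(`abs_opH_sub_opPhi_le`). In time there is an obstacle: replacing vⁿ by its average ṽⁿ inside Φ
would call for a bound on ∂ₜ²Δ²u, which is not among the hypotheses. Therefore Gⁿ = ṽⁿ − vⁿ is not
treated as a residual. It is subtracted from η, and the energy of η − G is followed instead. Then
only the change of G over a time step matters, and this is O(τ³) by the bound on ∂ₜ³Δu
(`energy_step`).

The nonlocal coefficient is handled by the Lipschitz continuity of P. The square of ‖·‖_F is
Simpson's rule, with error O(h⁴) for (Δu)² (`abs_simpson_square_le`), and ‖v‖_F² − ‖V‖_F² is at most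
a multiple of ‖v − V‖(‖v‖ + ‖V‖) (`abs_normF_sq_sub_le`). The norm of V is bounded beforehand by the
same energy argument applied to the scheme itself (`norm_bound_of_scheme`), whatever the size of the
damping.

The coefficient at time n involves only Vⁿ, which the energy of the previous step already controls,
so a discrete Gronwall inequality closes the estimate without any smallness of τ
(`exists_error_bound`). -/

/-- The grid function `w` vanishes at the boundary points of the grid. -/
structure VanishesOnBoundary (J₁ J₂ : ℕ) (w : ℕ → ℕ → ℝ) : Prop where
  left : ∀ j ≤ 2 * J₂, w 0 j = 0
  right : ∀ j ≤ 2 * J₂, w (2 * J₁) j = 0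
  bottom : ∀ i ≤ 2 * J₁, w i 0 = 0
  top : ∀ i ≤ 2 * J₁, w i (2 * J₂) = 0

/-- `(i, j)` is an interior grid point. -/
def Interior (J₁ J₂ i j : ℕ) : Prop :=
  i ∈ Finset.Icc 1 (2 * J₁ - 1) ∧ j ∈ Finset.Icc 1 (2 * J₂ - 1)

/-- The sum of the two horizontal neighbours. -/
def nbrX (w : ℕ → ℕ → ℝ) : ℕ → ℕ → ℝ := fun i j => w (i + 1) j + w (i - 1) j

/-- The sum of the two vertical neighbours. -/
def nbrY (w : ℕ → ℕ → ℝ) : ℕ → ℕ → ℝ := fun i j => w i (j + 1) + w i (j - 1)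

/-- A symmetric nine-point stencil. -/
def stencil (a b c d : ℝ) (w : ℕ → ℕ → ℝ) : ℕ → ℕ → ℝ :=
  fun i j => a * w i j + b * nbrX w i j + c * nbrY w i j + d * nbrX (nbrY w) i j

/-- On interior points 𝓗 and Φ are both symmetric nine-point stencils, so linearity and symmetry can
be proved for `stencil` alone. On the edges this fails: there 𝓐 or 𝓑 is the identity, and `i - 1` is
truncated at 0. -/
theorem opH_eq_stencil {J₁ J₂ i j : ℕ} (w : ℕ → ℕ → ℝ) (h : Interior J₁ J₂ i j) :
    opH J₁ J₂ w i j = stencil (100 / 144) (10 / 144) (10 / 144) (1 / 144) w i j := by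
  obtain ⟨hi, hj⟩ := h
  rw [Finset.mem_Icc] at hi hj
  have hi' : 1 ≤ i ∧ i + 1 ≤ 2 * J₁ := by omega
  have hj' : 1 ≤ j ∧ j + 1 ≤ 2 * J₂ := by omega
  simp only [opH, opA, opB, stencil, nbrX, nbrY, if_pos hi', if_pos hj']
  ring

theorem opPhi_eq_stencil {J₁ J₂ i j : ℕ} (w : ℕ → ℕ → ℝ) (h : Interior J₁ J₂ i j) :
    opPhi J₁ J₂ w i j = stencil
      (-(20 / 12) * ((step J₁)⁻¹ ^ 2 + (step J₂)⁻¹ ^ 2))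
      (10 / 12 * (step J₁)⁻¹ ^ 2 - 2 / 12 * (step J₂)⁻¹ ^ 2)
      (10 / 12 * (step J₂)⁻¹ ^ 2 - 2 / 12 * (step J₁)⁻¹ ^ 2)
      (1 / 12 * ((step J₁)⁻¹ ^ 2 + (step J₂)⁻¹ ^ 2)) w i j := by
  obtain ⟨hi, hj⟩ := h
  rw [Finset.mem_Icc] at hi hj
  have hi' : 1 ≤ i ∧ i + 1 ≤ 2 * J₁ := by omega
  have hj' : 1 ≤ j ∧ j + 1 ≤ 2 * J₂ := by omega
  simp only [opPhi, opA, opB, stencil, nbrX, nbrY, if_pos hi', if_pos hj', secX, secY, fwdX, fwdY,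
    bwdX, bwdY, div_eq_mul_inv]
  ring

theorem step_pos {J : ℕ} (hJ : 1 ≤ J) : 0 < step J := by
  have : (0 : ℝ) < J := by exact_mod_cast hJ
  unfold step; positivity

theorem step_mul {J : ℕ} (hJ : 1 ≤ J) : ((2 * J : ℕ) : ℝ) * step J = 1 := by
  have : (0 : ℝ) < J := by exact_mod_cast hJ
  unfold step; push_cast; field_simp

/-! ### Summation by parts -/

/-- Discrete Green formula: the difference of the summands is an increment of w(i+1) z(i) − w(i)
z(i+1), which is zero at both ends. -/
theorem sum_nbr_mul_symm {M : ℕ} (hM : 1 ≤ M) {w z : ℕ → ℝ} (hw0 : w 0 = 0) (hwM : w M = 0)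
    (hz0 : z 0 = 0) (hzM : z M = 0) :
    ∑ i ∈ Finset.Icc 1 (M - 1), (w (i + 1) + w (i - 1)) * z i
      = ∑ i ∈ Finset.Icc 1 (M - 1), w i * (z (i + 1) + z (i - 1)) := by
  obtain ⟨m, rfl⟩ : ∃ m, M = m + 1 := ⟨M - 1, by omega⟩
  rw [← sub_eq_zero, ← Finset.sum_sub_distrib, Nat.add_sub_cancel, ← Finset.Ico_add_one_right_eq_Icc,
    Finset.sum_Ico_eq_sum_range, Nat.add_sub_cancel]
  have h := Finset.sum_range_sub (fun i => w (i + 1) * z i - w i * z (i + 1)) m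
  simp only [hw0, hwM, hz0, hzM, mul_zero, zero_mul, sub_zero, zero_add] at h
  rw [← h]
  refine Finset.sum_congr rfl fun i _ => ?_
  rw [Nat.add_comm 1 i, Nat.add_sub_cancel]
  ring

/-- The difference of the two sides is a telescoping sum of second differences, equal to −q(M−1) −
q(1). -/
theorem sum_nbr_le {M : ℕ} (hM : 1 ≤ M) {q : ℕ → ℝ} (hq : ∀ i, 0 ≤ q i) (hq0 : q 0 = 0)
    (hqM : q M = 0) :
    ∑ i ∈ Finset.Icc 1 (M - 1), (q (i + 1) + q (i - 1))
      ≤ 2 * ∑ i ∈ Finset.Icc 1 (M - 1), q i := by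
  obtain ⟨m, rfl⟩ : ∃ m, M = m + 1 := ⟨M - 1, by omega⟩
  rw [← sub_nonpos, Finset.mul_sum, ← Finset.sum_sub_distrib, Nat.add_sub_cancel,
    ← Finset.Ico_add_one_right_eq_Icc, Finset.sum_Ico_eq_sum_range, Nat.add_sub_cancel]
  have h := Finset.sum_range_sub (fun i => q (i + 1) - q i) m
  have h' : ∑ i ∈ Finset.range m, (q (1 + i + 1) + q (1 + i - 1) - 2 * q (1 + i))
      = ∑ i ∈ Finset.range m, ((q (i + 1 + 1) - q (i + 1)) - (q (i + 1) - q i)) := by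
    refine Finset.sum_congr rfl fun i _ => ?_
    rw [Nat.add_comm 1 i, Nat.add_sub_cancel]
    ring
  rw [h', h]
  simp only [zero_add]
  linarith [hq m, hq 1]

/-- The sum over the interior grid points. -/
def gridSum (J₁ J₂ : ℕ) (w : ℕ → ℕ → ℝ) : ℝ :=
  ∑ i ∈ Finset.Icc 1 (2 * J₁ - 1), ∑ j ∈ Finset.Icc 1 (2 * J₂ - 1), w i j

theorem gridSum_congr {J₁ J₂ : ℕ} {w z : ℕ → ℕ → ℝ}
    (h : ∀ i j, Interior J₁ J₂ i j → w i j = z i j) : gridSum J₁ J₂ w = gridSum J₁ J₂ z :=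
  Finset.sum_congr rfl fun i hi => Finset.sum_congr rfl fun j hj => h i j ⟨hi, hj⟩

theorem gridSum_le {J₁ J₂ : ℕ} {w z : ℕ → ℕ → ℝ}
    (h : ∀ i j, Interior J₁ J₂ i j → w i j ≤ z i j) : gridSum J₁ J₂ w ≤ gridSum J₁ J₂ z :=
  Finset.sum_le_sum fun i hi => Finset.sum_le_sum fun j hj => h i j ⟨hi, hj⟩

theorem gridSum_add (J₁ J₂ : ℕ) (w z : ℕ → ℕ → ℝ) :
    gridSum J₁ J₂ (fun i j => w i j + z i j) = gridSum J₁ J₂ w + gridSum J₁ J₂ z := by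
  simp only [gridSum, Finset.sum_add_distrib]

theorem gridSum_mul_left (J₁ J₂ : ℕ) (c : ℝ) (w : ℕ → ℕ → ℝ) :
    gridSum J₁ J₂ (fun i j => c * w i j) = c * gridSum J₁ J₂ w := by
  simp only [gridSum, Finset.mul_sum]

theorem gridSum_comm (J₁ J₂ : ℕ) (w : ℕ → ℕ → ℝ) :
    gridSum J₁ J₂ w = ∑ j ∈ Finset.Icc 1 (2 * J₂ - 1), ∑ i ∈ Finset.Icc 1 (2 * J₁ - 1), w i j :=
  Finset.sum_comm

/-- The edge conditions are asked only at interior j. This admits `nbrY w`, which vanishes on the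
left and right edges but in general not on the other two. -/
theorem gridSum_nbrX_mul {J₁ J₂ : ℕ} (h₁ : 1 ≤ J₁) {w z : ℕ → ℕ → ℝ}
    (hw : ∀ j ∈ Finset.Icc 1 (2 * J₂ - 1), w 0 j = 0 ∧ w (2 * J₁) j = 0)
    (hz : ∀ j ∈ Finset.Icc 1 (2 * J₂ - 1), z 0 j = 0 ∧ z (2 * J₁) j = 0) :
    gridSum J₁ J₂ (fun i j => nbrX w i j * z i j)
      = gridSum J₁ J₂ (fun i j => w i j * nbrX z i j) := by
  rw [gridSum_comm, gridSum_comm]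
  refine Finset.sum_congr rfl fun j hj => ?_
  exact sum_nbr_mul_symm (w := fun i => w i j) (z := fun i => z i j) (by omega)
    (hw j hj).1 (hw j hj).2 (hz j hj).1 (hz j hj).2

theorem gridSum_nbrY_mul {J₁ J₂ : ℕ} (h₂ : 1 ≤ J₂) {w z : ℕ → ℕ → ℝ}
    (hw : ∀ i ∈ Finset.Icc 1 (2 * J₁ - 1), w i 0 = 0 ∧ w i (2 * J₂) = 0)
    (hz : ∀ i ∈ Finset.Icc 1 (2 * J₁ - 1), z i 0 = 0 ∧ z i (2 * J₂) = 0) :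
    gridSum J₁ J₂ (fun i j => nbrY w i j * z i j)
      = gridSum J₁ J₂ (fun i j => w i j * nbrY z i j) := by
  refine Finset.sum_congr rfl fun i hi => ?_
  exact sum_nbr_mul_symm (w := fun j => w i j) (z := fun j => z i j) (by omega)
    (hw i hi).1 (hw i hi).2 (hz i hi).1 (hz i hi).2

theorem gridSum_nbrX_le {J₁ J₂ : ℕ} (h₁ : 1 ≤ J₁) {q : ℕ → ℕ → ℝ} (hq : ∀ i j, 0 ≤ q i j)
    (hw : ∀ j ∈ Finset.Icc 1 (2 * J₂ - 1), q 0 j = 0 ∧ q (2 * J₁) j = 0) :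
    gridSum J₁ J₂ (nbrX q) ≤ 2 * gridSum J₁ J₂ q := by
  rw [gridSum_comm, gridSum_comm, Finset.mul_sum]
  refine Finset.sum_le_sum fun j hj => ?_
  exact sum_nbr_le (q := fun i => q i j) (by omega) (fun i => hq i j) (hw j hj).1 (hw j hj).2

theorem gridSum_nbrY_le {J₁ J₂ : ℕ} (h₂ : 1 ≤ J₂) {q : ℕ → ℕ → ℝ} (hq : ∀ i j, 0 ≤ q i j)
    (hw : ∀ i ∈ Finset.Icc 1 (2 * J₁ - 1), q i 0 = 0 ∧ q i (2 * J₂) = 0) :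
    gridSum J₁ J₂ (nbrY q) ≤ 2 * gridSum J₁ J₂ q := by
  rw [gridSum, gridSum, Finset.mul_sum]
  refine Finset.sum_le_sum fun i hi => ?_
  exact sum_nbr_le (q := fun j => q i j) (by omega) (fun j => hq i j) (hw i hi).1 (hw i hi).2

namespace VanishesOnBoundary

variable {J₁ J₂ : ℕ} {w z : ℕ → ℕ → ℝ}

theorem edgeX (hw : VanishesOnBoundary J₁ J₂ w) :
    ∀ j ∈ Finset.Icc 1 (2 * J₂ - 1), w 0 j = 0 ∧ w (2 * J₁) j = 0 := fun j hj => by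
  rw [Finset.mem_Icc] at hj
  exact ⟨hw.left j (by omega), hw.right j (by omega)⟩

theorem edgeY (hw : VanishesOnBoundary J₁ J₂ w) :
    ∀ i ∈ Finset.Icc 1 (2 * J₁ - 1), w i 0 = 0 ∧ w i (2 * J₂) = 0 := fun i hi => by
  rw [Finset.mem_Icc] at hi
  exact ⟨hw.bottom i (by omega), hw.top i (by omega)⟩

theorem edgeX_nbrY (hw : VanishesOnBoundary J₁ J₂ w) :
    ∀ j ∈ Finset.Icc 1 (2 * J₂ - 1), nbrY w 0 j = 0 ∧ nbrY w (2 * J₁) j = 0 := fun j hj => by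
  rw [Finset.mem_Icc] at hj
  simp [nbrY, hw.left (j + 1) (by omega), hw.left (j - 1) (by omega),
    hw.right (j + 1) (by omega), hw.right (j - 1) (by omega)]

theorem edgeY_nbrX (hw : VanishesOnBoundary J₁ J₂ w) :
    ∀ i ∈ Finset.Icc 1 (2 * J₁ - 1), nbrX w i 0 = 0 ∧ nbrX w i (2 * J₂) = 0 := fun i hi => by
  rw [Finset.mem_Icc] at hi
  simp [nbrX, hw.bottom (i + 1) (by omega), hw.bottom (i - 1) (by omega),
    hw.top (i + 1) (by omega), hw.top (i - 1) (by omega)]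

theorem linComb (hw : VanishesOnBoundary J₁ J₂ w) (hz : VanishesOnBoundary J₁ J₂ z) (a b : ℝ) :
    VanishesOnBoundary J₁ J₂ (fun i j => a * w i j + b * z i j) where
  left j hj := by simp [hw.left j hj, hz.left j hj]
  right j hj := by simp [hw.right j hj, hz.right j hj]
  bottom i hi := by simp [hw.bottom i hi, hz.bottom i hi]
  top i hi := by simp [hw.top i hi, hz.top i hi]

theorem sq (hw : VanishesOnBoundary J₁ J₂ w) :
    VanishesOnBoundary J₁ J₂ (fun i j => w i j ^ 2) where
  left j hj := by simp [hw.left j hj]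
  right j hj := by simp [hw.right j hj]
  bottom i hi := by simp [hw.bottom i hi]
  top i hi := by simp [hw.top i hi]

theorem sub (hw : VanishesOnBoundary J₁ J₂ w) (hz : VanishesOnBoundary J₁ J₂ z) :
    VanishesOnBoundary J₁ J₂ (fun i j => w i j - z i j) := by
  simpa [sub_eq_add_neg] using hw.linComb hz 1 (-1)

end VanishesOnBoundary

/-- Both neighbour sums are symmetric and they commute, so their composition is symmetric too. -/
theorem gridSum_stencil_mul {J₁ J₂ : ℕ} (h₁ : 1 ≤ J₁) (h₂ : 1 ≤ J₂) {w z : ℕ → ℕ → ℝ}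
    (hw : VanishesOnBoundary J₁ J₂ w) (hz : VanishesOnBoundary J₁ J₂ z) (a b c d : ℝ) :
    gridSum J₁ J₂ (fun i j => stencil a b c d w i j * z i j)
      = gridSum J₁ J₂ (fun i j => stencil a b c d z i j * w i j) := by
  have expand : ∀ w z : ℕ → ℕ → ℝ, gridSum J₁ J₂ (fun i j => stencil a b c d w i j * z i j)
      = a * gridSum J₁ J₂ (fun i j => w i j * z i j)
        + b * gridSum J₁ J₂ (fun i j => nbrX w i j * z i j)
        + c * gridSum J₁ J₂ (fun i j => nbrY w i j * z i j)
        + d * gridSum J₁ J₂ (fun i j => nbrX (nbrY w) i j * z i j) := fun w z => by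
    simp only [← gridSum_mul_left, ← gridSum_add]
    refine gridSum_congr fun i j _ => ?_
    simp only [stencil]; ring
  have hcomm : ∀ w z : ℕ → ℕ → ℝ, gridSum J₁ J₂ (fun i j => w i j * z i j)
      = gridSum J₁ J₂ (fun i j => z i j * w i j) := fun w z =>
    gridSum_congr fun i j _ => mul_comm _ _
  have hxy : nbrY (nbrX z) = nbrX (nbrY z) := by
    funext i j; simp only [nbrX, nbrY]; ring
  rw [expand, expand, gridSum_nbrX_mul h₁ hw.edgeX hz.edgeX, gridSum_nbrY_mul h₂ hw.edgeY hz.edgeY,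
    gridSum_nbrX_mul h₁ hw.edgeX_nbrY hz.edgeX, gridSum_nbrY_mul h₂ hw.edgeY hz.edgeY_nbrX, hxy,
    hcomm w z, hcomm w, hcomm w, hcomm w]

/-- Each product of neighbouring values is at least minus half the sum of their squares, and the
sums of neighbouring squares are at most 2 (straight) or 4 (diagonal) times the sum of squares. This
leaves 100/144 − 44/288 − 44/288 = 7/18. -/
theorem gridSum_stencil_self_ge {J₁ J₂ : ℕ} (h₁ : 1 ≤ J₁) (h₂ : 1 ≤ J₂) {w : ℕ → ℕ → ℝ}
    (hw : VanishesOnBoundary J₁ J₂ w) :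
    7 / 18 * gridSum J₁ J₂ (fun i j => w i j ^ 2)
      ≤ gridSum J₁ J₂
        (fun i j => stencil (100 / 144) (10 / 144) (10 / 144) (1 / 144) w i j * w i j) := by
  set q : ℕ → ℕ → ℝ := fun i j => w i j ^ 2 with hq
  have hq0 : ∀ i j, 0 ≤ q i j := fun i j => sq_nonneg _
  have hX := gridSum_nbrX_le h₁ hq0 hw.sq.edgeX
  have hY := gridSum_nbrY_le h₂ hq0 hw.sq.edgeY
  have hXY := gridSum_nbrX_le (q := nbrY q) h₁ (fun i j => add_nonneg (hq0 _ _) (hq0 _ _))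
    hw.sq.edgeX_nbrY
  have key : gridSum J₁ J₂ (fun i j => (100 / 144 - 40 / 288 - 4 / 288) * q i j
        + (-(10 / 288) * nbrX q i j + (-(10 / 288) * nbrY q i j
          + -(1 / 288) * nbrX (nbrY q) i j)))
      ≤ gridSum J₁ J₂
        (fun i j => stencil (100 / 144) (10 / 144) (10 / 144) (1 / 144) w i j * w i j) := by
    refine gridSum_le fun i j _ => ?_
    simp only [stencil, nbrX, nbrY, hq]
    nlinarith [sq_nonneg (w i j + w (i + 1) j), sq_nonneg (w i j + w (i - 1) j),
      sq_nonneg (w i j + w i (j + 1)), sq_nonneg (w i j + w i (j - 1)),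
      sq_nonneg (w i j + w (i + 1) (j + 1)), sq_nonneg (w i j + w (i - 1) (j + 1)),
      sq_nonneg (w i j + w (i + 1) (j - 1)), sq_nonneg (w i j + w (i - 1) (j - 1))]
  rw [gridSum_add, gridSum_add, gridSum_add] at key
  simp only [gridSum_mul_left] at key
  linarith

/-! ### The discrete inner product -/

theorem gridInner_eq (J₁ J₂ : ℕ) (w z : ℕ → ℕ → ℝ) :
    gridInner J₁ J₂ w z = step J₁ * step J₂ * gridSum J₁ J₂ (fun i j => w i j * z i j) := rfl

theorem step_mul_step_nonneg (J₁ J₂ : ℕ) : 0 ≤ step J₁ * step J₂ := by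
  unfold step; positivity

theorem gridInner_congr {J₁ J₂ : ℕ} {w w' z z' : ℕ → ℕ → ℝ}
    (h : ∀ i j, Interior J₁ J₂ i j → w i j * z i j = w' i j * z' i j) :
    gridInner J₁ J₂ w z = gridInner J₁ J₂ w' z' := by
  rw [gridInner_eq, gridInner_eq, gridSum_congr h]

theorem gridInner_linComb_left (J₁ J₂ : ℕ) (a b : ℝ) (w w' z : ℕ → ℕ → ℝ) :
    gridInner J₁ J₂ (fun i j => a * w i j + b * w' i j) z
      = a * gridInner J₁ J₂ w z + b * gridInner J₁ J₂ w' z := by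
  have : gridSum J₁ J₂ (fun i j => (a * w i j + b * w' i j) * z i j)
      = a * gridSum J₁ J₂ (fun i j => w i j * z i j)
        + b * gridSum J₁ J₂ (fun i j => w' i j * z i j) := by
    rw [← gridSum_mul_left, ← gridSum_mul_left, ← gridSum_add]
    exact gridSum_congr fun i j _ => by ring
  rw [gridInner_eq, gridInner_eq, gridInner_eq, this]; ring

theorem gridInner_comm (J₁ J₂ : ℕ) (w z : ℕ → ℕ → ℝ) :
    gridInner J₁ J₂ w z = gridInner J₁ J₂ z w :=
  gridInner_congr fun _ _ _ => mul_comm _ _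

theorem gridInner_linComb_right (J₁ J₂ : ℕ) (a b : ℝ) (w z z' : ℕ → ℕ → ℝ) :
    gridInner J₁ J₂ w (fun i j => a * z i j + b * z' i j)
      = a * gridInner J₁ J₂ w z + b * gridInner J₁ J₂ w z' := by
  rw [gridInner_comm, gridInner_linComb_left, gridInner_comm _ _ z, gridInner_comm _ _ z']

theorem gridInner_self_nonneg (J₁ J₂ : ℕ) (w : ℕ → ℕ → ℝ) : 0 ≤ gridInner J₁ J₂ w w :=
  mul_nonneg (step_mul_step_nonneg _ _) <|
    Finset.sum_nonneg fun _ _ => Finset.sum_nonneg fun _ _ => mul_self_nonneg _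

theorem gridNorm_nonneg (J₁ J₂ : ℕ) (w : ℕ → ℕ → ℝ) : 0 ≤ gridNorm J₁ J₂ w := Real.sqrt_nonneg _

theorem gridNorm_sq (J₁ J₂ : ℕ) (w : ℕ → ℕ → ℝ) :
    gridNorm J₁ J₂ w ^ 2 = gridInner J₁ J₂ w w :=
  Real.sq_sqrt (gridInner_self_nonneg _ _ _)

theorem gridInner_le (J₁ J₂ : ℕ) (w z : ℕ → ℕ → ℝ) :
    gridInner J₁ J₂ w z ≤ gridNorm J₁ J₂ w * gridNorm J₁ J₂ z := by
  rw [gridNorm, gridNorm, ← Real.sqrt_mul (gridInner_self_nonneg _ _ _)]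
  refine Real.le_sqrt_of_sq_le ?_
  have h := Finset.sum_mul_sq_le_sq_mul_sq
    (Finset.Icc 1 (2 * J₁ - 1) ×ˢ Finset.Icc 1 (2 * J₂ - 1))
    (fun p => w p.1 p.2) (fun p => z p.1 p.2)
  simp only [Finset.sum_product, pow_two (w _ _), pow_two (z _ _)] at h
  have := mul_le_mul_of_nonneg_left h (sq_nonneg (step J₁ * step J₂))
  simp only [gridInner]
  linarith

/-- The cells h₁h₂ attached to the interior points have total area at most one. Hence pointwise
bounds are also bounds in the discrete norm. -/
theorem gridSum_one_le {J₁ J₂ : ℕ} (h₁ : 1 ≤ J₁) (h₂ : 1 ≤ J₂) {c : ℝ} (hc : 0 ≤ c) :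
    step J₁ * step J₂ * gridSum J₁ J₂ (fun _ _ => c) ≤ c := by
  have e₁ := step_mul h₁
  have e₂ := step_mul h₂
  have p₁ := step_pos h₁
  have p₂ := step_pos h₂
  have n₁ : (((2 * J₁ - 1 : ℕ) : ℝ)) * step J₁ ≤ 1 := by
    rw [← e₁]; gcongr; omega
  have n₂ : (((2 * J₂ - 1 : ℕ) : ℝ)) * step J₂ ≤ 1 := by
    rw [← e₂]; gcongr; omega
  have : gridSum J₁ J₂ (fun _ _ => c) = ((2 * J₁ - 1 : ℕ) : ℝ) * ((2 * J₂ - 1 : ℕ) : ℝ) * c := by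
    simp [gridSum, mul_assoc]
  rw [this]
  calc step J₁ * step J₂ * (((2 * J₁ - 1 : ℕ) : ℝ) * ((2 * J₂ - 1 : ℕ) : ℝ) * c)
      = (((2 * J₁ - 1 : ℕ) : ℝ) * step J₁) * (((2 * J₂ - 1 : ℕ) : ℝ) * step J₂) * c := by ring
    _ ≤ 1 * 1 * c := by gcongr
    _ = c := by ring

theorem gridNorm_le_of_abs_le {J₁ J₂ : ℕ} (h₁ : 1 ≤ J₁) (h₂ : 1 ≤ J₂) {w : ℕ → ℕ → ℝ} {c : ℝ}
    (hc : 0 ≤ c) (h : ∀ i j, Interior J₁ J₂ i j → |w i j| ≤ c) : gridNorm J₁ J₂ w ≤ c := by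
  refine Real.sqrt_le_iff.2 ⟨hc, ?_⟩
  refine le_trans ?_ (gridSum_one_le h₁ h₂ (sq_nonneg c))
  rw [gridInner_eq]
  refine mul_le_mul_of_nonneg_left (gridSum_le fun i j hij => ?_) (step_mul_step_nonneg _ _)
  have := abs_le.1 (h i j hij)
  nlinarith

theorem gridNorm_sub_le (J₁ J₂ : ℕ) (w z : ℕ → ℕ → ℝ) :
    gridNorm J₁ J₂ (fun i j => w i j - z i j) ≤ gridNorm J₁ J₂ w + gridNorm J₁ J₂ z := by
  have e : (fun i j => w i j - z i j) = fun i j => 1 * w i j + (-1) * z i j := by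
    funext i j; ring
  refine abs_le_of_sq_le_sq' ?_ (add_nonneg (gridNorm_nonneg _ _ _) (gridNorm_nonneg _ _ _)) |>.2
  -- Here −w is written as a linear combination, so that Cauchy–Schwarz gives a lower bound for ⟨w,
  -- z⟩.
  have h := gridInner_le J₁ J₂ (fun i j => -1 * w i j + 0 * w i j) z
  have hn : gridNorm J₁ J₂ (fun i j => -1 * w i j + 0 * w i j) = gridNorm J₁ J₂ w := by
    rw [gridNorm, gridNorm]; congr 1
    exact gridInner_congr fun _ _ _ => by ring
  rw [hn, gridInner_linComb_left] at h
  rw [gridNorm_sq, e, gridInner_linComb_left, gridInner_linComb_right, gridInner_linComb_right,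
    gridInner_comm _ _ z w, ← gridNorm_sq, ← gridNorm_sq]
  nlinarith

theorem gridNorm_add_le (J₁ J₂ : ℕ) (w z : ℕ → ℕ → ℝ) :
    gridNorm J₁ J₂ (fun i j => w i j + z i j) ≤ gridNorm J₁ J₂ w + gridNorm J₁ J₂ z := by
  have h := gridNorm_sub_le J₁ J₂ w (fun i j => - z i j)
  have hn : gridNorm J₁ J₂ (fun i j => - z i j) = gridNorm J₁ J₂ z := by
    rw [gridNorm, gridNorm]; congr 1
    exact gridInner_congr fun _ _ _ => by ring
  simpa [hn] using h

/-! ### The discrete energy -/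

theorem opH_linComb {J₁ J₂ i j : ℕ} (h : Interior J₁ J₂ i j) (a b : ℝ) (w z : ℕ → ℕ → ℝ) :
    opH J₁ J₂ (fun i j => a * w i j + b * z i j) i j
      = a * opH J₁ J₂ w i j + b * opH J₁ J₂ z i j := by
  simp only [opH_eq_stencil _ h, stencil, nbrX, nbrY]; ring

theorem opPhi_linComb {J₁ J₂ i j : ℕ} (h : Interior J₁ J₂ i j) (a b : ℝ) (w z : ℕ → ℕ → ℝ) :
    opPhi J₁ J₂ (fun i j => a * w i j + b * z i j) i j
      = a * opPhi J₁ J₂ w i j + b * opPhi J₁ J₂ z i j := by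
  simp only [opPhi_eq_stencil _ h, stencil, nbrX, nbrY]; ring

theorem Interior.bounds {J₁ J₂ i j : ℕ} (h : Interior J₁ J₂ i j) :
    1 ≤ i ∧ i + 1 ≤ 2 * J₁ ∧ 1 ≤ j ∧ j + 1 ≤ 2 * J₂ := by
  obtain ⟨hi, hj⟩ := h
  rw [Finset.mem_Icc] at hi hj
  omega

/-- The weights of 𝓗 are nonnegative and add up to one. -/
theorem abs_opH_le {J₁ J₂ i j : ℕ} (h : Interior J₁ J₂ i j) {w : ℕ → ℕ → ℝ} {c : ℝ}
    (hw : ∀ i ≤ 2 * J₁, ∀ j ≤ 2 * J₂, |w i j| ≤ c) : |opH J₁ J₂ w i j| ≤ c := by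
  obtain ⟨hi, hi', hj, hj'⟩ := h.bounds
  have b := fun i j hi hj => abs_le.1 (hw i hi j hj)
  have b0 := b i j (by omega) (by omega)
  have b1 := b (i + 1) j (by omega) (by omega)
  have b2 := b (i - 1) j (by omega) (by omega)
  have b3 := b i (j + 1) (by omega) (by omega)
  have b4 := b i (j - 1) (by omega) (by omega)
  have b5 := b (i + 1) (j + 1) (by omega) (by omega)
  have b6 := b (i + 1) (j - 1) (by omega) (by omega)
  have b7 := b (i - 1) (j + 1) (by omega) (by omega)
  have b8 := b (i - 1) (j - 1) (by omega) (by omega)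
  rw [opH_eq_stencil _ h, abs_le]
  simp only [stencil, nbrX, nbrY]
  constructor <;> linarith

/-- The bilinear form `⟨𝓗 w, z⟩`. -/
def innerH (J₁ J₂ : ℕ) (w z : ℕ → ℕ → ℝ) : ℝ := gridInner J₁ J₂ (opH J₁ J₂ w) z

section

variable {J₁ J₂ : ℕ} (h₁ : 1 ≤ J₁) (h₂ : 1 ≤ J₂) {w z : ℕ → ℕ → ℝ}
include h₁ h₂

theorem innerH_comm (hw : VanishesOnBoundary J₁ J₂ w) (hz : VanishesOnBoundary J₁ J₂ z) :
    innerH J₁ J₂ w z = innerH J₁ J₂ z w := by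
  rw [innerH, innerH, gridInner_eq, gridInner_eq]
  congr 1
  have e : ∀ w z : ℕ → ℕ → ℝ, gridSum J₁ J₂ (fun i j => opH J₁ J₂ w i j * z i j)
      = gridSum J₁ J₂
        (fun i j => stencil (100 / 144) (10 / 144) (10 / 144) (1 / 144) w i j * z i j) :=
    fun w z => gridSum_congr fun i j h => by rw [opH_eq_stencil _ h]
  rw [e, e, gridSum_stencil_mul h₁ h₂ hw hz]

theorem gridInner_opPhi_comm (hw : VanishesOnBoundary J₁ J₂ w) (hz : VanishesOnBoundary J₁ J₂ z) :
    gridInner J₁ J₂ (opPhi J₁ J₂ w) z = gridInner J₁ J₂ (opPhi J₁ J₂ z) w := by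
  rw [gridInner_eq, gridInner_eq]
  congr 1
  refine ((gridSum_congr fun i j h => by rw [opPhi_eq_stencil _ h]).trans
    (gridSum_stencil_mul h₁ h₂ hw hz _ _ _ _)).trans
    (gridSum_congr fun i j h => by rw [opPhi_eq_stencil _ h])

theorem gridNorm_sq_le_innerH (hw : VanishesOnBoundary J₁ J₂ w) :
    7 / 18 * gridNorm J₁ J₂ w ^ 2 ≤ innerH J₁ J₂ w w := by
  have e : gridSum J₁ J₂ (fun i j => opH J₁ J₂ w i j * w i j)
      = gridSum J₁ J₂
        (fun i j => stencil (100 / 144) (10 / 144) (10 / 144) (1 / 144) w i j * w i j) :=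
    gridSum_congr fun i j h => by rw [opH_eq_stencil _ h]
  have := mul_le_mul_of_nonneg_left (gridSum_stencil_self_ge h₁ h₂ hw)
    (step_mul_step_nonneg J₁ J₂)
  rw [gridNorm_sq, innerH, gridInner_eq, gridInner_eq, e]
  simp only [← pow_two (w _ _)]
  linarith

theorem innerH_self_nonneg (hw : VanishesOnBoundary J₁ J₂ w) : 0 ≤ innerH J₁ J₂ w w :=
  le_trans (by positivity) (gridNorm_sq_le_innerH h₁ h₂ hw)

theorem innerH_self_le {c : ℝ} (hc : 0 ≤ c) (hw : ∀ i ≤ 2 * J₁, ∀ j ≤ 2 * J₂, |w i j| ≤ c) :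
    innerH J₁ J₂ w w ≤ c ^ 2 := by
  have hH : gridNorm J₁ J₂ (opH J₁ J₂ w) ≤ c :=
    gridNorm_le_of_abs_le h₁ h₂ hc fun i j h => abs_opH_le h hw
  have hI : gridNorm J₁ J₂ w ≤ c := gridNorm_le_of_abs_le h₁ h₂ hc fun i j h => by
    obtain ⟨hi, hi', hj, hj'⟩ := h.bounds
    exact hw i (by omega) j (by omega)
  calc innerH J₁ J₂ w w ≤ gridNorm J₁ J₂ (opH J₁ J₂ w) * gridNorm J₁ J₂ w := gridInner_le _ _ _ _
    _ ≤ c * c := mul_le_mul hH hI (gridNorm_nonneg _ _ _) hc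
    _ = c ^ 2 := by ring

/-- Changing `w` by a pointwise small grid function changes `⟨𝓗 w, w⟩` little. -/
theorem innerH_add_le (hw : VanishesOnBoundary J₁ J₂ w) (hz : VanishesOnBoundary J₁ J₂ z) {c : ℝ}
    (hc : 0 ≤ c) (hzc : ∀ i ≤ 2 * J₁, ∀ j ≤ 2 * J₂, |z i j| ≤ c) :
    innerH J₁ J₂ (fun i j => w i j + z i j) (fun i j => w i j + z i j)
      ≤ innerH J₁ J₂ w w + 2 * c * gridNorm J₁ J₂ w + c ^ 2 := by
  have e : (fun i j => w i j + z i j) = fun i j => 1 * w i j + 1 * z i j := by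
    funext i j; ring
  have hH : gridNorm J₁ J₂ (opH J₁ J₂ z) ≤ c :=
    gridNorm_le_of_abs_le h₁ h₂ hc fun i j h => abs_opH_le h hzc
  have hzw : innerH J₁ J₂ z w ≤ c * gridNorm J₁ J₂ w :=
    (gridInner_le _ _ _ _).trans (mul_le_mul_of_nonneg_right hH (gridNorm_nonneg _ _ _))
  have hzz := innerH_self_le h₁ h₂ hc hzc
  have expand : innerH J₁ J₂ (fun i j => 1 * w i j + 1 * z i j) (fun i j => 1 * w i j + 1 * z i j)
      = innerH J₁ J₂ w w + innerH J₁ J₂ w z + innerH J₁ J₂ z w + innerH J₁ J₂ z z := by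
    rw [innerH, gridInner_linComb_right,
      gridInner_congr (w := opH J₁ J₂ fun i j => 1 * w i j + 1 * z i j) (z := w)
        fun i j h => by rw [opH_linComb h],
      gridInner_congr (w := opH J₁ J₂ fun i j => 1 * w i j + 1 * z i j) (z := z)
        fun i j h => by rw [opH_linComb h],
      gridInner_linComb_left, gridInner_linComb_left]
    simp only [innerH]; ring
  rw [e, expand, innerH_comm h₁ h₂ hw hz]
  linarith

end

/-- The energy inequality for one time step of the linearized scheme. -/
theorem innerH_step {J₁ J₂ : ℕ} (h₁ : 1 ≤ J₁) (h₂ : 1 ≤ J₂) {τ p : ℝ} (hτ : 0 < τ) (hp : 0 ≤ p)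
    {e₀ e₁ a b g s : ℕ → ℕ → ℝ} (he₀ : VanishesOnBoundary J₁ J₂ e₀)
    (he₁ : VanishesOnBoundary J₁ J₂ e₁) (ha : VanishesOnBoundary J₁ J₂ a)
    (hb : VanishesOnBoundary J₁ J₂ b)
    (hU : ∀ i j, Interior J₁ J₂ i j → opH J₁ J₂ (fun i j => (e₁ i j - e₀ i j) / τ) i j
      + p * opH J₁ J₂ (fun i j => (e₁ i j + e₀ i j) / 2) i j
      + opPhi J₁ J₂ (fun i j => (a i j + b i j) / 2) i j = g i j)
    (hV : ∀ i j, Interior J₁ J₂ i j → opH J₁ J₂ (fun i j => (a i j - b i j) / (2 * τ)) i j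
      = opPhi J₁ J₂ (fun i j => (e₁ i j + e₀ i j) / 2) i j + s i j) :
    innerH J₁ J₂ e₁ e₁ + 1 / 2 * innerH J₁ J₂ a a
      ≤ innerH J₁ J₂ e₀ e₀ + 1 / 2 * innerH J₁ J₂ b b
        + τ * (gridInner J₁ J₂ g e₁ + gridInner J₁ J₂ g e₀ + gridInner J₁ J₂ s a
          + gridInner J₁ J₂ s b) := by
  have hz : (fun i j => (e₁ i j + e₀ i j) / 2) = fun i j => 1 / 2 * e₁ i j + 1 / 2 * e₀ i j := by
    funext i j; ring
  have hm : (fun i j => (a i j + b i j) / 2) = fun i j => 1 / 2 * a i j + 1 / 2 * b i j := by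
    funext i j; ring
  have hdz : (fun i j => (e₁ i j - e₀ i j) / τ)
      = fun i j => 1 / τ * e₁ i j + (-(1 / τ)) * e₀ i j := by
    funext i j; ring
  have hdm : (fun i j => (a i j - b i j) / (2 * τ))
      = fun i j => 1 / (2 * τ) * a i j + (-(1 / (2 * τ))) * b i j := by
    funext i j; ring
  rw [hz, hm, hdz] at hU
  rw [hz, hdm] at hV
  -- These means are the test functions: paired with them, the time differences become differences
  -- of squares, since 𝓗 is symmetric.
  set z : ℕ → ℕ → ℝ := fun i j => 1 / 2 * e₁ i j + 1 / 2 * e₀ i j with z_def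
  set m : ℕ → ℕ → ℝ := fun i j => 1 / 2 * a i j + 1 / 2 * b i j with m_def
  have vz : VanishesOnBoundary J₁ J₂ z := he₁.linComb he₀ _ _
  have vm : VanishesOnBoundary J₁ J₂ m := ha.linComb hb _ _
  have key₁ : gridInner J₁ J₂ g z
      = (1 / τ * innerH J₁ J₂ e₁ z + -(1 / τ) * innerH J₁ J₂ e₀ z) + p * innerH J₁ J₂ z z
        + gridInner J₁ J₂ (opPhi J₁ J₂ m) z := by
    have e : gridInner J₁ J₂ g z = gridInner J₁ J₂ (fun i j => 1 *
        (fun i j => 1 * (fun i j => 1 / τ * opH J₁ J₂ e₁ i j + -(1 / τ) * opH J₁ J₂ e₀ i j) i j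
          + p * opH J₁ J₂ z i j) i j + 1 * opPhi J₁ J₂ m i j) z :=
      gridInner_congr fun i j h => by
        rw [← hU i j h, opH_linComb h]; ring
    rw [e, gridInner_linComb_left, gridInner_linComb_left, gridInner_linComb_left]
    simp only [innerH]; ring
  have key₂ : 1 / (2 * τ) * innerH J₁ J₂ a m + -(1 / (2 * τ)) * innerH J₁ J₂ b m
      = gridInner J₁ J₂ (opPhi J₁ J₂ z) m + gridInner J₁ J₂ s m := by
    have e : gridInner J₁ J₂
        (fun i j => 1 / (2 * τ) * opH J₁ J₂ a i j + -(1 / (2 * τ)) * opH J₁ J₂ b i j) m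
        = gridInner J₁ J₂ (fun i j => 1 * opPhi J₁ J₂ z i j + 1 * s i j) m :=
      gridInner_congr fun i j h => by
        have := hV i j h
        rw [opH_linComb h] at this
        rw [this]; ring
    rw [gridInner_linComb_left, gridInner_linComb_left] at e
    simp only [innerH]; linarith
  -- The coupling terms of the two tested equations are the same number, and it cancels. The damping
  -- term is nonnegative and is dropped.
  have key₃ := gridInner_opPhi_comm h₁ h₂ vm vz
  have nz : 0 ≤ p * innerH J₁ J₂ z z := mul_nonneg hp (innerH_self_nonneg h₁ h₂ vz)
  have x₁ : ∀ w, innerH J₁ J₂ w z = 1 / 2 * innerH J₁ J₂ w e₁ + 1 / 2 * innerH J₁ J₂ w e₀ :=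
    fun w => gridInner_linComb_right _ _ _ _ _ _ _
  have x₂ : ∀ w, innerH J₁ J₂ w m = 1 / 2 * innerH J₁ J₂ w a + 1 / 2 * innerH J₁ J₂ w b :=
    fun w => gridInner_linComb_right _ _ _ _ _ _ _
  have x₃ : gridInner J₁ J₂ g z = 1 / 2 * gridInner J₁ J₂ g e₁ + 1 / 2 * gridInner J₁ J₂ g e₀ :=
    gridInner_linComb_right _ _ _ _ _ _ _
  have x₄ : gridInner J₁ J₂ s m = 1 / 2 * gridInner J₁ J₂ s a + 1 / 2 * gridInner J₁ J₂ s b :=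
    gridInner_linComb_right _ _ _ _ _ _ _
  have s₁ := innerH_comm h₁ h₂ he₁ he₀
  have s₂ := innerH_comm h₁ h₂ ha hb
  rw [x₂, x₂, x₄, ← key₃] at key₂
  have t₁ : 1 / τ * innerH J₁ J₂ e₁ z + -(1 / τ) * innerH J₁ J₂ e₀ z
      = (innerH J₁ J₂ e₁ e₁ - innerH J₁ J₂ e₀ e₀) / (2 * τ) := by
    rw [x₁, x₁, s₁]; field_simp; ring
  have t₂ : 1 / (2 * τ) * (1 / 2 * innerH J₁ J₂ a a + 1 / 2 * innerH J₁ J₂ a b)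
      + -(1 / (2 * τ)) * (1 / 2 * innerH J₁ J₂ b a + 1 / 2 * innerH J₁ J₂ b b)
      = (1 / 2 * innerH J₁ J₂ a a - 1 / 2 * innerH J₁ J₂ b b) / (2 * τ) := by
    rw [s₂]; field_simp; ring
  rw [t₁, x₃] at key₁
  rw [t₂] at key₂
  have fin : (innerH J₁ J₂ e₁ e₁ - innerH J₁ J₂ e₀ e₀) / (2 * τ)
      + (1 / 2 * innerH J₁ J₂ a a - 1 / 2 * innerH J₁ J₂ b b) / (2 * τ)
      ≤ 1 / 2 * (gridInner J₁ J₂ g e₁ + gridInner J₁ J₂ g e₀ + gridInner J₁ J₂ s a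
          + gridInner J₁ J₂ s b) := by linarith
  rw [← add_div, div_le_iff₀ (by positivity)] at fin
  linarith

/-- The energy norm of the discrete velocity `e` and of two consecutive values `a`, `b`. -/
def energy (J₁ J₂ : ℕ) (e a b : ℕ → ℕ → ℝ) : ℝ :=
  √(innerH J₁ J₂ e e + 1 / 2 * innerH J₁ J₂ a a + 1 / 2 * innerH J₁ J₂ b b)

section

variable {J₁ J₂ : ℕ} (h₁ : 1 ≤ J₁) (h₂ : 1 ≤ J₂) {e a b : ℕ → ℕ → ℝ}

theorem energy_nonneg : 0 ≤ energy J₁ J₂ e a b := Real.sqrt_nonneg _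

include h₁ h₂

theorem energy_sq (he : VanishesOnBoundary J₁ J₂ e) (ha : VanishesOnBoundary J₁ J₂ a)
    (hb : VanishesOnBoundary J₁ J₂ b) :
    energy J₁ J₂ e a b ^ 2
      = innerH J₁ J₂ e e + 1 / 2 * innerH J₁ J₂ a a + 1 / 2 * innerH J₁ J₂ b b := by
  have := innerH_self_nonneg h₁ h₂ he
  have := innerH_self_nonneg h₁ h₂ ha
  have := innerH_self_nonneg h₁ h₂ hb
  exact Real.sq_sqrt (by positivity)

/-- Coercivity together with the weight ½ gives at worst the factor 36/7 between the squares, and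
36/7 < 9. -/
theorem gridNorm_le_energy (he : VanishesOnBoundary J₁ J₂ e) (ha : VanishesOnBoundary J₁ J₂ a)
    (hb : VanishesOnBoundary J₁ J₂ b) :
    gridNorm J₁ J₂ e ≤ 3 * energy J₁ J₂ e a b ∧ gridNorm J₁ J₂ a ≤ 3 * energy J₁ J₂ e a b
      ∧ gridNorm J₁ J₂ b ≤ 3 * energy J₁ J₂ e a b := by
  have hs := energy_sq h₁ h₂ he ha hb
  have e0 : 0 ≤ 3 * energy J₁ J₂ e a b := mul_nonneg (by norm_num) energy_nonneg
  have n1 := innerH_self_nonneg h₁ h₂ he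
  have n2 := innerH_self_nonneg h₁ h₂ ha
  have n3 := innerH_self_nonneg h₁ h₂ hb
  have m1 := gridNorm_sq_le_innerH h₁ h₂ he
  have m2 := gridNorm_sq_le_innerH h₁ h₂ ha
  have m3 := gridNorm_sq_le_innerH h₁ h₂ hb
  refine ⟨?_, ?_, ?_⟩ <;> refine (abs_le_of_sq_le_sq' ?_ e0).2 <;> nlinarith

theorem energy_le (he : VanishesOnBoundary J₁ J₂ e) (ha : VanishesOnBoundary J₁ J₂ a)
    (hb : VanishesOnBoundary J₁ J₂ b) {c : ℝ} (hc : 0 ≤ c)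
    (ec : ∀ i ≤ 2 * J₁, ∀ j ≤ 2 * J₂, |e i j| ≤ c) (ac : ∀ i ≤ 2 * J₁, ∀ j ≤ 2 * J₂, |a i j| ≤ c)
    (bc : ∀ i ≤ 2 * J₁, ∀ j ≤ 2 * J₂, |b i j| ≤ c) : energy J₁ J₂ e a b ≤ 2 * c := by
  refine (abs_le_of_sq_le_sq' ?_ (by positivity)).2
  rw [energy_sq h₁ h₂ he ha hb]
  have := innerH_self_le h₁ h₂ hc ec
  have := innerH_self_le h₁ h₂ hc ac
  have := innerH_self_le h₁ h₂ hc bc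
  nlinarith

/-- The growth of the energy in one time step of the linearized scheme, in which the variable `η`
enters the first equation with a shift `G`, which may vary with time. -/
theorem energy_step {τ p κ : ℝ} (hτ : 0 < τ) (hp : 0 ≤ p) (hκ : 0 ≤ κ)
    {e₀ e₁ η₀ η₁ η₂ G G' g s : ℕ → ℕ → ℝ} (he₀ : VanishesOnBoundary J₁ J₂ e₀)
    (he₁ : VanishesOnBoundary J₁ J₂ e₁) (hη₀ : VanishesOnBoundary J₁ J₂ η₀)
    (hη₁ : VanishesOnBoundary J₁ J₂ η₁) (hη₂ : VanishesOnBoundary J₁ J₂ η₂)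
    (hG : VanishesOnBoundary J₁ J₂ G) (hG' : VanishesOnBoundary J₁ J₂ G')
    (hGG : ∀ i ≤ 2 * J₁, ∀ j ≤ 2 * J₂, |G i j - G' i j| ≤ κ)
    (hU : ∀ i j, Interior J₁ J₂ i j → opH J₁ J₂ (fun i j => (e₁ i j - e₀ i j) / τ) i j
      + p * opH J₁ J₂ (fun i j => (e₁ i j + e₀ i j) / 2) i j
      + opPhi J₁ J₂ (fun i j => (η₂ i j + η₀ i j) / 2 - G i j) i j = g i j)
    (hV : ∀ i j, Interior J₁ J₂ i j → opH J₁ J₂ (fun i j => (η₂ i j - η₀ i j) / (2 * τ)) i j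
      = opPhi J₁ J₂ (fun i j => (e₁ i j + e₀ i j) / 2) i j + s i j) :
    energy J₁ J₂ e₁ (fun i j => η₂ i j - G i j) (fun i j => η₁ i j - G i j)
      ≤ energy J₁ J₂ e₀ (fun i j => η₁ i j - G' i j) (fun i j => η₀ i j - G' i j)
        + 3 * (κ + τ * (gridNorm J₁ J₂ g + gridNorm J₁ J₂ s)) := by
  have va := hη₂.sub hG
  have vc := hη₁.sub hG
  have vb := hη₀.sub hG
  have vc' := hη₁.sub hG'
  have vb' := hη₀.sub hG'
  -- The step relates only η₂ − G and η₀ − G; the middle value η₁ − G enters both energies with the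
  -- same weight. The same G is used at both ends, so it drops out of the second equation.
  have hstep := innerH_step (g := g) (s := s) h₁ h₂ hτ hp he₀ he₁ va vb
    (fun i j h => by
      rw [← hU i j h]
      congr 2
      funext i j; ring)
    (fun i j h => by
      rw [← hV i j h]
      congr 1
      funext i j; ring)
  set E₁ := energy J₁ J₂ e₁ (fun i j => η₂ i j - G i j) (fun i j => η₁ i j - G i j) with hE₁
  set E := energy J₁ J₂ e₀ (fun i j => η₁ i j - G i j) (fun i j => η₀ i j - G i j) with hE
  set E₀ := energy J₁ J₂ e₀ (fun i j => η₁ i j - G' i j) (fun i j => η₀ i j - G' i j) with hE₀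
  have nE₁ : 0 ≤ E₁ := energy_nonneg
  have nE : 0 ≤ E := energy_nonneg
  have nE₀ : 0 ≤ E₀ := energy_nonneg
  have sq₁ : E₁ ^ 2 = _ := energy_sq h₁ h₂ he₁ va vc
  have sq : E ^ 2 = _ := energy_sq h₁ h₂ he₀ vc vb
  have sq₀ : E₀ ^ 2 = _ := energy_sq h₁ h₂ he₀ vc' vb'
  obtain ⟨a1, a2, -⟩ := gridNorm_le_energy h₁ h₂ he₁ va vc
  obtain ⟨b1, -, b3⟩ := gridNorm_le_energy h₁ h₂ he₀ vc vb
  obtain ⟨-, c2, c3⟩ := gridNorm_le_energy h₁ h₂ he₀ vc' vb'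
  rw [← hE₁] at a1 a2
  rw [← hE] at b1 b3
  rw [← hE₀] at c2 c3
  -- Exchanging G' for G moves both slots by at most κ, so that E² ≤ E₀² + 6κE₀ + κ².
  have shift : E ≤ E₀ + 3 * κ := by
    have vd : VanishesOnBoundary J₁ J₂ (fun i j => G' i j - G i j) := hG'.sub hG
    have dk : ∀ i ≤ 2 * J₁, ∀ j ≤ 2 * J₂, |G' i j - G i j| ≤ κ := fun i hi j hj => by
      rw [abs_sub_comm]; exact hGG i hi j hj
    have d1 := innerH_add_le h₁ h₂ vc' vd hκ dk
    have d2 := innerH_add_le h₁ h₂ vb' vd hκ dk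
    simp only [sub_add_sub_cancel] at d1 d2
    refine (abs_le_of_sq_le_sq' ?_ (by positivity)).2
    rw [sq]
    nlinarith [mul_le_mul_of_nonneg_left c2 hκ, mul_le_mul_of_nonneg_left c3 hκ]
  set ρ := gridNorm J₁ J₂ g + gridNorm J₁ J₂ s with hρ
  have ng : 0 ≤ gridNorm J₁ J₂ g := gridNorm_nonneg _ _ _
  have ns : 0 ≤ gridNorm J₁ J₂ s := gridNorm_nonneg _ _ _
  have nρ : 0 ≤ ρ := add_nonneg ng ns
  -- From E₁² − E² ≤ 3τρ(E₁ + E) one divides by E₁ + E. Working with the root of the energy avoids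
  -- an implicit term that would restrict τ.
  have grow : E₁ ≤ E + 3 * (τ * ρ) := by
    have i1 := (gridInner_le J₁ J₂ g e₁).trans (mul_le_mul_of_nonneg_left a1 ng)
    have i2 := (gridInner_le J₁ J₂ g e₀).trans (mul_le_mul_of_nonneg_left b1 ng)
    have i3 := (gridInner_le J₁ J₂ s _).trans (mul_le_mul_of_nonneg_left a2 ns)
    have i4 := (gridInner_le J₁ J₂ s _).trans (mul_le_mul_of_nonneg_left b3 ns)
    have i5 : gridInner J₁ J₂ g e₁ + gridInner J₁ J₂ g e₀
        + gridInner J₁ J₂ s (fun i j => η₂ i j - G i j)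
        + gridInner J₁ J₂ s (fun i j => η₀ i j - G i j) ≤ 3 * ρ * (E₁ + E) := by
      rw [hρ]; linarith
    have i6 := mul_le_mul_of_nonneg_left i5 hτ.le
    have i7 : E₁ ^ 2 - E ^ 2 ≤ τ * (3 * ρ * (E₁ + E)) := by
      rw [sq₁, sq]; linarith
    have nr : 0 ≤ τ * ρ := mul_nonneg hτ.le nρ
    by_contra! hcon
    nlinarith
  linarith

end

/-- A discrete Gronwall inequality. -/
theorem discrete_gronwall {y : ℕ → ℝ} {N : ℕ} {τ K δ : ℝ} (hδ : 0 ≤ δ)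
    (hy : ∀ n, 0 ≤ y n)
    (h : ∀ n < N, y (n + 1) ≤ y n + τ * K * (y n + δ)) :
    ∀ n ≤ N, y n + δ ≤ Real.exp (K * (n * τ)) * (y 0 + δ) := by
  intro n
  induction n with
  | zero => intro _; simp
  | succ n ih =>
    intro hn
    have h1 := h n hn
    have h2 := ih (by omega)
    have h3 : 1 + τ * K ≤ Real.exp (τ * K) := by linarith [Real.add_one_le_exp (τ * K)]
    have h4 : 0 ≤ y n + δ := add_nonneg (hy n) hδ
    calc y (n + 1) + δ ≤ (1 + τ * K) * (y n + δ) := by linarith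
      _ ≤ Real.exp (τ * K) * (Real.exp (K * (n * τ)) * (y 0 + δ)) :=
        mul_le_mul h3 h2 h4 (Real.exp_pos _).le
      _ = Real.exp (K * ((n + 1 : ℕ) * τ)) * (y 0 + δ) := by
        rw [← mul_assoc, ← Real.exp_add]; push_cast; ring_nf

/-! ### Chains of derivatives and Taylor expansions -/

/-- `φ k` is the `k`-th derivative of `φ 0` on `[a, b]` for `k ≤ m`, and all these derivatives are
bounded by `M`. -/
structure DerivChain (a b : ℝ) (m : ℕ) (M : ℝ) (φ : ℕ → ℝ → ℝ) : Prop where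
  deriv : ∀ k < m, ∀ x ∈ Icc a b, HasDerivWithinAt (φ k) (φ (k + 1) x) (Icc a b) x
  bound : ∀ k ≤ m, ∀ x ∈ Icc a b, |φ k x| ≤ M

namespace DerivChain

variable {a b M : ℝ} {m : ℕ} {φ : ℕ → ℝ → ℝ}

theorem shift (h : DerivChain a b m M φ) (l n : ℕ) (hn : l + n ≤ m) :
    DerivChain a b n M (fun k => φ (l + k)) where
  deriv k hk x hx := h.deriv (l + k) (by omega) x hx
  bound k hk x hx := h.bound (l + k) (by omega) x hx

theorem take (h : DerivChain a b m M φ) (n : ℕ) (hn : n ≤ m) : DerivChain a b n M φ where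
  deriv k hk x hx := h.deriv k (by omega) x hx
  bound k hk x hx := h.bound k (by omega) x hx

theorem continuousOn (h : DerivChain a b m M φ) {k : ℕ} (hk : k < m) :
    ContinuousOn (φ k) (Icc a b) :=
  fun x hx => (h.deriv k hk x hx).continuousWithinAt

theorem nonneg (h : DerivChain a b m M φ) {x : ℝ} (hx : x ∈ Icc a b) : 0 ≤ M :=
  (abs_nonneg _).trans (h.bound 0 (Nat.zero_le _) x hx)

/-- Induction on the order: the derivative of the remainder is the remainder, one order lower, of
the shifted chain, and the mean value inequality adds a factor |y − x|. The factorial in the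
remainder is given up; in return the highest derivative need not be continuous. -/
theorem taylor {φ : ℕ → ℝ → ℝ} (h : DerivChain a b m M φ) {x y : ℝ} (hx : x ∈ Icc a b)
    (hy : y ∈ Icc a b) :
    |φ 0 y - ∑ k ∈ Finset.range m, φ k x * (y - x) ^ k / (k.factorial : ℝ)|
      ≤ M * |y - x| ^ m := by
  induction m generalizing φ y with
  | zero => simpa using h.bound 0 le_rfl y hy
  | succ m ih =>
    have hsub : uIcc x y ⊆ Icc a b := uIcc_subset_Icc hx hy
    set R : ℝ → ℝ := fun s =>
      φ 0 s - ∑ k ∈ Finset.range (m + 1), φ k x * (s - x) ^ k / (k.factorial : ℝ) with hR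
    have hR0 : R x = 0 := by
      simp [hR, Finset.sum_range_succ']
    have hRd : ∀ s ∈ uIcc x y, HasDerivWithinAt R
        (φ 1 s - ∑ k ∈ Finset.range m, φ (1 + k) x * (s - x) ^ k / (k.factorial : ℝ))
        (uIcc x y) s := fun s hs => by
      refine ((h.deriv 0 (Nat.succ_pos _) s (hsub hs)).mono hsub).sub ?_
      have hd : ∀ k ∈ Finset.range (m + 1), HasDerivWithinAt
          (fun s => φ k x * (s - x) ^ k / (k.factorial : ℝ))
          (φ k x * (k * (s - x) ^ (k - 1) * 1) / (k.factorial : ℝ)) (uIcc x y) s := fun k _ =>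
        ((((hasDerivAt_id s).sub_const x).pow k).const_mul (φ k x)).div_const _
          |>.hasDerivWithinAt
      have := HasDerivWithinAt.fun_sum hd
      convert this using 1
      rw [Finset.sum_range_succ']
      simp only [Nat.cast_zero, zero_mul, mul_zero, zero_div, add_zero]
      refine Finset.sum_congr rfl fun k _ => ?_
      rw [Nat.factorial_succ, add_comm 1 k, Nat.add_sub_cancel]
      have : ((k : ℝ) + 1) ≠ 0 := by positivity
      have : (k.factorial : ℝ) ≠ 0 := by positivity
      push_cast
      field_simp
    have hb : ∀ s ∈ uIcc x y,
        ‖φ 1 s - ∑ k ∈ Finset.range m, φ (1 + k) x * (s - x) ^ k / (k.factorial : ℝ)‖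
          ≤ M * |y - x| ^ m := fun s hs => by
      refine (ih (h.shift 1 m (by omega)) (hsub hs)).trans ?_
      have : |s - x| ≤ |y - x| := abs_sub_left_of_mem_uIcc hs
      have := h.nonneg hx
      gcongr
    have := (convex_uIcc x y).norm_image_sub_le_of_norm_hasDerivWithin_le hRd hb left_mem_uIcc
      right_mem_uIcc
    rw [hR0, sub_zero, Real.norm_eq_abs, Real.norm_eq_abs] at this
    rw [pow_succ, ← mul_assoc]
    exact this

theorem abs_sub_le {φ : ℕ → ℝ → ℝ} (h : DerivChain a b 1 M φ) {x y : ℝ} (hx : x ∈ Icc a b)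
    (hy : y ∈ Icc a b) : |φ 0 y - φ 0 x| ≤ M * |y - x| := by
  simpa using h.taylor hx hy

theorem abs_second_diff_le {φ : ℕ → ℝ → ℝ} (h : DerivChain a b 2 M φ) {t τ : ℝ} (hτ : 0 < τ)
    (h₀ : t ∈ Icc a b) (h₁ : t + τ ∈ Icc a b) (h₂ : t - τ ∈ Icc a b) :
    |φ 0 (t + τ) - 2 * φ 0 t + φ 0 (t - τ)| ≤ 2 * M * τ ^ 2 := by
  have t₁ := h.taylor h₀ h₁
  have t₂ := h.taylor h₀ h₂
  simp only [Finset.sum_range_succ, Finset.sum_range_zero, add_sub_cancel_left, sub_sub_cancel_left,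
    abs_neg, abs_of_pos hτ] at t₁ t₂
  norm_num [Nat.factorial] at t₁ t₂
  rw [abs_le] at *
  constructor <;> linarith

/-- The combination φ(t+τ) − 3φ(t) + 3φ(t−τ) − φ(t−2τ) annihilates quadratics, and the remainders
add up to 1 + 3 + 2³ = 12. It bounds the change of the shift G over one time step. -/
theorem abs_third_diff_le {φ : ℕ → ℝ → ℝ} (h : DerivChain a b 3 M φ) {t τ : ℝ} (hτ : 0 < τ)
    (h₀ : t ∈ Icc a b) (h₁ : t + τ ∈ Icc a b) (h₂ : t - τ ∈ Icc a b) (h₃ : t - 2 * τ ∈ Icc a b) :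
    |(φ 0 (t + τ) - 2 * φ 0 t + φ 0 (t - τ)) - (φ 0 t - 2 * φ 0 (t - τ) + φ 0 (t - 2 * τ))|
      ≤ 12 * M * τ ^ 3 := by
  have t₁ := h.taylor h₀ h₁
  have t₂ := h.taylor h₀ h₂
  have t₃ := h.taylor h₀ h₃
  have hτ' : 0 < 2 * τ := by positivity
  simp only [Finset.sum_range_succ, Finset.sum_range_zero, add_sub_cancel_left, sub_sub_cancel_left,
    abs_neg, abs_of_pos hτ, abs_of_pos hτ'] at t₁ t₂ t₃
  norm_num [Nat.factorial] at t₁ t₂ t₃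
  ring_nf at t₁ t₂ t₃ ⊢
  rw [abs_le] at *
  constructor <;> linarith

theorem abs_central_sub_le {φ : ℕ → ℝ → ℝ} (h : DerivChain a b 3 M φ) {t τ : ℝ} (hτ : 0 < τ)
    (h₀ : t ∈ Icc a b) (h₁ : t + τ ∈ Icc a b) (h₂ : t - τ ∈ Icc a b) :
    |(φ 0 (t + τ) - φ 0 (t - τ)) / (2 * τ) - φ 1 t| ≤ M * τ ^ 2 := by
  have t₁ := h.taylor h₀ h₁
  have t₂ := h.taylor h₀ h₂
  simp only [Finset.sum_range_succ, Finset.sum_range_zero, add_sub_cancel_left, sub_sub_cancel_left,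
    abs_neg, abs_of_pos hτ] at t₁ t₂
  norm_num [Nat.factorial] at t₁ t₂
  have e : (φ 0 (t + τ) - φ 0 (t - τ)) / (2 * τ) - φ 1 t
      = (φ 0 (t + τ) - φ 0 (t - τ) - 2 * τ * φ 1 t) / (2 * τ) := by field_simp
  rw [e, abs_div, abs_of_pos (by positivity : 0 < 2 * τ), div_le_iff₀ (by positivity)]
  rw [abs_le] at *
  constructor <;> linarith

theorem abs_second_quot_sub_le {φ : ℕ → ℝ → ℝ} (h : DerivChain a b 4 M φ) {t τ : ℝ} (hτ : 0 < τ)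
    (h₀ : t ∈ Icc a b) (h₁ : t + τ ∈ Icc a b) (h₂ : t - τ ∈ Icc a b) :
    |(φ 0 (t + τ) - 2 * φ 0 t + φ 0 (t - τ)) / τ ^ 2 - φ 2 t| ≤ 2 * M * τ ^ 2 := by
  have t₁ := h.taylor h₀ h₁
  have t₂ := h.taylor h₀ h₂
  simp only [Finset.sum_range_succ, Finset.sum_range_zero, add_sub_cancel_left, sub_sub_cancel_left,
    abs_neg, abs_of_pos hτ] at t₁ t₂
  norm_num [Nat.factorial] at t₁ t₂
  have e : (φ 0 (t + τ) - 2 * φ 0 t + φ 0 (t - τ)) / τ ^ 2 - φ 2 t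
      = (φ 0 (t + τ) - 2 * φ 0 t + φ 0 (t - τ) - τ ^ 2 * φ 2 t) / τ ^ 2 := by field_simp
  rw [e, abs_div, abs_of_pos (by positivity : 0 < τ ^ 2), div_le_iff₀ (by positivity)]
  ring_nf at t₁ t₂ ⊢
  rw [abs_le] at *
  constructor <;> linarith

theorem abs_forward_quot_sub_le {φ : ℕ → ℝ → ℝ} (h : DerivChain a b 3 M φ) {t τ : ℝ} (hτ : 0 < τ)
    (h₀ : t ∈ Icc a b) (h₁ : t + τ ∈ Icc a b) :
    |(φ 0 (t + τ) - φ 0 t) / τ - φ 1 t - τ / 2 * φ 2 t| ≤ M * τ ^ 2 := by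
  have t₁ := h.taylor h₀ h₁
  simp only [Finset.sum_range_succ, Finset.sum_range_zero, add_sub_cancel_left,
    abs_of_pos hτ] at t₁
  norm_num [Nat.factorial] at t₁
  have e : (φ 0 (t + τ) - φ 0 t) / τ - φ 1 t - τ / 2 * φ 2 t
      = (φ 0 (t + τ) - φ 0 t - τ * φ 1 t - τ ^ 2 / 2 * φ 2 t) / τ := by field_simp
  rw [e, abs_div, abs_of_pos hτ, div_le_iff₀ hτ]
  rw [abs_le] at *
  constructor <;> linarith

theorem abs_first_order_le {φ : ℕ → ℝ → ℝ} (h : DerivChain a b 2 M φ) {t τ : ℝ} (hτ : 0 < τ)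
    (h₀ : t ∈ Icc a b) (h₁ : t + τ ∈ Icc a b) :
    |φ 0 (t + τ) - φ 0 t - τ * φ 1 t| ≤ M * τ ^ 2 := by
  have t₁ := h.taylor h₀ h₁
  simp only [Finset.sum_range_succ, Finset.sum_range_zero, add_sub_cancel_left,
    abs_of_pos hτ] at t₁
  norm_num [Nat.factorial] at t₁
  rw [abs_le] at *
  constructor <;> linarith

/-- Consistency of the compact fourth-order approximation of the second derivative. -/
theorem abs_compact_sub_le {φ : ℕ → ℝ → ℝ} (h : DerivChain a b 6 M φ) {x s : ℝ} (hs : 0 < s)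
    (h₀ : x ∈ Icc a b) (h₁ : x + s ∈ Icc a b) (h₂ : x - s ∈ Icc a b) :
    |(φ 2 (x + s) + 10 * φ 2 x + φ 2 (x - s)) / 12
      - (φ 0 (x + s) - 2 * φ 0 x + φ 0 (x - s)) * s⁻¹ ^ 2| ≤ 3 * M * s ^ 4 := by
  have t₁ := h.taylor h₀ h₁
  have t₂ := h.taylor h₀ h₂
  have t₃ := (h.shift 2 4 (by norm_num)).taylor h₀ h₁
  have t₄ := (h.shift 2 4 (by norm_num)).taylor h₀ h₂
  simp only [Finset.sum_range_succ, Finset.sum_range_zero, add_sub_cancel_left, sub_sub_cancel_left,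
    abs_neg, abs_of_pos hs] at t₁ t₂ t₃ t₄
  norm_num [Nat.factorial] at t₁ t₂ t₃ t₄
  have hM := h.nonneg h₀
  -- The weights 1, 10, 1 are chosen so that both parts contain s²/12 times the fourth derivative;
  -- it cancels, and only terms of order s⁴ remain.
  have e : (φ 2 (x + s) + 10 * φ 2 x + φ 2 (x - s)) / 12
        - (φ 0 (x + s) - 2 * φ 0 x + φ 0 (x - s)) * s⁻¹ ^ 2
      = (φ 2 (x + s) + 10 * φ 2 x + φ 2 (x - s) - (12 * φ 2 x + s ^ 2 * φ 4 x)) / 12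
        - (φ 0 (x + s) - 2 * φ 0 x + φ 0 (x - s) - s ^ 2 * φ 2 x - s ^ 4 / 12 * φ 4 x)
          / s ^ 2 := by
    field_simp; ring
  have b₁ : |(φ 2 (x + s) + 10 * φ 2 x + φ 2 (x - s) - (12 * φ 2 x + s ^ 2 * φ 4 x)) / 12|
      ≤ M * s ^ 4 := by
    have := mul_nonneg hM (by positivity : 0 ≤ s ^ 4)
    ring_nf at t₃ t₄ this ⊢
    rw [abs_le] at *
    constructor <;> linarith
  have b₂ : |(φ 0 (x + s) - 2 * φ 0 x + φ 0 (x - s) - s ^ 2 * φ 2 x - s ^ 4 / 12 * φ 4 x)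
          / s ^ 2| ≤ 2 * M * s ^ 4 := by
    rw [abs_div, abs_of_pos (by positivity : 0 < s ^ 2), div_le_iff₀ (by positivity)]
    ring_nf at t₁ t₂ ⊢
    rw [abs_le] at *
    constructor <;> linarith
  rw [e]
  refine (abs_sub _ _).trans ?_
  linarith

/-- Simpson's rule is exact for the cubic Taylor polynomial at the midpoint. The remainder, at most
M s⁴, contributes 2s times this through the integral and 2s/3 times this through the nodes. -/
theorem abs_simpson_panel_le {φ : ℕ → ℝ → ℝ} (h : DerivChain a b 4 M φ) {c s : ℝ} (hs : 0 < s)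
    (h₀ : c ∈ Icc a b) (h₁ : c + s ∈ Icc a b) (h₂ : c - s ∈ Icc a b) :
    |(∫ x in (c - s)..(c + s), φ 0 x) - s / 3 * (φ 0 (c - s) + 4 * φ 0 c + φ 0 (c + s))|
      ≤ 4 * M * s ^ 5 := by
  have hM := h.nonneg h₀
  have hsub : uIcc (c - s) (c + s) ⊆ Icc a b := uIcc_subset_Icc h₂ h₁
  set p : ℝ → ℝ := fun x =>
    φ 0 c + φ 1 c * (x - c) + φ 2 c / 2 * (x - c) ^ 2 + φ 3 c / 6 * (x - c) ^ 3 with hp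
  have pcont : Continuous p := by fun_prop
  have taylor' : ∀ y ∈ uIcc (c - s) (c + s), |φ 0 y - p y| ≤ M * s ^ 4 := fun y hy => by
    have t := h.taylor h₀ (hsub hy)
    simp only [Finset.sum_range_succ, Finset.sum_range_zero] at t
    norm_num [Nat.factorial] at t
    have hy' : |y - c| ≤ s := by
      rw [uIcc_of_le (by linarith)] at hy
      rw [abs_le]; constructor <;> linarith [hy.1, hy.2]
    have e : φ 0 y - p y = φ 0 y - (φ 0 c + φ 1 c * (y - c) + φ 2 c * (y - c) ^ 2 / 2
        + φ 3 c * (y - c) ^ 3 / 6) := by simp only [hp]; ring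
    rw [e]
    refine t.trans ?_
    gcongr
  have hint : IntervalIntegrable (φ 0) MeasureTheory.volume (c - s) (c + s) :=
    ((h.continuousOn (k := 0) (by norm_num)).mono hsub).intervalIntegrable
  have i₁ : |(∫ x in (c - s)..(c + s), φ 0 x) - ∫ x in (c - s)..(c + s), p x|
      ≤ M * s ^ 4 * (2 * s) := by
    rw [← intervalIntegral.integral_sub hint (pcont.intervalIntegrable _ _)]
    have := intervalIntegral.norm_integral_le_of_norm_le_const (a := c - s) (b := c + s)
      (f := fun x => φ 0 x - p x) (C := M * s ^ 4)
      fun y hy => taylor' y (uIoc_subset_uIcc hy)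
    rw [Real.norm_eq_abs] at this
    refine this.trans (le_of_eq ?_)
    rw [show c + s - (c - s) = 2 * s by ring, abs_of_pos (by positivity)]
  have i₂ : ∫ x in (c - s)..(c + s), p x = 2 * s * φ 0 c + s ^ 3 / 3 * φ 2 c := by
    have := intervalIntegral.integral_comp_sub_right (a := c - s) (b := c + s)
      (fun x => φ 0 c + φ 1 c * x + φ 2 c / 2 * x ^ 2 + φ 3 c / 6 * x ^ 3) c
    simp only [hp]
    rw [this]
    rw [intervalIntegral.integral_add, intervalIntegral.integral_add, intervalIntegral.integral_add]
    · have linear : ∫ x in (c - s - c)..(c + s - c), φ 1 c * x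
          = φ 1 c * ∫ x in (c - s - c)..(c + s - c), x := intervalIntegral.integral_const_mul _ _
      rw [linear, integral_id]
      simp only [intervalIntegral.integral_const_mul, intervalIntegral.integral_const, integral_pow,
        smul_eq_mul]
      ring
    all_goals exact Continuous.intervalIntegrable (by fun_prop) _ _
  have t₁ := taylor' (c + s) right_mem_uIcc
  have t₂ := taylor' (c - s) left_mem_uIcc
  have e : (∫ x in (c - s)..(c + s), φ 0 x) - s / 3 * (φ 0 (c - s) + 4 * φ 0 c + φ 0 (c + s))
      = ((∫ x in (c - s)..(c + s), φ 0 x) - ∫ x in (c - s)..(c + s), p x)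
        - s / 3 * ((φ 0 (c + s) - p (c + s)) + (φ 0 (c - s) - p (c - s))) := by
    rw [i₂]; simp only [hp]; ring
  rw [e]
  refine (abs_sub _ _).trans ?_
  rw [abs_mul, abs_of_pos (by positivity : 0 < s / 3)]
  have := mul_le_mul_of_nonneg_left ((abs_add_le _ _).trans (add_le_add t₁ t₂))
    (by positivity : 0 ≤ s / 3)
  have : 0 ≤ M * s ^ 5 := by positivity
  nlinarith

end DerivChain

/-! ### The composite Simpson rule -/

/-- The weights of the composite Simpson rule at the interior nodes, in units of the step size. -/
def simpsonWeight (i : ℕ) : ℝ := if Odd i then 4 / 3 else 2 / 3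

theorem simpsonWeight_nonneg (i : ℕ) : 0 ≤ simpsonWeight i := by
  unfold simpsonWeight; split_ifs <;> norm_num

theorem simpsonWeight_le (i : ℕ) : simpsonWeight i ≤ 4 / 3 := by
  unfold simpsonWeight; split_ifs <;> norm_num

/-- `normE` is summed over blocks of two nodes per direction, the Simpson weights go by parity; this
passes from one to the other. The first block contains the boundary node 0, hence the extra term. -/
theorem sum_odd_even (α β : ℝ) (q : ℕ → ℝ) {J : ℕ} (hJ : 1 ≤ J) :
    ∑ i ∈ Finset.Icc 1 J, (α * q (2 * i - 1) + β * q (2 * i - 2))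
      = ∑ i ∈ Finset.Icc 1 (2 * J - 1), (if Odd i then α else β) * q i + β * q 0 := by
  induction J, hJ using Nat.le_induction with
  | base => simp
  | succ J hJ ih =>
    rw [Finset.sum_Icc_succ_top (by omega), ih]
    obtain ⟨m, rfl⟩ : ∃ m, J = m + 1 := ⟨J - 1, by omega⟩
    rw [show 2 * (m + 1 + 1) - 1 = 2 * (m + 1) - 1 + 1 + 1 by omega,
      Finset.sum_Icc_succ_top (by omega), Finset.sum_Icc_succ_top (by omega)]
    rw [show 2 * (m + 1) - 1 + 1 = 2 * (m + 1) by omega,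
      show 2 * (m + 1 + 1) - 2 = 2 * (m + 1) by omega]
    have o : Odd (2 * (m + 1) + 1) := ⟨m + 1, rfl⟩
    have e : ¬ Odd (2 * (m + 1)) := by simp
    rw [if_pos o, if_neg e]
    ring

theorem sum_simpson (q : ℕ → ℝ) {J : ℕ} (hJ : 1 ≤ J) (h0 : q 0 = 0) (hq : q (2 * J) = 0) :
    ∑ i ∈ Finset.range J, 1 / 3 * (q (2 * i) + 4 * q (2 * i + 1) + q (2 * i + 2))
      = ∑ i ∈ Finset.Icc 1 (2 * J - 1), simpsonWeight i * q i := by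
  have h := sum_odd_even (4 / 3) (2 / 3) q hJ
  rw [h0, mul_zero, add_zero] at h
  simp only [simpsonWeight]
  rw [← h, ← Finset.Ico_add_one_right_eq_Icc, Finset.sum_Ico_eq_sum_range, Nat.add_sub_cancel]
  have ht := Finset.sum_range_sub (fun i => q (2 * i)) J
  rw [hq, mul_zero, h0, sub_zero] at ht
  rw [← sub_eq_zero, ← Finset.sum_sub_distrib, ← mul_zero (1 / 3 : ℝ), ← ht, Finset.mul_sum]
  refine Finset.sum_congr rfl fun i _ => ?_
  rw [show 2 * (1 + i) - 1 = 2 * i + 1 by omega, show 2 * (1 + i) - 2 = 2 * i by omega,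
    show 2 * (i + 1) = 2 * i + 2 by ring]
  ring

theorem mul_step_mem {J i : ℕ} (hJ : 1 ≤ J) (hi : i ≤ 2 * J) :
    (i : ℝ) * step J ∈ Icc (0 : ℝ) 1 := by
  have := step_pos hJ
  refine ⟨by positivity, ?_⟩
  rw [← step_mul hJ]
  gcongr

/-- The error of the composite Simpson rule for a function vanishing at the end points. -/
theorem DerivChain.abs_simpson_le {M : ℝ} {φ : ℕ → ℝ → ℝ} (h : DerivChain 0 1 4 M φ)
    (h0 : φ 0 0 = 0) (h1 : φ 0 1 = 0) {J : ℕ} (hJ : 1 ≤ J) :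
    |(∫ x in (0 : ℝ)..1, φ 0 x)
        - step J * ∑ i ∈ Finset.Icc 1 (2 * J - 1), simpsonWeight i * φ 0 (i * step J)|
      ≤ 2 * M * step J ^ 4 := by
  have hs := step_pos hJ
  have hm := step_mul hJ
  have mem : ∀ i ≤ 2 * J, (i : ℝ) * step J ∈ Icc (0 : ℝ) 1 := fun i hi => mul_step_mem hJ hi
  have hsplit : ∑ i ∈ Finset.range J,
      ∫ x in (((2 * i : ℕ) : ℝ) * step J)..(((2 * (i + 1) : ℕ) : ℝ) * step J), φ 0 x
      = ∫ x in (0 : ℝ)..1, φ 0 x := by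
    rw [intervalIntegral.sum_integral_adjacent_intervals
      (a := fun i : ℕ => ((2 * i : ℕ) : ℝ) * step J)]
    · rw [hm]; simp
    · intro i hi
      refine ((h.continuousOn (k := 0) (by norm_num)).mono ?_).intervalIntegrable
      exact uIcc_subset_Icc (mem _ (by omega)) (mem _ (by omega))
  rw [← hsplit, ← sum_simpson (fun i => φ 0 (i * step J)) hJ (by simpa using h0)
    (by rw [hm]; exact h1), Finset.mul_sum, ← Finset.sum_sub_distrib]
  refine (Finset.abs_sum_le_sum_abs _ _).trans ?_
  have panel : ∀ i ∈ Finset.range J,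
      |(∫ x in (((2 * i : ℕ) : ℝ) * step J)..(((2 * (i + 1) : ℕ) : ℝ) * step J), φ 0 x)
        - step J * (1 / 3 * (φ 0 ((2 * i : ℕ) * step J) + 4 * φ 0 ((2 * i + 1 : ℕ) * step J)
          + φ 0 ((2 * i + 2 : ℕ) * step J)))| ≤ 4 * M * step J ^ 5 := fun i hi => by
    rw [Finset.mem_range] at hi
    have ea : ((2 * i : ℕ) : ℝ) * step J = ((2 * i + 1 : ℕ) : ℝ) * step J - step J := by
      push_cast; ring
    have eb : ((2 * (i + 1) : ℕ) : ℝ) * step J = ((2 * i + 1 : ℕ) : ℝ) * step J + step J := by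
      push_cast; ring
    have ec : ((2 * i + 2 : ℕ) : ℝ) * step J = ((2 * i + 1 : ℕ) : ℝ) * step J + step J := by
      push_cast; ring
    have := h.abs_simpson_panel_le hs (mem (2 * i + 1) (by omega))
      (by rw [← eb]; exact mem _ (by omega)) (by rw [← ea]; exact mem _ (by omega))
    rw [ea, eb, ec]
    convert this using 3
    ring
  refine (Finset.sum_le_sum panel).trans (le_of_eq ?_)
  rw [Finset.sum_const, Finset.card_range, nsmul_eq_mul]
  push_cast at hm
  calc (J : ℝ) * (4 * M * step J ^ 5) = 2 * M * step J ^ 4 * (2 * J * step J) := by ring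
    _ = 2 * M * step J ^ 4 := by rw [hm, mul_one]

/-! ### The Simpson norm -/

/-- The product weights are 4/9, 8/9 and 16/9 when none, one or both of the indices are odd. The
term 4/9‖w‖² gives 4/9 everywhere, and ‖w‖_E² supplies the missing 4/9 and 12/9. -/
theorem normF_sq {J₁ J₂ : ℕ} (h₁ : 1 ≤ J₁) (h₂ : 1 ≤ J₂) {w : ℕ → ℕ → ℝ}
    (hw : VanishesOnBoundary J₁ J₂ w) :
    normF J₁ J₂ w ^ 2 = step J₁ * step J₂ *
      gridSum J₁ J₂ (fun i j => simpsonWeight i * simpsonWeight j * w i j ^ 2) := by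
  set q : ℕ → ℕ → ℝ := fun i j => w i j ^ 2 with hq
  have hst := step_mul_step_nonneg J₁ J₂
  -- Needed twice: with weights 1, 1 for the plain sum and with 4/3, 2/3 for the Simpson sum, so
  -- that all sums run over the same blocks.
  have weighted : ∀ α β : ℝ, gridSum J₁ J₂
      (fun i j => (if Odd i then α else β) * (if Odd j then α else β) * q i j)
      = ∑ i ∈ Finset.Icc 1 J₁, ∑ j ∈ Finset.Icc 1 J₂,
        (α * (α * q (2 * i - 1) (2 * j - 1) + β * q (2 * i - 1) (2 * j - 2))
          + β * (α * q (2 * i - 2) (2 * j - 1) + β * q (2 * i - 2) (2 * j - 2))) := fun α β => by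
    have inner : ∀ i ≤ 2 * J₁,
        ∑ j ∈ Finset.Icc 1 J₂, (α * q i (2 * j - 1) + β * q i (2 * j - 2))
          = ∑ j ∈ Finset.Icc 1 (2 * J₂ - 1), (if Odd j then α else β) * q i j := fun i hi => by
      rw [sum_odd_even α β (q i) h₂, hq]
      simp [hw.bottom i hi]
    have outer := sum_odd_even α β
      (fun i => ∑ j ∈ Finset.Icc 1 (2 * J₂ - 1), (if Odd j then α else β) * q i j) h₁
    have edge : ∑ j ∈ Finset.Icc 1 (2 * J₂ - 1), (if Odd j then α else β) * q 0 j = 0 := by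
      rw [← inner 0 (by omega)]
      refine Finset.sum_eq_zero fun j hj => ?_
      rw [Finset.mem_Icc] at hj
      simp [hq, hw.left (2 * j - 1) (by omega), hw.left (2 * j - 2) (by omega)]
    rw [edge, mul_zero, add_zero] at outer
    simp only [gridSum, mul_assoc, ← Finset.mul_sum]
    rw [← outer]
    refine Finset.sum_congr rfl fun i hi => ?_
    rw [Finset.mem_Icc] at hi
    rw [← inner _ (by omega), ← inner _ (by omega), Finset.mul_sum, Finset.mul_sum,
      ← Finset.sum_add_distrib]
  have hE : normE J₁ J₂ w ^ 2 = 4 / 9 * (step J₁ * step J₂ *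
      ∑ i ∈ Finset.Icc 1 J₁, ∑ j ∈ Finset.Icc 1 J₂,
      (q (2 * i - 2) (2 * j - 1) + q (2 * i - 1) (2 * j - 2)
        + 3 * q (2 * i - 1) (2 * j - 1))) := by
    rw [normE, mul_pow, Real.sq_sqrt]
    · norm_num [hq]
    · refine mul_nonneg hst (Finset.sum_nonneg fun i _ => Finset.sum_nonneg fun j _ => ?_)
      positivity
  have hN : gridNorm J₁ J₂ w ^ 2 = step J₁ * step J₂ * gridSum J₁ J₂
      (fun i j => (if Odd i then (1 : ℝ) else 1) * (if Odd j then 1 else 1) * q i j) := by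
    rw [gridNorm_sq, gridInner_eq]
    congr 1
    refine gridSum_congr fun i j _ => ?_
    simp [hq, pow_two]
  have hF : normF J₁ J₂ w ^ 2 = 4 / 9 * gridNorm J₁ J₂ w ^ 2 + normE J₁ J₂ w ^ 2 :=
    Real.sq_sqrt (by positivity)
  rw [hF, hN, hE, weighted 1 1]
  simp only [simpsonWeight]
  rw [weighted (4 / 3) (2 / 3)]
  have e : ∀ a b c d : ℝ, 4 / 9 * (d * a) + 4 / 9 * (d * b) = d * c ↔
      d * (4 / 9 * a + 4 / 9 * b) = d * c := fun a b c d => by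
    rw [show d * (4 / 9 * a + 4 / 9 * b) = 4 / 9 * (d * a) + 4 / 9 * (d * b) by ring]
  rw [e]
  congr 1
  rw [Finset.mul_sum, Finset.mul_sum, ← Finset.sum_add_distrib]
  refine Finset.sum_congr rfl fun i _ => ?_
  rw [Finset.mul_sum, Finset.mul_sum, ← Finset.sum_add_distrib]
  refine Finset.sum_congr rfl fun j _ => ?_
  ring

/-- Factor w² − z² and apply Cauchy–Schwarz. The weights are at most 16/9, which is rounded up to 2.
-/
theorem abs_normF_sq_sub_le {J₁ J₂ : ℕ} (h₁ : 1 ≤ J₁) (h₂ : 1 ≤ J₂) {w z : ℕ → ℕ → ℝ}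
    (hw : VanishesOnBoundary J₁ J₂ w) (hz : VanishesOnBoundary J₁ J₂ z) :
    |normF J₁ J₂ w ^ 2 - normF J₁ J₂ z ^ 2|
      ≤ 2 * (gridNorm J₁ J₂ (fun i j => w i j - z i j)
        * (gridNorm J₁ J₂ w + gridNorm J₁ J₂ z)) := by
  have hst := step_mul_step_nonneg J₁ J₂
  rw [normF_sq h₁ h₂ hw, normF_sq h₁ h₂ hz, ← mul_sub, abs_mul, abs_of_nonneg hst]
  have hnorm : ∀ w : ℕ → ℕ → ℝ, gridNorm J₁ J₂ (fun i j => |w i j|) = gridNorm J₁ J₂ w :=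
    fun w => by
      rw [gridNorm, gridNorm]; congr 1
      exact gridInner_congr fun i j _ => abs_mul_abs_self _
  have cs := gridInner_le J₁ J₂ (fun i j => |w i j - z i j|) (fun i j => |w i j + z i j|)
  rw [hnorm, hnorm (fun i j => w i j + z i j)] at cs
  have cs' := cs.trans
    (mul_le_mul_of_nonneg_left (gridNorm_add_le J₁ J₂ w z) (gridNorm_nonneg _ _ _))
  have main : |gridSum J₁ J₂ (fun i j => simpsonWeight i * simpsonWeight j * w i j ^ 2)
      - gridSum J₁ J₂ (fun i j => simpsonWeight i * simpsonWeight j * z i j ^ 2)|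
      ≤ 2 * gridSum J₁ J₂ (fun i j => |w i j - z i j| * |w i j + z i j|) := by
    rw [gridSum, gridSum, gridSum, ← Finset.sum_sub_distrib, Finset.mul_sum]
    refine (Finset.abs_sum_le_sum_abs _ _).trans (Finset.sum_le_sum fun i _ => ?_)
    rw [← Finset.sum_sub_distrib, Finset.mul_sum]
    refine (Finset.abs_sum_le_sum_abs _ _).trans (Finset.sum_le_sum fun j _ => ?_)
    rw [← abs_mul, show simpsonWeight i * simpsonWeight j * w i j ^ 2
      - simpsonWeight i * simpsonWeight j * z i j ^ 2
      = simpsonWeight i * simpsonWeight j * ((w i j - z i j) * (w i j + z i j)) by ring, abs_mul,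
      abs_of_nonneg (mul_nonneg (simpsonWeight_nonneg i) (simpsonWeight_nonneg j))]
    refine mul_le_mul_of_nonneg_right ?_ (abs_nonneg _)
    nlinarith [simpsonWeight_le i, simpsonWeight_le j, simpsonWeight_nonneg i,
      simpsonWeight_nonneg j]
  have := mul_le_mul_of_nonneg_left main hst
  rw [gridInner_eq] at cs'
  linarith

/-- The error of the composite Simpson rule on the square for a function vanishing on the
boundary; `φ k = ∂ₓᵏ g` and `ψ k = ∂_yᵏ g`. -/
theorem abs_simpson_square_le {M : ℝ} {g : ℝ → ℝ → ℝ} {φ ψ : ℕ → ℝ → ℝ → ℝ} (hφg : φ 0 = g)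
    (hψg : ψ 0 = g)
    (hφ : ∀ y ∈ Icc (0 : ℝ) 1, DerivChain 0 1 4 M (fun k x => φ k x y))
    (hψ : ∀ x ∈ Icc (0 : ℝ) 1, DerivChain 0 1 4 M (fun k y => ψ k x y))
    (hg : ContinuousOn (fun p : ℝ × ℝ => g p.1 p.2) (Icc (0 : ℝ) 1 ×ˢ Icc (0 : ℝ) 1))
    (hbd : ∀ x y, OnBoundary x y → g x y = 0) {J₁ J₂ : ℕ} (h₁ : 1 ≤ J₁) (h₂ : 1 ≤ J₂) :
    |(∫ p in (Icc (0 : ℝ) 1 ×ˢ Icc (0 : ℝ) 1 : Set (ℝ × ℝ)), g p.1 p.2)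
      - step J₁ * step J₂ * gridSum J₁ J₂
        (fun i j => simpsonWeight i * simpsonWeight j * g (i * step J₁) (j * step J₂))|
      ≤ 4 * M * (step J₁ ^ 4 + step J₂ ^ 4) := by
  have z0 : (0 : ℝ) ∈ Icc (0 : ℝ) 1 := by simp
  have z1 : (1 : ℝ) ∈ Icc (0 : ℝ) 1 := by simp
  have hM : 0 ≤ M := (hφ 0 z0).nonneg z0
  have p₁ := step_pos h₁
  have p₂ := step_pos h₂
  set F : ℝ → ℝ := fun x => ∫ y in (0 : ℝ)..1, g x y with hF
  have hint : MeasureTheory.IntegrableOn (fun p : ℝ × ℝ => g p.1 p.2)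
      (Icc (0 : ℝ) 1 ×ˢ Icc (0 : ℝ) 1) (MeasureTheory.volume.prod MeasureTheory.volume) :=
    hg.integrableOn_compact (isCompact_Icc.prod isCompact_Icc)
  have hI : (∫ p in (Icc (0 : ℝ) 1 ×ˢ Icc (0 : ℝ) 1 : Set (ℝ × ℝ)), g p.1 p.2)
      = ∫ x in (0 : ℝ)..1, F x := by
    rw [MeasureTheory.Measure.volume_eq_prod, MeasureTheory.setIntegral_prod _ hint,
      intervalIntegral.integral_of_le zero_le_one, ← MeasureTheory.integral_Icc_eq_integral_Ioc]
    simp only [hF, intervalIntegral.integral_of_le (zero_le_one' ℝ),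
      ← MeasureTheory.integral_Icc_eq_integral_Ioc]
  have hFint : IntervalIntegrable F MeasureTheory.volume 0 1 := by
    rw [intervalIntegrable_iff_integrableOn_Icc_of_le zero_le_one]
    have := hint
    rw [MeasureTheory.IntegrableOn, ← MeasureTheory.Measure.prod_restrict] at this
    have h := this.integral_prod_left
    simp only [hF, intervalIntegral.integral_of_le (zero_le_one' ℝ),
      ← MeasureTheory.integral_Icc_eq_integral_Ioc]
    exact h
  have mem₁ : ∀ i ∈ Finset.Icc 1 (2 * J₁ - 1), (i : ℝ) * step J₁ ∈ Icc (0 : ℝ) 1 := fun i hi => by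
    rw [Finset.mem_Icc] at hi; exact mul_step_mem h₁ (by omega)
  have mem₂ : ∀ j ∈ Finset.Icc 1 (2 * J₂ - 1), (j : ℝ) * step J₂ ∈ Icc (0 : ℝ) 1 := fun j hj => by
    rw [Finset.mem_Icc] at hj; exact mul_step_mem h₂ (by omega)
  have hcol : ∀ j ∈ Finset.Icc 1 (2 * J₂ - 1),
      IntervalIntegrable (fun x => g x (j * step J₂)) MeasureTheory.volume 0 1 := fun j hj => by
    have := (hφ _ (mem₂ j hj)).continuousOn (k := 0) (by norm_num)
    simp only [hφg] at this
    refine ContinuousOn.intervalIntegrable ?_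
    rwa [uIcc_of_le zero_le_one]
  set S : ℝ → ℝ := fun x =>
    step J₂ * ∑ j ∈ Finset.Icc 1 (2 * J₂ - 1), simpsonWeight j * g x (j * step J₂) with hS
  have hSint : IntervalIntegrable S MeasureTheory.volume 0 1 := by
    have := (IntervalIntegrable.sum (Finset.Icc 1 (2 * J₂ - 1))
      (f := fun j x => simpsonWeight j * g x (j * step J₂))
      fun j hj => (hcol j hj).const_mul (simpsonWeight j)).const_mul (step J₂)
    refine this.congr fun x _ => ?_
    simp only [hS, Finset.sum_apply]
  have hSI : ∫ x in (0 : ℝ)..1, S x = step J₂ * ∑ j ∈ Finset.Icc 1 (2 * J₂ - 1),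
      simpsonWeight j * ∫ x in (0 : ℝ)..1, g x (j * step J₂) := by
    simp only [hS]
    rw [intervalIntegral.integral_const_mul, intervalIntegral.integral_finsetSum
      fun j hj => (hcol j hj).const_mul _]
    simp only [intervalIntegral.integral_const_mul]
  -- Simpson's rule in y for each fixed x, integrated over x.
  have err₁ : |(∫ x in (0 : ℝ)..1, F x) - ∫ x in (0 : ℝ)..1, S x| ≤ 2 * M * step J₂ ^ 4 := by
    rw [← intervalIntegral.integral_sub hFint hSint]
    have := intervalIntegral.norm_integral_le_of_norm_le_const (a := (0 : ℝ)) (b := 1)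
      (f := fun x => F x - S x) (C := 2 * M * step J₂ ^ 4) fun x hx => by
        rw [uIoc_of_le zero_le_one] at hx
        have hx' : x ∈ Icc (0 : ℝ) 1 := Ioc_subset_Icc_self hx
        have := (hψ x hx').abs_simpson_le
          (by rw [hψg]; exact hbd _ _ ⟨⟨hx', z0⟩, by simp⟩)
          (by rw [hψg]; exact hbd _ _ ⟨⟨hx', z1⟩, by simp⟩) h₂
        simp only [hψg] at this
        exact this
    simpa using this
  -- Simpson's rule in x along each horizontal grid line. The weights in y have total mass at most
  -- 4/3.
  have err₂ : |(∫ x in (0 : ℝ)..1, S x) - step J₁ * step J₂ * gridSum J₁ J₂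
      (fun i j => simpsonWeight i * simpsonWeight j * g (i * step J₁) (j * step J₂))|
      ≤ 4 * M * step J₁ ^ 4 := by
    have e : step J₁ * step J₂ * gridSum J₁ J₂
        (fun i j => simpsonWeight i * simpsonWeight j * g (i * step J₁) (j * step J₂))
        = step J₂ * ∑ j ∈ Finset.Icc 1 (2 * J₂ - 1), simpsonWeight j * (step J₁ *
          ∑ i ∈ Finset.Icc 1 (2 * J₁ - 1), simpsonWeight i * g (i * step J₁) (j * step J₂)) := by
      rw [gridSum_comm, Finset.mul_sum, Finset.mul_sum]
      refine Finset.sum_congr rfl fun j _ => ?_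
      rw [Finset.mul_sum, Finset.mul_sum, Finset.mul_sum, Finset.mul_sum]
      refine Finset.sum_congr rfl fun i _ => ?_
      ring
    rw [hSI, e, ← mul_sub, ← Finset.sum_sub_distrib, abs_mul, abs_of_pos p₂]
    have bound : |∑ j ∈ Finset.Icc 1 (2 * J₂ - 1),
        (simpsonWeight j * (∫ x in (0 : ℝ)..1, g x (j * step J₂)) - simpsonWeight j * (step J₁ *
          ∑ i ∈ Finset.Icc 1 (2 * J₁ - 1), simpsonWeight i * g (i * step J₁) (j * step J₂)))|
        ≤ ∑ j ∈ Finset.Icc 1 (2 * J₂ - 1), 4 / 3 * (2 * M * step J₁ ^ 4) := by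
      refine (Finset.abs_sum_le_sum_abs _ _).trans (Finset.sum_le_sum fun j hj => ?_)
      rw [← mul_sub, abs_mul, abs_of_nonneg (simpsonWeight_nonneg j)]
      refine mul_le_mul (simpsonWeight_le j) ?_ (abs_nonneg _) (by norm_num)
      have hy := mem₂ j hj
      have := (hφ _ hy).abs_simpson_le
        (by rw [hφg]; exact hbd _ _ ⟨⟨z0, hy⟩, by simp⟩)
        (by rw [hφg]; exact hbd _ _ ⟨⟨z1, hy⟩, by simp⟩) h₁
      simpa only [hφg] using this
    rw [Finset.sum_const, Nat.card_Icc, nsmul_eq_mul] at bound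
    have n₂ : (((2 * J₂ - 1 + 1 - 1 : ℕ) : ℝ)) * step J₂ ≤ 1 := by
      rw [← step_mul h₂]; gcongr; omega
    have n0 : 0 ≤ M * step J₁ ^ 4 := by positivity
    calc _ ≤ step J₂ * (((2 * J₂ - 1 + 1 - 1 : ℕ) : ℝ) * (4 / 3 * (2 * M * step J₁ ^ 4))) := by
          gcongr
      _ = (((2 * J₂ - 1 + 1 - 1 : ℕ) : ℝ) * step J₂) * (4 / 3 * (2 * M * step J₁ ^ 4)) := by ring
      _ ≤ 1 * (4 / 3 * (2 * M * step J₁ ^ 4)) := by gcongr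
      _ ≤ 4 * M * step J₁ ^ 4 := by linarith
  rw [hI]
  have := abs_sub_le (∫ x in (0 : ℝ)..1, F x) (∫ x in (0 : ℝ)..1, S x)
    (step J₁ * step J₂ * gridSum J₁ J₂
      (fun i j => simpsonWeight i * simpsonWeight j * g (i * step J₁) (j * step J₂)))
  have : 0 ≤ M * step J₂ ^ 4 := by positivity
  linarith

/-- The derivatives of `v²` in terms of those of `v`. -/
def sqChain (φ : ℕ → ℝ → ℝ) : ℕ → ℝ → ℝ
  | 0 => fun x => φ 0 x ^ 2
  | 1 => fun x => 2 * φ 0 x * φ 1 x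
  | 2 => fun x => 2 * φ 1 x ^ 2 + 2 * φ 0 x * φ 2 x
  | 3 => fun x => 6 * φ 1 x * φ 2 x + 2 * φ 0 x * φ 3 x
  | _ => fun x => 6 * φ 2 x ^ 2 + 8 * φ 1 x * φ 3 x + 2 * φ 0 x * φ 4 x

/-- The factor 16 is 6 + 8 + 2, the coefficient sum of the fourth derivative. Entries of `sqChain`
beyond the fourth carry no meaning and are not used. -/
theorem DerivChain.sq {a b M : ℝ} {φ : ℕ → ℝ → ℝ} (h : DerivChain a b 4 M φ) :
    DerivChain a b 4 (16 * M ^ 2) (sqChain φ) where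
  deriv k hk x hx := by
    have d0 := h.deriv 0 (by norm_num) x hx
    have d1 := h.deriv 1 (by norm_num) x hx
    have d2 := h.deriv 2 (by norm_num) x hx
    have d3 := h.deriv 3 (by norm_num) x hx
    interval_cases k
    · refine (d0.pow 2).congr_deriv ?_
      change _ = 2 * φ 0 x * φ 1 x
      norm_num
    · refine ((d0.const_mul 2).mul d1).congr_deriv ?_
      change _ = 2 * φ 1 x ^ 2 + 2 * φ 0 x * φ 2 x
      ring
    · refine (((d1.pow 2).const_mul 2).add ((d0.const_mul 2).mul d2)).congr_deriv ?_
      change _ = 6 * φ 1 x * φ 2 x + 2 * φ 0 x * φ 3 x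
      ring
    · refine (((d1.const_mul 6).mul d2).add ((d0.const_mul 2).mul d3)).congr_deriv ?_
      change _ = 6 * φ 2 x ^ 2 + 8 * φ 1 x * φ 3 x + 2 * φ 0 x * φ 4 x
      ring
  bound k hk x hx := by
    have hp : ∀ i ≤ 4, ∀ j ≤ 4, |φ i x * φ j x| ≤ M ^ 2 := fun i hi j hj => by
      rw [abs_mul, pow_two]
      exact mul_le_mul (h.bound i hi x hx) (h.bound j hj x hx) (abs_nonneg _) (h.nonneg hx)
    have p00 := abs_le.1 (hp 0 (by norm_num) 0 (by norm_num))
    have p01 := abs_le.1 (hp 0 (by norm_num) 1 (by norm_num))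
    have p02 := abs_le.1 (hp 0 (by norm_num) 2 (by norm_num))
    have p03 := abs_le.1 (hp 0 (by norm_num) 3 (by norm_num))
    have p04 := abs_le.1 (hp 0 (by norm_num) 4 (by norm_num))
    have p11 := abs_le.1 (hp 1 (by norm_num) 1 (by norm_num))
    have p12 := abs_le.1 (hp 1 (by norm_num) 2 (by norm_num))
    have p13 := abs_le.1 (hp 1 (by norm_num) 3 (by norm_num))
    have p22 := abs_le.1 (hp 2 (by norm_num) 2 (by norm_num))
    have nn := sq_nonneg M
    rw [abs_le]
    interval_cases k <;> simp only [sqChain, mul_assoc, pow_two (φ _ x)] <;>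
      constructor <;> linarith

/-! ### Interchanging derivatives -/

/-- Pass to the limit in the slopes; every point of a nondegenerate interval is an accumulation
point of it. -/
theorem abs_le_of_hasDerivWithinAt {a b t C D : ℝ} (hab : a < b) (ht : t ∈ Icc a b) {ψ : ℝ → ℝ}
    (hD : HasDerivWithinAt ψ D (Icc a b) t)
    (hC : ∀ᶠ s in nhdsWithin t (Icc a b), |ψ s - ψ t| ≤ C * |s - t|) : |D| ≤ C := by
  have hne : (nhdsWithin t (Icc a b \ {t})).NeBot :=
    mem_closure_iff_nhdsWithin_neBot.1 <| by
      have := (uniqueDiffOn_Icc hab) t ht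
      rw [uniqueDiffWithinAt_iff_accPt, accPt_principal_iff_nhdsWithin] at this
      exact mem_closure_iff_nhdsWithin_neBot.2 this
  rw [hasDerivWithinAt_iff_tendsto_slope] at hD
  refine le_of_tendsto hD.abs ?_
  filter_upwards [hC.filter_mono (nhdsWithin_mono t sdiff_subset), self_mem_nhdsWithin] with s hs hst
  have : 0 < |s - t| := abs_pos.2 (sub_ne_zero.2 hst.2)
  rw [slope_def_field, abs_div, div_le_iff₀ this]
  exact hs

/-- If `∂ₓ w`, `∂ₜ w` and `∂ₜ ∂ₓ w` exist and the last one is continuous, then `∂ₓ ∂ₜ w` exists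
and equals `∂ₜ ∂ₓ w`. -/
theorem hasDerivWithinAt_swap {a b c d : ℝ} (hab : a < b) {w wx wt wxt : ℝ → ℝ → ℝ}
    (hx : ∀ t ∈ Icc a b, ∀ x ∈ Icc c d, HasDerivWithinAt (fun r => w t r) (wx t x) (Icc c d) x)
    (ht : ∀ t ∈ Icc a b, ∀ x ∈ Icc c d, HasDerivWithinAt (fun s => w s x) (wt t x) (Icc a b) t)
    (hxt : ∀ t ∈ Icc a b, ∀ x ∈ Icc c d,
      HasDerivWithinAt (fun s => wx s x) (wxt t x) (Icc a b) t)
    (hc : ContinuousOn (fun p : ℝ × ℝ => wxt p.1 p.2) (Icc a b ×ˢ Icc c d))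
    {t₀ x₀ : ℝ} (ht₀ : t₀ ∈ Icc a b) (hx₀ : x₀ ∈ Icc c d) :
    HasDerivWithinAt (fun r => wt t₀ r) (wxt t₀ x₀) (Icc c d) x₀ := by
  rw [hasDerivWithinAt_iff_isLittleO, Asymptotics.isLittleO_iff]
  intro ε hε
  obtain ⟨δ, hδ, hδε⟩ := Metric.continuousOn_iff.1 hc (t₀, x₀) ⟨ht₀, hx₀⟩ ε hε
  have near : ∀ t ∈ Icc a b, ∀ x ∈ Icc c d, |t - t₀| < δ → |x - x₀| < δ →
      |wxt t x - wxt t₀ x₀| ≤ ε := fun t hts x hxs h1 h2 => by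
    have := hδε (t, x) ⟨hts, hxs⟩ (by
      rw [Prod.dist_eq, max_lt_iff, Real.dist_eq, Real.dist_eq]; exact ⟨h1, h2⟩)
    rw [Real.dist_eq] at this
    exact this.le
  set l := wxt t₀ x₀ with hl
  filter_upwards [self_mem_nhdsWithin, mem_nhdsWithin_of_mem_nhds (Metric.ball_mem_nhds x₀ hδ)]
    with x hxs hxδ
  rw [Metric.mem_ball, Real.dist_eq] at hxδ
  have hsubx : uIcc x₀ x ⊆ Icc c d := uIcc_subset_Icc hx₀ hxs
  rw [Real.norm_eq_abs, Real.norm_eq_abs, smul_eq_mul]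
  -- The quantity to be bounded is the derivative at t₀ of this ψ, so it suffices to estimate the
  -- increments of ψ in t.
  refine abs_le_of_hasDerivWithinAt (ψ := fun t => w t x - w t x₀ - (x - x₀) * l * t) hab ht₀
    ?_ ?_
  · have := (((ht t₀ ht₀ x hxs).sub (ht t₀ ht₀ x₀ hx₀)).sub
      ((hasDerivWithinAt_id t₀ (Icc a b)).const_mul ((x - x₀) * l)))
    exact this.congr_deriv (by ring)
  · filter_upwards [self_mem_nhdsWithin, mem_nhdsWithin_of_mem_nhds (Metric.ball_mem_nhds t₀ hδ)]
      with t hts htδ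
    rw [Metric.mem_ball, Real.dist_eq] at htδ
    have hsubt : uIcc t₀ t ⊆ Icc a b := uIcc_subset_Icc ht₀ hts
    -- The mean value inequality, first in t for wx and then in x for w, bounds the mixed second
    -- difference minus l(t − t₀)(x − x₀) by ε|t − t₀||x − x₀|.
    have inner : ∀ r ∈ uIcc x₀ x, ‖wx t r - wx t₀ r - (t - t₀) * l‖ ≤ ε * |t - t₀| :=
      fun r hr => by
        have hr' := hsubx hr
        have hrδ : |r - x₀| < δ := (abs_sub_left_of_mem_uIcc hr).trans_lt hxδ
        have := (convex_uIcc t₀ t).norm_image_sub_le_of_norm_hasDerivWithin_le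
          (f := fun s => wx s r - s * l) (f' := fun s => wxt s r - 1 * l) (C := ε)
          (fun s hs => ((hxt s (hsubt hs) r hr').mono hsubt).sub
            ((hasDerivWithinAt_id s _).mul_const l))
          (fun s hs => by
            rw [one_mul]
            exact near s (hsubt hs) r hr' ((abs_sub_left_of_mem_uIcc hs).trans_lt htδ) hrδ)
          left_mem_uIcc right_mem_uIcc
        rw [Real.norm_eq_abs (t - t₀)] at this
        rwa [show wx t r - wx t₀ r - (t - t₀) * l = wx t r - t * l - (wx t₀ r - t₀ * l) by ring]
    have := (convex_uIcc x₀ x).norm_image_sub_le_of_norm_hasDerivWithin_le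
      (f := fun r => w t r - w t₀ r - (t - t₀) * l * r)
      (f' := fun r => wx t r - wx t₀ r - (t - t₀) * l) (C := ε * |t - t₀|)
      (fun r hr => by
        have := (((hx t hts r (hsubx hr)).mono hsubx).sub ((hx t₀ ht₀ r (hsubx hr)).mono hsubx)).sub
          ((hasDerivWithinAt_id r (uIcc x₀ x)).const_mul ((t - t₀) * l))
        exact this.congr_deriv (by ring))
      inner left_mem_uIcc right_mem_uIcc
    rw [Real.norm_eq_abs, Real.norm_eq_abs] at this
    have e : w t x - w t x₀ - (x - x₀) * l * t - (w t₀ x - w t₀ x₀ - (x - x₀) * l * t₀)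
      = w t x - w t₀ x - (t - t₀) * l * x - (w t x₀ - w t₀ x₀ - (t - t₀) * l * x₀) := by ring
    rw [e]
    linarith

/-! ### Stability and convergence of the linearized scheme -/

theorem opH_congr {J₁ J₂ i j : ℕ} (h : Interior J₁ J₂ i j) {w z : ℕ → ℕ → ℝ}
    (hwz : ∀ i ≤ 2 * J₁, ∀ j ≤ 2 * J₂, w i j = z i j) : opH J₁ J₂ w i j = opH J₁ J₂ z i j := by
  obtain ⟨hi, hi', hj, hj'⟩ := h.bounds
  simp only [opH_eq_stencil _ h, stencil, nbrX, nbrY]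
  rw [hwz i (by omega) j (by omega), hwz (i + 1) (by omega) j (by omega),
    hwz (i - 1) (by omega) j (by omega), hwz i (by omega) (j + 1) (by omega),
    hwz i (by omega) (j - 1) (by omega), hwz (i + 1) (by omega) (j + 1) (by omega),
    hwz (i + 1) (by omega) (j - 1) (by omega), hwz (i - 1) (by omega) (j + 1) (by omega),
    hwz (i - 1) (by omega) (j - 1) (by omega)]

theorem VanishesOnBoundary.dt {J₁ J₂ : ℕ} {W : ℕ → ℕ → ℕ → ℝ} {n : ℕ} (τ : ℝ)
    (h : VanishesOnBoundary J₁ J₂ (W n)) (h' : VanishesOnBoundary J₁ J₂ (W (n - 1))) :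
    VanishesOnBoundary J₁ J₂ (dt τ W n) where
  left j hj := by simp [PlateScheme.dt, h.left j hj, h'.left j hj]
  right j hj := by simp [PlateScheme.dt, h.right j hj, h'.right j hj]
  bottom i hi := by simp [PlateScheme.dt, h.bottom i hi, h'.bottom i hi]
  top i hi := by simp [PlateScheme.dt, h.top i hi, h'.top i hi]

theorem dtBar_eq (τ : ℝ) (W : ℕ → ℕ → ℕ → ℝ) (n : ℕ) :
    (fun i j => (dt τ W (n + 1) i j + dt τ W n i j) / 2) = dtBar τ W n := by
  funext i j
  simp only [dt, dtBar, Nat.add_sub_cancel]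
  rw [← add_div, div_div, mul_comm τ 2]
  ring

/-- The energy argument for the scheme itself, without shift. The damping coefficients need only be
nonnegative, so nothing has to be known in advance about P(‖Vⁿ‖_F²). -/
theorem norm_bound_of_scheme {J₁ J₂ N : ℕ} (h₁ : 1 ≤ J₁) (h₂ : 1 ≤ J₂) {τ c F : ℝ} (hτ : 0 < τ)
    (hc : 0 ≤ c) (hF : 0 ≤ F) {U V f : ℕ → ℕ → ℕ → ℝ} {p : ℕ → ℝ}
    (vU : ∀ n ≤ N + 1, VanishesOnBoundary J₁ J₂ (U n))
    (vV : ∀ n ≤ N + 1, VanishesOnBoundary J₁ J₂ (V n)) (hp : ∀ n, 0 ≤ p n)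
    (hU : ∀ n, 1 ≤ n → n ≤ N → ∀ i j, Interior J₁ J₂ i j → opH J₁ J₂ (dt2 τ U n) i j
      + p n * opH J₁ J₂ (dtBar τ U n) i j + opPhi J₁ J₂ (avg V n) i j = opH J₁ J₂ (f n) i j)
    (hV : ∀ n, 1 ≤ n → n ≤ N → ∀ i j, Interior J₁ J₂ i j →
      opH J₁ J₂ (dtBar τ V n) i j = opPhi J₁ J₂ (dtBar τ U n) i j)
    (hf : ∀ n ≤ N, ∀ i ≤ 2 * J₁, ∀ j ≤ 2 * J₂, |f n i j| ≤ F)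
    (hU1 : ∀ i ≤ 2 * J₁, ∀ j ≤ 2 * J₂, |dt τ U 1 i j| ≤ c)
    (hV0 : ∀ i ≤ 2 * J₁, ∀ j ≤ 2 * J₂, |V 0 i j| ≤ c)
    (hV1 : ∀ i ≤ 2 * J₁, ∀ j ≤ 2 * J₂, |V 1 i j| ≤ c) :
    ∀ n ≤ N, gridNorm J₁ J₂ (V n) ≤ 3 * (2 * c + 3 * (n * τ) * F) := by
  have vE : ∀ n ≤ N, VanishesOnBoundary J₁ J₂ (dt τ U (n + 1)) := fun n hn =>
    (vU (n + 1) (by omega)).dt τ (vU n (by omega))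
  have v0 : VanishesOnBoundary J₁ J₂ (fun _ _ => 0) := ⟨by simp, by simp, by simp, by simp⟩
  have en : ∀ n ≤ N, energy J₁ J₂ (dt τ U (n + 1)) (V (n + 1)) (V n)
      ≤ 2 * c + 3 * (n * τ) * F := by
    intro n
    induction n with
    | zero =>
      intro _
      refine (energy_le h₁ h₂ (vE 0 (by omega)) (vV 1 (by omega)) (vV 0 (by omega)) hc hU1 hV1
        hV0).trans (by simp)
    | succ n ih =>
      intro hn
      have step := energy_step (κ := 0) (G := fun _ _ => 0) (G' := fun _ _ => 0)
        (g := opH J₁ J₂ (f (n + 1))) (s := fun _ _ => 0) h₁ h₂ hτ (hp (n + 1)) le_rfl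
        (vE n (by omega)) (vE (n + 1) hn) (vV n (by omega)) (vV (n + 1) (by omega))
        (vV (n + 1 + 1) (by omega)) v0 v0 (by simp)
        (fun i j h => by
          rw [← hU (n + 1) (by omega) hn i j h, dtBar_eq]
          simp only [sub_zero]
          rfl)
        (fun i j h => by
          rw [dtBar_eq, add_zero, ← hV (n + 1) (by omega) hn i j h]
          rfl)
      simp only [sub_zero, zero_add] at step
      have g : gridNorm J₁ J₂ (opH J₁ J₂ (f (n + 1))) ≤ F :=
        gridNorm_le_of_abs_le h₁ h₂ hF fun i j h => abs_opH_le h (hf (n + 1) hn)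
      have z : gridNorm J₁ J₂ (fun _ _ => 0) ≤ 0 :=
        gridNorm_le_of_abs_le h₁ h₂ le_rfl (by simp)
      have := ih (by omega)
      have := mul_le_mul_of_nonneg_left (add_le_add g z) hτ.le
      push_cast
      linarith
  intro n hn
  have := (gridNorm_le_energy h₁ h₂ (vE n hn) (vV (n + 1) (by omega)) (vV n (by omega))).2.2
  linarith [en n hn]

/-- Convergence of the scheme: if `(u, v)` satisfies the scheme, with `Φ vⁿ` in place of
`Φ ṽⁿ`, up to errors of order `δ`, then the difference to the solution `(U, V)` of the scheme is of
order `δ`. -/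
theorem exists_error_bound (K T : ℝ) (hK : 0 ≤ K) :
    ∃ C : ℝ, 0 < C ∧ ∀ (J₁ J₂ N : ℕ) (τ δ : ℝ) (u v U V F : ℕ → ℕ → ℕ → ℝ) (p q : ℕ → ℝ),
      1 ≤ J₁ → 1 ≤ J₂ → 0 < τ → (N : ℝ) * τ ≤ T → 0 ≤ δ →
      (∀ n ≤ N + 1, VanishesOnBoundary J₁ J₂ (u n)) →
      (∀ n ≤ N + 1, VanishesOnBoundary J₁ J₂ (v n)) →
      (∀ n ≤ N + 1, VanishesOnBoundary J₁ J₂ (U n)) →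
      (∀ n ≤ N + 1, VanishesOnBoundary J₁ J₂ (V n)) →
      (∀ n, 0 ≤ p n) →
      (∀ n, 1 ≤ n → n ≤ N → ∀ i j, Interior J₁ J₂ i j → opH J₁ J₂ (dt2 τ U n) i j
        + p n * opH J₁ J₂ (dtBar τ U n) i j + opPhi J₁ J₂ (avg V n) i j = F n i j) →
      (∀ n, 1 ≤ n → n ≤ N → ∀ i j, Interior J₁ J₂ i j →
        opH J₁ J₂ (dtBar τ V n) i j = opPhi J₁ J₂ (dtBar τ U n) i j) →
      (∀ n, 1 ≤ n → n ≤ N → ∀ i j, Interior J₁ J₂ i j → |opH J₁ J₂ (dt2 τ u n) i j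
        + q n * opH J₁ J₂ (dtBar τ u n) i j + opPhi J₁ J₂ (v n) i j - F n i j| ≤ K * δ) →
      (∀ n, 1 ≤ n → n ≤ N → ∀ i j, Interior J₁ J₂ i j →
        |opH J₁ J₂ (dtBar τ v n) i j - opPhi J₁ J₂ (dtBar τ u n) i j| ≤ K * δ) →
      (∀ n, 1 ≤ n → n ≤ N → ∀ i ≤ 2 * J₁, ∀ j ≤ 2 * J₂, |dtBar τ u n i j| ≤ K) →
      (∀ n, 1 ≤ n → n ≤ N → ∀ i ≤ 2 * J₁, ∀ j ≤ 2 * J₂,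
        |v (n + 1) i j - 2 * v n i j + v (n - 1) i j| ≤ 2 * (K * δ)) →
      (∀ n, 1 ≤ n → n + 1 ≤ N → ∀ i ≤ 2 * J₁, ∀ j ≤ 2 * J₂,
        |(v (n + 2) i j - 2 * v (n + 1) i j + v n i j)
          - (v (n + 1) i j - 2 * v n i j + v (n - 1) i j)| ≤ 2 * (τ * (K * δ))) →
      (∀ n, 1 ≤ n → n ≤ N → |q n - p n| ≤ K * (δ + gridNorm J₁ J₂ (fun i j => v n i j - V n i j))) →
      (∀ i ≤ 2 * J₁, ∀ j ≤ 2 * J₂, |dt τ u 1 i j - dt τ U 1 i j| ≤ K * δ) →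
      (∀ i ≤ 2 * J₁, ∀ j ≤ 2 * J₂, |v 0 i j - V 0 i j| ≤ K * δ) →
      (∀ i ≤ 2 * J₁, ∀ j ≤ 2 * J₂, |v 1 i j - V 1 i j| ≤ K * δ) →
      ∀ n, 1 ≤ n → n ≤ N → gridNorm J₁ J₂ (dt τ (u - U) (n + 1)) ≤ C * δ
        ∧ gridNorm J₁ J₂ (v (n + 1) - V (n + 1)) ≤ C * δ
        ∧ gridNorm J₁ J₂ (v n - V n) ≤ C * δ := by
  -- A/3 dominates the rates in the step below: 3K from the drift of G and the two residuals, the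
  -- powers K² and K³ from the coefficient error times the velocity bound K.
  set A : ℝ := 3 * (3 * K + 3 * K ^ 2 + K ^ 3 + 3 * K ^ 2) with hA
  have hA0 : 0 ≤ A := by positivity
  -- The exponential part bounds the shifted energy in units of δ, 3 leads from energy to norms, and
  -- K pays for undoing the shift.
  refine ⟨3 * (Real.exp (A * T) * (4 * K + 1)) + K + 1, by positivity, ?_⟩
  intro J₁ J₂ N τ δ u v U V F p q h₁ h₂ hτ hN hδ vu vv vU vV hp hU hV hu hv hut hG hGG hpq i0 i1 i2
  set e : ℕ → ℕ → ℕ → ℝ := u - U with he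
  set η : ℕ → ℕ → ℕ → ℝ := v - V with hη
  -- The second difference at n = 0 would need a value at time −τ. With `max n 1` the shift at 0
  -- equals the one at 1, so the first step has no drift.
  set G : ℕ → ℕ → ℕ → ℝ := fun n i j =>
    (v (max n 1 + 1) i j - 2 * v (max n 1) i j + v (max n 1 - 1) i j) / 2 with hGdef
  intro n₀ hn₀ hn₀N
  have hKδ : 0 ≤ K * δ := mul_nonneg hK hδ
  have ve : ∀ n ≤ N + 1, VanishesOnBoundary J₁ J₂ (e n) := fun n hn => (vu n hn).sub (vU n hn)
  have vη : ∀ n ≤ N + 1, VanishesOnBoundary J₁ J₂ (η n) := fun n hn => (vv n hn).sub (vV n hn)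
  have vde : ∀ n ≤ N, VanishesOnBoundary J₁ J₂ (dt τ e (n + 1)) := fun n hn =>
    (ve (n + 1) (by omega)).dt τ (ve n (by omega))
  have vG : ∀ n ≤ N, VanishesOnBoundary J₁ J₂ (G n) := fun n hn => by
    have hmax : max n 1 ≤ N := by omega
    have a := vv (max n 1 + 1) (by omega)
    have b := vv (max n 1) (by omega)
    have c := vv (max n 1 - 1) (by omega)
    have := (a.linComb b (1 / 2) (-1)).linComb c 1 (1 / 2)
    convert this using 1
    funext i j
    simp only [hGdef]; ring
  have bG : ∀ n ≤ N, ∀ i ≤ 2 * J₁, ∀ j ≤ 2 * J₂, |G n i j| ≤ K * δ := fun n hn i hi j hj => by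
    have := hG (max n 1) (by omega) (by omega) i hi j hj
    simp only [hGdef]
    rw [abs_div, abs_of_pos (by norm_num : (0 : ℝ) < 2)]
    linarith
  have nG : ∀ n ≤ N, gridNorm J₁ J₂ (G n) ≤ K * δ := fun n hn =>
    gridNorm_le_of_abs_le h₁ h₂ hKδ fun i j h => by
      obtain ⟨hi, hi', hj, hj'⟩ := h.bounds
      exact bG n hn i (by omega) j (by omega)
  have bGG : ∀ n, n + 1 ≤ N → ∀ i ≤ 2 * J₁, ∀ j ≤ 2 * J₂,
      |G (n + 1) i j - G n i j| ≤ τ * (K * δ) := fun n hn i hi j hj => by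
    rcases Nat.eq_zero_or_pos n with rfl | hpos
    · have : 0 ≤ τ * (K * δ) := by positivity
      simpa [hGdef] using this
    · have := hGG n hpos hn i hi j hj
      have m1 : max (n + 1) 1 = n + 1 := by omega
      have m2 : max n 1 = n := by omega
      simp only [hGdef, m1, m2, Nat.add_sub_cancel]
      rw [← sub_div, abs_div, abs_of_pos (by norm_num : (0 : ℝ) < 2)]
      linarith
  set y : ℕ → ℝ := fun n => energy J₁ J₂ (dt τ e (n + 1)) (fun i j => η (n + 1) i j - G n i j)
    (fun i j => η n i j - G n i j) with hy
  have hy0 : ∀ n, 0 ≤ y n := fun n => energy_nonneg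
  have ynorm : ∀ n ≤ N, gridNorm J₁ J₂ (dt τ e (n + 1)) ≤ 3 * y n
      ∧ gridNorm J₁ J₂ (η (n + 1)) ≤ 3 * y n + K * δ ∧ gridNorm J₁ J₂ (η n) ≤ 3 * y n + K * δ := by
    intro n hn
    obtain ⟨a, b, c⟩ := gridNorm_le_energy h₁ h₂ (vde n hn) ((vη (n + 1) (by omega)).sub (vG n hn))
      ((vη n (by omega)).sub (vG n hn))
    have back : ∀ m, gridNorm J₁ J₂ (η m)
        ≤ gridNorm J₁ J₂ (fun i j => η m i j - G n i j) + gridNorm J₁ J₂ (G n) := fun m => by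
      have := gridNorm_add_le J₁ J₂ (fun i j => η m i j - G n i j) (G n)
      simpa only [sub_add_cancel] using this
    exact ⟨a, by linarith [back (n + 1), nG n hn], by linarith [back n, nG n hn]⟩
  have step : ∀ n < N, y (n + 1) ≤ y n + τ * A * (y n + δ) := by
    intro n hn
    -- In the error equation the scheme's coefficient p multiplies the velocity error, so the
    -- residual is corrected by (q − p)𝓗 applied to the exact discrete velocity.
    set g : ℕ → ℕ → ℝ := fun i j => opH J₁ J₂ (dt2 τ u (n + 1)) i j
        + q (n + 1) * opH J₁ J₂ (dtBar τ u (n + 1)) i j + opPhi J₁ J₂ (v (n + 1)) i j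
        - F (n + 1) i j - (q (n + 1) - p (n + 1)) * opH J₁ J₂ (dtBar τ u (n + 1)) i j with hg
    set s : ℕ → ℕ → ℝ := fun i j => opH J₁ J₂ (dtBar τ v (n + 1)) i j
        - opPhi J₁ J₂ (dtBar τ u (n + 1)) i j with hs
    have E := energy_step (g := g) (s := s) h₁ h₂ hτ (hp (n + 1))
      (by positivity : 0 ≤ τ * (K * δ)) (vde n (by omega)) (vde (n + 1) hn) (vη n (by omega))
      (vη (n + 1) (by omega)) (vη (n + 1 + 1) (by omega)) (vG (n + 1) hn) (vG n (by omega))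
      (bGG n hn)
      (fun i j h => by
        have m1 : max (n + 1) 1 = n + 1 := by omega
        have e1 : (fun i j => (dt τ e (n + 1 + 1) i j - dt τ e (n + 1) i j) / τ)
            = fun i j => 1 * dt2 τ u (n + 1) i j + -1 * dt2 τ U (n + 1) i j := by
          funext i j
          simp only [he, dt2, dt, Pi.sub_apply, Nat.add_sub_cancel]
          ring
        have e2 : dtBar τ e (n + 1)
            = fun i j => 1 * dtBar τ u (n + 1) i j + -1 * dtBar τ U (n + 1) i j := by
          funext i j
          simp only [he, dtBar, Pi.sub_apply]
          ring
        -- The purpose of the shift: the average of η minus G is exactly vⁿ⁺¹ − Ṽⁿ⁺¹.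
        have e3 : (fun i j => (η (n + 1 + 1) i j + η n i j) / 2 - G (n + 1) i j)
            = fun i j => 1 * v (n + 1) i j + -1 * avg V (n + 1) i j := by
          funext i j
          simp only [hη, hGdef, avg, m1, Pi.sub_apply, Nat.add_sub_cancel]
          ring
        rw [dtBar_eq, e1, e2, e3, opH_linComb h, opH_linComb h, opPhi_linComb h, hg]
        linarith [hU (n + 1) (by omega) hn i j h])
      (fun i j h => by
        have e1 : (fun i j => (η (n + 1 + 1) i j - η n i j) / (2 * τ))
            = fun i j => 1 * dtBar τ v (n + 1) i j + -1 * dtBar τ V (n + 1) i j := by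
          funext i j
          simp only [hη, dtBar, Pi.sub_apply, Nat.add_sub_cancel]
          ring
        have e2 : dtBar τ e (n + 1)
            = fun i j => 1 * dtBar τ u (n + 1) i j + -1 * dtBar τ U (n + 1) i j := by
          funext i j
          simp only [he, dtBar, Pi.sub_apply]
          ring
        rw [dtBar_eq, e1, e2, opH_linComb h, opPhi_linComb h, hs]
        linarith [hV (n + 1) (by omega) hn i j h])
    have yn := hy0 n
    -- The coefficient at level n + 1 involves η(n + 1), which is already part of y(n); hence the
    -- recursion is explicit.
    have hηn := (ynorm n (by omega)).2.1
    have hpq' : |q (n + 1) - p (n + 1)| ≤ K * (δ + (3 * y n + K * δ)) :=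
      (hpq (n + 1) (by omega) hn).trans
        (mul_le_mul_of_nonneg_left (add_le_add le_rfl hηn) hK)
    have ng : gridNorm J₁ J₂ g ≤ K * δ + K * (δ + (3 * y n + K * δ)) * K := by
      refine gridNorm_le_of_abs_le h₁ h₂ (by positivity) fun i j h => ?_
      refine (abs_sub _ _).trans (add_le_add (hu (n + 1) (by omega) hn i j h) ?_)
      rw [abs_mul]
      exact mul_le_mul hpq' (abs_opH_le h (hut (n + 1) (by omega) hn)) (abs_nonneg _)
        (by positivity)
    have ns : gridNorm J₁ J₂ s ≤ K * δ :=
      gridNorm_le_of_abs_le h₁ h₂ hKδ fun i j h => hv (n + 1) (by omega) hn i j h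
    have tot : K * δ + (gridNorm J₁ J₂ g + gridNorm J₁ J₂ s) ≤ A / 3 * (y n + δ) := by
      have : A / 3 * (y n + δ) - (K * δ + (K * δ + K * (δ + (3 * y n + K * δ)) * K + K * δ))
          = (3 * K + 3 * K ^ 2 + K ^ 3) * y n + 5 * K ^ 2 * δ := by
        rw [hA]; ring
      have : 0 ≤ (3 * K + 3 * K ^ 2 + K ^ 3) * y n + 5 * K ^ 2 * δ := by positivity
      linarith
    have := mul_le_mul_of_nonneg_left tot hτ.le
    refine E.trans ?_
    change y n + _ ≤ _
    linarith
  have y00 : y 0 ≤ 4 * K * δ := by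
    have := energy_le h₁ h₂ (vde 0 (by omega)) ((vη (0 + 1) (by omega)).sub (vG 0 (by omega)))
      ((vη 0 (by omega)).sub (vG 0 (by omega))) (c := 2 * (K * δ)) (by positivity)
      (fun i hi j hj => by
        have := i0 i hi j hj
        rw [show dt τ e (0 + 1) i j = dt τ u 1 i j - dt τ U 1 i j by
          simp only [he, dt, Pi.sub_apply]; ring]
        linarith)
      (fun i hi j hj => by
        have a := i2 i hi j hj
        have b := bG 0 (by omega) i hi j hj
        refine (abs_sub _ _).trans ?_
        change |v 1 i j - V 1 i j| + _ ≤ _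
        linarith)
      (fun i hi j hj => by
        have a := i1 i hi j hj
        have b := bG 0 (by omega) i hi j hj
        refine (abs_sub _ _).trans ?_
        change |v 0 i j - V 0 i j| + _ ≤ _
        linarith)
    change y 0 ≤ _ at this
    linarith
  have gron := discrete_gronwall hδ hy0 step n₀ hn₀N
  have ht : Real.exp (A * (n₀ * τ)) ≤ Real.exp (A * T) := by
    refine Real.exp_le_exp.2 (mul_le_mul_of_nonneg_left (le_trans ?_ hN) hA0)
    gcongr
  have fin : y n₀ ≤ Real.exp (A * T) * (4 * K + 1) * δ := by
    have : Real.exp (A * (n₀ * τ)) * (y 0 + δ) ≤ Real.exp (A * T) * (4 * K * δ + δ) :=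
      mul_le_mul ht (by linarith) (add_nonneg (hy0 0) hδ) (Real.exp_pos _).le
    linarith
  obtain ⟨a, b, c⟩ := ynorm n₀ hn₀N
  refine ⟨?_, ?_, ?_⟩
  · linarith
  · change gridNorm J₁ J₂ (η (n₀ + 1)) ≤ _
    linarith
  · change gridNorm J₁ J₂ (η n₀) ≤ _
    linarith

/-! ### Regularity of the solution -/

/-- All `∂ₜᵃ' ∂ₓᵇ' ∂_yᶜ' u` with `a' ≤ a`, `b' ≤ b`, `c' ≤ c` are bounded by `M`. -/
def AllBounded (T M : ℝ) (a b c : ℕ) (u : ℝ → ℝ → ℝ → ℝ) : Prop :=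
  ∀ a' ≤ a, ∀ b' ≤ b, ∀ c' ≤ c, ∀ t ∈ Icc 0 T, ∀ x ∈ Icc (0 : ℝ) 1, ∀ y ∈ Icc (0 : ℝ) 1,
    |partialDeriv T a' b' c' u t x y| ≤ M

theorem AllBounded.mono {T M M' : ℝ} {a b c : ℕ} {u : ℝ → ℝ → ℝ → ℝ}
    (h : AllBounded T M a b c u) (hM : M ≤ M') : AllBounded T M' a b c u :=
  fun a' ha b' hb c' hc t ht x hx y hy => (h a' ha b' hb c' hc t ht x hx y hy).trans hM

namespace PartialBound

variable {T Q : ℝ} {a b c : ℕ} {u : ℝ → ℝ → ℝ → ℝ}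

/-- Q bounds only the highest derivative; the lower ones are bounded by compactness. The constant
depends on u but on no discretization parameter. -/
theorem exists_allBounded (h : PartialBound T Q a b c u) : ∃ M, AllBounded T M a b c u := by
  have hcpt : IsCompact (cylinder T) := isCompact_Icc.prod (isCompact_Icc.prod isCompact_Icc)
  have ex : ∀ k : Fin (a + 1) × Fin (b + 1) × Fin (c + 1), ∃ C, ∀ p ∈ cylinder T,
      ‖partialDeriv T k.1 k.2.1 k.2.2 u p.1 p.2.1 p.2.2‖ ≤ C := fun k =>
    hcpt.exists_bound_of_continuousOn
      (h.cont k.1 (by omega) k.2.1 (by omega) k.2.2 (by omega))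
  choose C hC using ex
  obtain ⟨M, hM⟩ := (Set.finite_range C).bddAbove
  refine ⟨M, fun a' ha b' hb c' hc t ht x hx y hy => ?_⟩
  exact (hC (⟨a', by omega⟩, ⟨b', by omega⟩, ⟨c', by omega⟩) (t, x, y) ⟨ht, hx, hy⟩).trans
    (hM (mem_range_self _))

theorem hasDeriv_t (h : PartialBound T Q a b c u) {a' b' c' : ℕ} (ha : a' < a) (hb : b' ≤ b)
    (hc : c' ≤ c) {t x y : ℝ} (ht : t ∈ Icc 0 T) (hx : x ∈ Icc (0 : ℝ) 1)
    (hy : y ∈ Icc (0 : ℝ) 1) :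
    HasDerivWithinAt (fun s => partialDeriv T a' b' c' u s x y)
      (partialDeriv T (a' + 1) b' c' u t x y) (Icc 0 T) t := by
  have := (h.diff_t a' ha b' hb c' hc t ht x hx y hy).hasDerivWithinAt
  simp only [partialDeriv, Function.iterate_succ_apply'] at this ⊢
  exact this

/-- `partialDeriv` applies ∂ₜ last, so the x-derivative has to be moved past one ∂ₜ at a time. The
cases a' = 1, 2 serve to compute the Laplacian that defines V¹. -/
theorem hasDeriv_x (hT : 0 < T) (h : PartialBound T Q a b c u) {a' b' c' : ℕ} (ha : a' ≤ a)
    (hb : b' < b) (hc : c' ≤ c) {t x y : ℝ} (ht : t ∈ Icc 0 T) (hx : x ∈ Icc (0 : ℝ) 1)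
    (hy : y ∈ Icc (0 : ℝ) 1) :
    HasDerivWithinAt (fun s => partialDeriv T a' b' c' u t s y)
      (partialDeriv T a' (b' + 1) c' u t x y) (Icc 0 1) x := by
  induction a' generalizing t x with
  | zero =>
    have := (h.diff_x b' hb c' hc t ht x hx y hy).hasDerivWithinAt
    simp only [partialDeriv, Function.iterate_succ_apply', Function.iterate_zero, id_eq]
      at this ⊢
    exact this
  | succ k ih =>
    refine hasDerivWithinAt_swap hT
      (w := fun t x => partialDeriv T k b' c' u t x y)
      (wx := fun t x => partialDeriv T k (b' + 1) c' u t x y)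
      (wt := fun t x => partialDeriv T (k + 1) b' c' u t x y)
      (wxt := fun t x => partialDeriv T (k + 1) (b' + 1) c' u t x y)
      (fun t ht x hx => ih (by omega) ht hx)
      (fun t ht x hx => h.hasDeriv_t (by omega) (by omega) hc ht hx hy)
      (fun t ht x hx => h.hasDeriv_t (by omega) (by omega) hc ht hx hy) ?_ ht hx
    exact (h.cont (k + 1) ha (b' + 1) hb c' hc).comp
      (f := fun p : ℝ × ℝ => (p.1, p.2, y)) (by fun_prop)
      fun p hp => ⟨hp.1, hp.2, hy⟩

theorem hasDeriv_y (hT : 0 < T) (h : PartialBound T Q a b c u) {a' c' : ℕ} (ha : a' ≤ a)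
    (hc : c' < c) {t x y : ℝ} (ht : t ∈ Icc 0 T) (hx : x ∈ Icc (0 : ℝ) 1)
    (hy : y ∈ Icc (0 : ℝ) 1) :
    HasDerivWithinAt (fun s => partialDeriv T a' 0 c' u t x s)
      (partialDeriv T a' 0 (c' + 1) u t x y) (Icc 0 1) y := by
  induction a' generalizing t y with
  | zero =>
    have := (h.diff_y c' hc t ht x hx y hy).hasDerivWithinAt
    simp only [partialDeriv, Function.iterate_succ_apply', Function.iterate_zero, id_eq]
      at this ⊢
    exact this
  | succ k ih =>
    refine hasDerivWithinAt_swap hT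
      (w := fun t y => partialDeriv T k 0 c' u t x y)
      (wx := fun t y => partialDeriv T k 0 (c' + 1) u t x y)
      (wt := fun t y => partialDeriv T (k + 1) 0 c' u t x y)
      (wxt := fun t y => partialDeriv T (k + 1) 0 (c' + 1) u t x y)
      (fun t ht y hy => ih (by omega) ht hy)
      (fun t ht y hy => h.hasDeriv_t (by omega) (by omega) (by omega) ht hx hy)
      (fun t ht y hy => h.hasDeriv_t (by omega) (by omega) (by omega) ht hx hy) ?_ ht hy
    exact (h.cont (k + 1) ha 0 (by omega) (c' + 1) hc).comp
      (f := fun p : ℝ × ℝ => (p.1, x, p.2)) (by fun_prop)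
      fun p hp => ⟨hp.1, hx, hp.2⟩

variable {M : ℝ}

theorem chain_t (h : PartialBound T Q a b c u) (hM : AllBounded T M a b c u) {b' c' : ℕ}
    (hb : b' ≤ b) (hc : c' ≤ c) {x y : ℝ} (hx : x ∈ Icc (0 : ℝ) 1) (hy : y ∈ Icc (0 : ℝ) 1) :
    DerivChain 0 T a M (fun k t => partialDeriv T k b' c' u t x y) where
  deriv _ hk _ ht := h.hasDeriv_t hk hb hc ht hx hy
  bound k hk t ht := hM k hk b' hb c' hc t ht x hx y hy

theorem chain_x (hT : 0 < T) (h : PartialBound T Q a b c u) (hM : AllBounded T M a b c u) {t y : ℝ}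
    (ht : t ∈ Icc 0 T) (hy : y ∈ Icc (0 : ℝ) 1) :
    DerivChain 0 1 b M (fun k x => partialDeriv T 0 k 0 u t x y) where
  deriv k hk x hx := h.hasDeriv_x hT (by omega) hk (by omega) ht hx hy
  bound k hk x hx := hM 0 (by omega) k hk 0 (by omega) t ht x hx y hy

theorem chain_y (hT : 0 < T) (h : PartialBound T Q a b c u) (hM : AllBounded T M a b c u) {t x : ℝ}
    (ht : t ∈ Icc 0 T) (hx : x ∈ Icc (0 : ℝ) 1) :
    DerivChain 0 1 c M (fun k y => partialDeriv T 0 0 k u t x y) where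
  deriv k hk y hy := h.hasDeriv_y hT (by omega) hk ht hx hy
  bound k hk y hy := hM 0 (by omega) 0 (by omega) k hk t ht x hx y hy

end PartialBound

/-! ### The Laplacian, the square integral and the Lipschitz property of P. -/

theorem lap_eq_partialDeriv (T : ℝ) (u : ℝ → ℝ → ℝ → ℝ) (t x y : ℝ) :
    lap (u t) x y = partialDeriv T 0 2 0 u t x y + partialDeriv T 0 0 2 u t x y := rfl

/-- The Laplacian depends only on the values on the square. -/
theorem lap_congr {g k : ℝ → ℝ → ℝ}
    (h : ∀ x ∈ Icc (0 : ℝ) 1, ∀ y ∈ Icc (0 : ℝ) 1, g x y = k x y) :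
    ∀ x ∈ Icc (0 : ℝ) 1, ∀ y ∈ Icc (0 : ℝ) 1, lap g x y = lap k x y := by
  have hX : ∀ {g k : ℝ → ℝ → ℝ}, (∀ x ∈ Icc (0 : ℝ) 1, ∀ y ∈ Icc (0 : ℝ) 1, g x y = k x y) →
      ∀ x ∈ Icc (0 : ℝ) 1, ∀ y ∈ Icc (0 : ℝ) 1, dX g x y = dX k x y := fun h x hx y hy =>
    derivWithin_congr (fun s hs => h s hs y hy) (h x hx y hy)
  have hY : ∀ {g k : ℝ → ℝ → ℝ}, (∀ x ∈ Icc (0 : ℝ) 1, ∀ y ∈ Icc (0 : ℝ) 1, g x y = k x y) →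
      ∀ x ∈ Icc (0 : ℝ) 1, ∀ y ∈ Icc (0 : ℝ) 1, dY g x y = dY k x y := fun h x hx y hy =>
    derivWithin_congr (fun s hs => h x hx s hs) (h x hx y hy)
  intro x hx y hy
  rw [lap, lap, hX (hX h) x hx y hy, hY (hY h) x hx y hy]

theorem sqIntegral_congr {g k : ℝ → ℝ → ℝ}
    (h : ∀ x ∈ Icc (0 : ℝ) 1, ∀ y ∈ Icc (0 : ℝ) 1, g x y = k x y) :
    sqIntegral g = sqIntegral k :=
  MeasureTheory.setIntegral_congr_fun (measurableSet_Icc.prod measurableSet_Icc)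
    fun p hp => by simp only [h p.1 hp.1 p.2 hp.2]

theorem sqIntegral_nonneg (g : ℝ → ℝ → ℝ) : 0 ≤ sqIntegral g :=
  MeasureTheory.integral_nonneg fun _ => sq_nonneg _

theorem sqIntegral_le {g : ℝ → ℝ → ℝ} {M : ℝ}
    (h : ∀ x ∈ Icc (0 : ℝ) 1, ∀ y ∈ Icc (0 : ℝ) 1, |g x y| ≤ M) : sqIntegral g ≤ M ^ 2 := by
  have hvol : MeasureTheory.volume (Icc (0 : ℝ) 1 ×ˢ Icc (0 : ℝ) 1 : Set (ℝ × ℝ)) = 1 := by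
    rw [MeasureTheory.Measure.volume_eq_prod, MeasureTheory.Measure.prod_prod]; simp
  have := MeasureTheory.norm_setIntegral_le_of_norm_le_const
    (μ := MeasureTheory.volume) (s := (Icc (0 : ℝ) 1 ×ˢ Icc (0 : ℝ) 1 : Set (ℝ × ℝ)))
    (f := fun p => |g p.1 p.2| ^ 2) (C := M ^ 2) (by rw [hvol]; simp)
    fun p hp => by
      rw [Real.norm_eq_abs, abs_of_nonneg (by positivity)]
      exact pow_le_pow_left₀ (abs_nonneg _) (h p.1 hp.1 p.2 hp.2) 2
  rw [MeasureTheory.measureReal_def, hvol] at this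
  simp only [ENNReal.toReal_one, mul_one] at this
  exact (le_abs_self _).trans this

theorem lap_eq_of_hasDeriv {g g₁ g₂ k₁ k₂ : ℝ → ℝ → ℝ}
    (h₁ : ∀ x ∈ Icc (0 : ℝ) 1, ∀ y ∈ Icc (0 : ℝ) 1,
      HasDerivWithinAt (fun s => g s y) (g₁ x y) (Icc 0 1) x)
    (h₂ : ∀ x ∈ Icc (0 : ℝ) 1, ∀ y ∈ Icc (0 : ℝ) 1,
      HasDerivWithinAt (fun s => g₁ s y) (g₂ x y) (Icc 0 1) x)
    (h₃ : ∀ x ∈ Icc (0 : ℝ) 1, ∀ y ∈ Icc (0 : ℝ) 1,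
      HasDerivWithinAt (fun s => g x s) (k₁ x y) (Icc 0 1) y)
    (h₄ : ∀ x ∈ Icc (0 : ℝ) 1, ∀ y ∈ Icc (0 : ℝ) 1,
      HasDerivWithinAt (fun s => k₁ x s) (k₂ x y) (Icc 0 1) y) :
    ∀ x ∈ Icc (0 : ℝ) 1, ∀ y ∈ Icc (0 : ℝ) 1, lap g x y = g₂ x y + k₂ x y := by
  intro x hx y hy
  have ud := uniqueDiffOn_Icc_zero_one
  have hX : ∀ x ∈ Icc (0 : ℝ) 1, dX g x y = g₁ x y := fun x hx =>
    (h₁ x hx y hy).derivWithin (ud x hx)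
  have hY : ∀ y ∈ Icc (0 : ℝ) 1, dY g x y = k₁ x y := fun y hy =>
    (h₃ x hx y hy).derivWithin (ud y hy)
  have hXX : dX (dX g) x y = g₂ x y :=
    (derivWithin_congr hX (hX x hx)).trans ((h₂ x hx y hy).derivWithin (ud x hx))
  have hYY : dY (dY g) x y = k₂ x y :=
    (derivWithin_congr hY (hY y hy)).trans ((h₄ x hx y hy).derivWithin (ud y hy))
  rw [lap, hXX, hYY]

/-- `P` is Lipschitz continuous with constant `L`. -/
theorem DampingSlope.abs_sub_le {P : ℝ → ℝ} {L : ℝ} (h : DampingSlope P L) {z w : ℝ} (hz : 0 ≤ z)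
    (hw : 0 ≤ w) : |P z - P w| ≤ L * |z - w| := by
  refine (convex_Ici (0 : ℝ)).norm_image_sub_le_of_norm_derivWithin_le
    (h.1.differentiableOn one_ne_zero) (fun x hx => ?_) hw hz
  have := h.2 x hx
  rw [Real.norm_eq_abs, abs_of_nonneg this.1]
  exact this.2

theorem DampingSlope.nonneg {P : ℝ → ℝ} {L : ℝ} (h : DampingSlope P L) : 0 ≤ L :=
  (h.2 0 le_rfl).1.trans (h.2 0 le_rfl).2

/-! ### Consistency of the compact differences -/

theorem cast_add_one_mul_step (J i : ℕ) : ((i + 1 : ℕ) : ℝ) * step J = i * step J + step J := by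
  push_cast; ring

theorem cast_sub_one_mul_step (J : ℕ) {i : ℕ} (hi : 1 ≤ i) :
    ((i - 1 : ℕ) : ℝ) * step J = i * step J - step J := by
  rw [Nat.cast_sub hi]; push_cast; ring

/-- The error is 𝓑 applied to the one-dimensional errors in x on three rows plus 𝓐 applied to those
in y on three columns. These averages have nonnegative weights of sum one, so the one-dimensional
bounds simply add. -/
theorem abs_opH_sub_opPhi_le {M : ℝ} {w : ℝ → ℝ → ℝ} {φ ψ : ℕ → ℝ → ℝ → ℝ} (hφw : φ 0 = w)
    (hψw : ψ 0 = w)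
    (hφ : ∀ y ∈ Icc (0 : ℝ) 1, DerivChain 0 1 6 M (fun k x => φ k x y))
    (hψ : ∀ x ∈ Icc (0 : ℝ) 1, DerivChain 0 1 6 M (fun k y => ψ k x y)) {J₁ J₂ : ℕ} (h₁ : 1 ≤ J₁)
    (h₂ : 1 ≤ J₂) {i j : ℕ} (h : Interior J₁ J₂ i j) :
    |opH J₁ J₂ (onGrid J₁ J₂ fun x y => φ 2 x y + ψ 2 x y) i j
      - opPhi J₁ J₂ (onGrid J₁ J₂ w) i j| ≤ 3 * M * (step J₁ ^ 4 + step J₂ ^ 4) := by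
  obtain ⟨hi, hi', hj, hj'⟩ := h.bounds
  have p₁ := step_pos h₁
  have p₂ := step_pos h₂
  have mx := fun k hk => mul_step_mem (i := k) h₁ hk
  have my := fun k hk => mul_step_mem (i := k) h₂ hk
  have mx0 := mx i (by omega)
  have mx1 := mx (i + 1) (by omega)
  have mx2 := mx (i - 1) (by omega)
  have my0 := my j (by omega)
  have my1 := my (j + 1) (by omega)
  have my2 := my (j - 1) (by omega)
  rw [cast_add_one_mul_step] at mx1 my1
  rw [cast_sub_one_mul_step _ hi] at mx2
  rw [cast_sub_one_mul_step _ hj] at my2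
  have ex := fun y hy => abs_le.1 ((hφ y hy).abs_compact_sub_le p₁ mx0 mx1 mx2)
  have ey := fun x hx => abs_le.1 ((hψ x hx).abs_compact_sub_le p₂ my0 my1 my2)
  have ex0 := ex _ my0
  have ex1 := ex _ my1
  have ex2 := ex _ my2
  have ey0 := ey _ mx0
  have ey1 := ey _ mx1
  have ey2 := ey _ mx2
  simp only [hφw, hψw] at ex0 ex1 ex2 ey0 ey1 ey2
  rw [opH_eq_stencil _ h, opPhi_eq_stencil _ h, abs_le]
  simp only [stencil, nbrX, nbrY, onGrid, cast_add_one_mul_step, cast_sub_one_mul_step _ hi,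
    cast_sub_one_mul_step _ hj]
  constructor <;> linarith

/-- The bound is a separate hypothesis, because (M₁ + M₂)/|c| would blow up for small time steps c.
-/
theorem DerivChain.quot {a b M M₁ M₂ c : ℝ} {m : ℕ} {φ ψ : ℕ → ℝ → ℝ}
    (hφ : DerivChain a b m M₁ φ) (hψ : DerivChain a b m M₂ ψ)
    (h : ∀ k ≤ m, ∀ x ∈ Icc a b, |(φ k x - ψ k x) / c| ≤ M) :
    DerivChain a b m M (fun k x => (φ k x - ψ k x) / c) where
  deriv k hk x hx := ((hφ.deriv k hk x hx).sub (hψ.deriv k hk x hx)).div_const c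
  bound := h

/-- The regularity of `u` and `v = Δ u` that enters the error estimate, with a common bound. -/
structure RegularWith (T M : ℝ) (u : ℝ → ℝ → ℝ → ℝ) : Prop where
  u_t : ∀ x ∈ Icc (0 : ℝ) 1, ∀ y ∈ Icc (0 : ℝ) 1,
    DerivChain 0 T 4 M (fun k t => partialDeriv T k 0 0 u t x y)
  lap_t : ∀ x ∈ Icc (0 : ℝ) 1, ∀ y ∈ Icc (0 : ℝ) 1, DerivChain 0 T 3 M
    (fun k t => partialDeriv T k 2 0 u t x y + partialDeriv T k 0 2 u t x y)
  u_x : ∀ t ∈ Icc 0 T, ∀ y ∈ Icc (0 : ℝ) 1,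
    DerivChain 0 1 6 M (fun k x => partialDeriv T 0 k 0 u t x y)
  u_y : ∀ t ∈ Icc 0 T, ∀ x ∈ Icc (0 : ℝ) 1,
    DerivChain 0 1 6 M (fun k y => partialDeriv T 0 0 k u t x y)
  u_x_lipschitz : ∀ k ≤ 6, ∀ s ∈ Icc 0 T, ∀ t ∈ Icc 0 T, ∀ x ∈ Icc (0 : ℝ) 1,
    ∀ y ∈ Icc (0 : ℝ) 1,
    |partialDeriv T 0 k 0 u s x y - partialDeriv T 0 k 0 u t x y| ≤ M * |s - t|
  u_y_lipschitz : ∀ k ≤ 6, ∀ s ∈ Icc 0 T, ∀ t ∈ Icc 0 T, ∀ x ∈ Icc (0 : ℝ) 1,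
    ∀ y ∈ Icc (0 : ℝ) 1,
    |partialDeriv T 0 0 k u s x y - partialDeriv T 0 0 k u t x y| ≤ M * |s - t|
  lap_x : ∀ t ∈ Icc 0 T, ∀ y ∈ Icc (0 : ℝ) 1,
    DerivChain 0 1 6 M (fun k x => partialDeriv T 0 k 0 (fun t => lap (u t)) t x y)
  lap_y : ∀ t ∈ Icc 0 T, ∀ x ∈ Icc (0 : ℝ) 1,
    DerivChain 0 1 6 M (fun k y => partialDeriv T 0 0 k (fun t => lap (u t)) t x y)
  lap_cont : ∀ t ∈ Icc 0 T,
    ContinuousOn (fun p : ℝ × ℝ => lap (u t) p.1 p.2) (Icc (0 : ℝ) 1 ×ˢ Icc (0 : ℝ) 1)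
  lap_lap : ∀ t ∈ Icc 0 T, ∀ x ∈ Icc (0 : ℝ) 1, ∀ y ∈ Icc (0 : ℝ) 1,
    |lap (lap (u t)) x y| ≤ M
  lap_taylor : ∀ τ : ℝ, ∀ x ∈ Icc (0 : ℝ) 1, ∀ y ∈ Icc (0 : ℝ) 1,
    lap (fun x y => u 0 x y + τ * dT T u 0 x y + τ ^ 2 / 2 * dT T (dT T u) 0 x y) x y
      = lap (u 0) x y + τ * (partialDeriv T 1 2 0 u 0 x y + partialDeriv T 1 0 2 u 0 x y)
        + τ ^ 2 / 2 * (partialDeriv T 2 2 0 u 0 x y + partialDeriv T 2 0 2 u 0 x y)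

theorem exists_regularWith {T Q : ℝ} (hT : 0 < T) {u : ℝ → ℝ → ℝ → ℝ} (hS : SolutionBounds T Q u)
    (hC : CompactBounds T Q u) : ∃ M, 0 ≤ M ∧ RegularWith T M u := by
  obtain ⟨M₁, h₁⟩ := hS.tttt.exists_allBounded
  obtain ⟨M₂, h₂⟩ := hS.ttt_xx.exists_allBounded
  obtain ⟨M₃, h₃⟩ := hS.ttt_yy.exists_allBounded
  obtain ⟨M₄, h₄⟩ := hC.t_x6.exists_allBounded
  obtain ⟨M₅, h₅⟩ := hC.t_y6.exists_allBounded
  obtain ⟨M₆, h₆⟩ := hC.lap_x6.exists_allBounded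
  obtain ⟨M₇, h₇⟩ := hC.lap_y6.exists_allBounded
  obtain ⟨M₀, hM₀, hM⟩ : ∃ M, 0 ≤ M ∧
      (M₁ ≤ M ∧ M₂ ≤ M ∧ M₃ ≤ M ∧ M₄ ≤ M ∧ M₅ ≤ M ∧ M₆ ≤ M ∧ M₇ ≤ M) := by
    refine ⟨|M₁| + |M₂| + |M₃| + |M₄| + |M₅| + |M₆| + |M₇|, by positivity, ?_⟩
    refine ⟨?_, ?_, ?_, ?_, ?_, ?_, ?_⟩ <;>
      linarith [le_abs_self M₁, le_abs_self M₂, le_abs_self M₃, le_abs_self M₄, le_abs_self M₅,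
        le_abs_self M₆, le_abs_self M₇, abs_nonneg M₁, abs_nonneg M₂, abs_nonneg M₃,
        abs_nonneg M₄, abs_nonneg M₅, abs_nonneg M₆, abs_nonneg M₇]
  obtain ⟨l₁, l₂, l₃, l₄, l₅, l₆, l₇⟩ := hM
  have hM' : M₀ ≤ 2 * M₀ := by linarith
  have z0 : (0 : ℝ) ∈ Icc 0 T := ⟨le_rfl, hT.le⟩
  -- The factor 2 accounts for the Laplacian being a sum of two derivatives.
  refine ⟨2 * M₀, by positivity, ?_⟩
  refine ⟨fun x hx y hy => ?_, fun x hx y hy => ?_, fun t ht y hy => ?_, fun t ht x hx => ?_,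
    fun k hk s hs t ht x hx y hy => ?_, fun k hk s hs t ht x hx y hy => ?_,
    fun t ht y hy => ?_, fun t ht x hx => ?_, fun t ht => ?_, fun t ht x hx y hy => ?_,
    fun τ => ?_⟩
  · exact hS.tttt.chain_t (h₁.mono (l₁.trans hM')) le_rfl le_rfl hx hy
  · have cx := hS.ttt_xx.chain_t (h₂.mono l₂) le_rfl le_rfl hx hy
    have cy := hS.ttt_yy.chain_t (h₃.mono l₃) le_rfl le_rfl hx hy
    exact ⟨fun k hk t ht => (cx.deriv k hk t ht).add (cy.deriv k hk t ht), fun k hk t ht =>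
      (abs_add_le _ _).trans (by linarith [cx.bound k hk t ht, cy.bound k hk t ht])⟩
  · exact hC.t_x6.chain_x hT (h₄.mono (l₄.trans hM')) ht hy
  · exact hC.t_y6.chain_y hT (h₅.mono (l₅.trans hM')) ht hx
  · exact (hC.t_x6.chain_t (h₄.mono (l₄.trans hM')) hk le_rfl hx hy).abs_sub_le ht hs
  · exact (hC.t_y6.chain_t (h₅.mono (l₅.trans hM')) le_rfl hk hx hy).abs_sub_le ht hs
  · exact hC.lap_x6.chain_x hT (h₆.mono (l₆.trans hM')) ht hy
  · exact hC.lap_y6.chain_y hT (h₇.mono (l₇.trans hM')) ht hx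
  · exact (hC.lap_x6.cont 0 le_rfl 0 (by norm_num) 0 le_rfl).comp
      (f := fun p : ℝ × ℝ => (t, p.1, p.2)) (by fun_prop) fun p hp => ⟨ht, hp.1, hp.2⟩
  · have a := h₆ 0 le_rfl 2 (by norm_num) 0 le_rfl t ht x hx y hy
    have b := h₇ 0 le_rfl 0 le_rfl 2 (by norm_num) t ht x hx y hy
    rw [lap_eq_partialDeriv T (fun t => lap (u t))]
    exact (abs_add_le _ _).trans (by linarith)
  · have dx := fun (a' b' : ℕ) (ha : a' ≤ 3) (hb : b' < 2) (x y : ℝ) hx hy =>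
      hS.ttt_xx.hasDeriv_x hT (c' := 0) ha hb le_rfl z0 (x := x) (y := y) hx hy
    have dy := fun (a' c' : ℕ) (ha : a' ≤ 3) (hc : c' < 2) (x y : ℝ) hx hy =>
      hS.ttt_yy.hasDeriv_y hT ha hc z0 (x := x) (y := y) hx hy
    intro x hx y hy
    rw [lap_eq_of_hasDeriv
      (g := fun x y => u 0 x y + τ * dT T u 0 x y + τ ^ 2 / 2 * dT T (dT T u) 0 x y)
      (g₁ := fun x y => partialDeriv T 0 1 0 u 0 x y + τ * partialDeriv T 1 1 0 u 0 x y
        + τ ^ 2 / 2 * partialDeriv T 2 1 0 u 0 x y)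
      (g₂ := fun x y => partialDeriv T 0 2 0 u 0 x y + τ * partialDeriv T 1 2 0 u 0 x y
        + τ ^ 2 / 2 * partialDeriv T 2 2 0 u 0 x y)
      (k₁ := fun x y => partialDeriv T 0 0 1 u 0 x y + τ * partialDeriv T 1 0 1 u 0 x y
        + τ ^ 2 / 2 * partialDeriv T 2 0 1 u 0 x y)
      (k₂ := fun x y => partialDeriv T 0 0 2 u 0 x y + τ * partialDeriv T 1 0 2 u 0 x y
        + τ ^ 2 / 2 * partialDeriv T 2 0 2 u 0 x y)
      (fun x hx y hy => ((dx 0 0 (by norm_num) (by norm_num) x y hx hy).add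
        ((dx 1 0 (by norm_num) (by norm_num) x y hx hy).const_mul τ)).add
        ((dx 2 0 (by norm_num) (by norm_num) x y hx hy).const_mul (τ ^ 2 / 2)))
      (fun x hx y hy => ((dx 0 1 (by norm_num) (by norm_num) x y hx hy).add
        ((dx 1 1 (by norm_num) (by norm_num) x y hx hy).const_mul τ)).add
        ((dx 2 1 (by norm_num) (by norm_num) x y hx hy).const_mul (τ ^ 2 / 2)))
      (fun x hx y hy => ((dy 0 0 (by norm_num) (by norm_num) x y hx hy).add
        ((dy 1 0 (by norm_num) (by norm_num) x y hx hy).const_mul τ)).add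
        ((dy 2 0 (by norm_num) (by norm_num) x y hx hy).const_mul (τ ^ 2 / 2)))
      (fun x hx y hy => ((dy 0 1 (by norm_num) (by norm_num) x y hx hy).add
        ((dy 1 1 (by norm_num) (by norm_num) x y hx hy).const_mul τ)).add
        ((dy 2 1 (by norm_num) (by norm_num) x y hx hy).const_mul (τ ^ 2 / 2))) x hx y hy,
      lap_eq_partialDeriv T u]
    ring

/-- By continuity, the boundary conditions also hold at the initial time. -/
theorem IsPlateSolution.hinged_Icc {P : ℝ → ℝ} {T M : ℝ} (hT : 0 < T) {f : ℝ → ℝ → ℝ → ℝ}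
    {u₀ u₁ : ℝ → ℝ → ℝ} {u : ℝ → ℝ → ℝ → ℝ} (hu : IsPlateSolution P T f u₀ u₁ u)
    (hM : RegularWith T M u) {t : ℝ} (ht : t ∈ Icc 0 T) {x y : ℝ} (hxy : OnBoundary x y) :
    u t x y = 0 ∧ lap (u t) x y = 0 := by
  have key : ∀ w : ℝ → ℝ, ContinuousOn w (Icc 0 T) → (∀ t ∈ Ioc 0 T, w t = 0) → w t = 0 := by
    intro w hw h0
    rcases ht.1.eq_or_lt with rfl | hpos
    · have hlim := (hw 0 ht).mono_left (nhdsWithin_mono 0 Ioc_subset_Icc_self)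
      have hne : (nhdsWithin (0 : ℝ) (Ioc 0 T)).NeBot := left_nhdsWithin_Ioc_neBot hT
      refine tendsto_nhds_unique hlim (tendsto_const_nhds.congr' ?_)
      filter_upwards [self_mem_nhdsWithin] with s hs
      exact (h0 s hs).symm
    · exact h0 t ⟨hpos, ht.2⟩
  have hx := hxy.1.1
  have hy := hxy.1.2
  exact ⟨key (fun t => u t x y) ((hM.u_t x hx y hy).continuousOn (k := 0) (by norm_num))
      fun s hs => (hu.hinged s hs x y hxy).1,
    key (fun t => lap (u t) x y) ((hM.lap_t x hx y hy).continuousOn (k := 0) (by norm_num))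
      fun s hs => (hu.hinged s hs x y hxy).2⟩

theorem vanishesOnBoundary_onGrid {J₁ J₂ : ℕ} (h₁ : 1 ≤ J₁) (h₂ : 1 ≤ J₂) {g : ℝ → ℝ → ℝ}
    (hg : ∀ x y, OnBoundary x y → g x y = 0) : VanishesOnBoundary J₁ J₂ (onGrid J₁ J₂ g) := by
  have m₁ := fun i hi => mul_step_mem (i := i) h₁ hi
  have m₂ := fun j hj => mul_step_mem (i := j) h₂ hj
  have e₁ := step_mul h₁
  have e₂ := step_mul h₂
  exact
    { left := fun j hj => hg _ _ ⟨⟨m₁ 0 (by omega), m₂ j hj⟩, Or.inl (by simp)⟩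
      right := fun j hj => hg _ _ ⟨⟨m₁ _ le_rfl, m₂ j hj⟩, Or.inr (Or.inl e₁)⟩
      bottom := fun i hi =>
        hg _ _ ⟨⟨m₁ i hi, m₂ 0 (by omega)⟩, Or.inr (Or.inr (Or.inl (by simp)))⟩
      top := fun i hi => hg _ _ ⟨⟨m₁ i hi, m₂ _ le_rfl⟩, Or.inr (Or.inr (Or.inr e₂))⟩ }

/-- The Simpson norm of the grid values of `v = Δ u` approximates the integral of `v²`. -/
theorem RegularWith.abs_sqIntegral_sub_le {T M : ℝ} {u : ℝ → ℝ → ℝ → ℝ} (hM : RegularWith T M u)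
    {t : ℝ} (ht : t ∈ Icc 0 T) (hbd : ∀ x y, OnBoundary x y → lap (u t) x y = 0) {J₁ J₂ : ℕ}
    (h₁ : 1 ≤ J₁) (h₂ : 1 ≤ J₂) :
    |sqIntegral (lap (u t)) - normF J₁ J₂ (onGrid J₁ J₂ (lap (u t))) ^ 2|
      ≤ 64 * M ^ 2 * (step J₁ ^ 4 + step J₂ ^ 4) := by
  have key := abs_simpson_square_le (M := 16 * M ^ 2) (g := fun x y => lap (u t) x y ^ 2)
    (φ := fun k x y => sqChain (fun k x => partialDeriv T 0 k 0 (fun t => lap (u t)) t x y) k x)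
    (ψ := fun k x y => sqChain (fun k y => partialDeriv T 0 0 k (fun t => lap (u t)) t x y) k y)
    rfl rfl (fun y hy => ((hM.lap_x t ht y hy).take 4 (by norm_num)).sq)
    (fun x hx => ((hM.lap_y t ht x hx).take 4 (by norm_num)).sq) ((hM.lap_cont t ht).pow 2)
    (fun x y h => by simp only [hbd x y h]; norm_num) h₁ h₂
  rw [normF_sq h₁ h₂ (vanishesOnBoundary_onGrid h₁ h₂ hbd)]
  simp only [sqIntegral, sq_abs, onGrid]
  linarith

/-! ### Residuals of the exact solution in the two equations of the scheme. -/

section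

variable {T M τ : ℝ} {u : ℝ → ℝ → ℝ → ℝ} {J₁ J₂ n i j : ℕ}

theorem natCast_add_one_mul (n : ℕ) (τ : ℝ) : ((n + 1 : ℕ) : ℝ) * τ = n * τ + τ := by
  push_cast; ring

theorem natCast_sub_one_mul {n : ℕ} (hn : 1 ≤ n) (τ : ℝ) :
    ((n - 1 : ℕ) : ℝ) * τ = n * τ - τ := by
  rw [Nat.cast_sub hn]; push_cast; ring

/-- The residual of the solution in the first equation of the scheme, with `Φ vⁿ` in place of
`Φ ṽⁿ`. -/
theorem RegularWith.abs_residual_le (hM : RegularWith T M u) {P : ℝ → ℝ} {f : ℝ → ℝ → ℝ → ℝ}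
    {u₀ u₁ : ℝ → ℝ → ℝ} (hu : IsPlateSolution P T f u₀ u₁ u) {B : ℝ} (hB0 : 0 ≤ B) (h₁ : 1 ≤ J₁)
    (h₂ : 1 ≤ J₂) (h1 : 1 ≤ n) (hτ : 0 < τ) (ht : n * τ ∈ Icc 0 T) (ht1 : n * τ + τ ∈ Icc 0 T)
    (ht2 : n * τ - τ ∈ Icc 0 T) (hPB : |P (sqIntegral (lap (u (n * τ))))| ≤ B)
    (h : Interior J₁ J₂ i j) :
    |opH J₁ J₂ (dt2 τ (sample J₁ J₂ τ u) n) i j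
        + P (sqIntegral (lap (u (n * τ)))) * opH J₁ J₂ (dtBar τ (sample J₁ J₂ τ u) n) i j
        + opPhi J₁ J₂ (sample J₁ J₂ τ (fun t => lap (u t)) n) i j
        - opH J₁ J₂ (sample J₁ J₂ τ f n) i j|
      ≤ 2 * M * τ ^ 2 + B * (M * τ ^ 2) + 3 * M * (step J₁ ^ 4 + step J₂ ^ 4) := by
  have mx : ∀ i ≤ 2 * J₁, (i : ℝ) * step J₁ ∈ Icc (0 : ℝ) 1 := fun i hi => mul_step_mem h₁ hi
  have my : ∀ j ≤ 2 * J₂, (j : ℝ) * step J₂ ∈ Icc (0 : ℝ) 1 := fun j hj => mul_step_mem h₂ hj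
  set su := sample J₁ J₂ τ u with hsu
  set sv := sample J₁ J₂ τ (fun t => lap (u t)) with hsv
  set p := P (sqIntegral (lap (u (n * τ)))) with hp
  set a : ℕ → ℕ → ℝ := fun i j => dt2 τ su n i j
    - partialDeriv T 2 0 0 u (n * τ) (i * step J₁) (j * step J₂) with ha
  set b : ℕ → ℕ → ℝ := fun i j => dtBar τ su n i j
    - partialDeriv T 1 0 0 u (n * τ) (i * step J₁) (j * step J₂) with hb
  set l : ℕ → ℕ → ℝ := onGrid J₁ J₂ (fun x y =>
    partialDeriv T 0 2 0 (fun t => lap (u t)) (n * τ) x y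
      + partialDeriv T 0 0 2 (fun t => lap (u t)) (n * τ) x y) with hl
  have comp := abs_opH_sub_opPhi_le (w := lap (u (n * τ)))
    (φ := fun k x y => partialDeriv T 0 k 0 (fun t => lap (u t)) (n * τ) x y)
    (ψ := fun k x y => partialDeriv T 0 0 k (fun t => lap (u t)) (n * τ) x y)
    rfl rfl (fun y hy => hM.lap_x _ ht y hy) (fun x hx => hM.lap_y _ ht x hx) h₁ h₂ h
  change |opH J₁ J₂ l i j - opPhi J₁ J₂ (sv n) i j| ≤ _ at comp
  have ba : |opH J₁ J₂ a i j| ≤ 2 * M * τ ^ 2 := abs_opH_le h fun i hi j hj => by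
    have e := (hM.u_t _ (mx i hi) _ (my j hj)).abs_second_quot_sub_le hτ ht
      ht1 ht2
    refine le_trans (le_of_eq ?_) e
    congr 1
    simp only [ha, dt2, dt, hsu, sample, onGrid, Nat.add_sub_cancel, natCast_add_one_mul,
      natCast_sub_one_mul h1]
    change _ = (u (n * τ + τ) _ _ - 2 * u (n * τ) _ _ + u (n * τ - τ) _ _) / τ ^ 2 - _
    rw [← sub_div, div_div, ← pow_two]
    congr 2
    ring
  have bb : |opH J₁ J₂ b i j| ≤ M * τ ^ 2 := abs_opH_le h fun i hi j hj => by
    have e := ((hM.u_t _ (mx i hi) _ (my j hj)).take 3 (by norm_num)).abs_central_sub_le hτ ht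
      ht1 ht2
    refine le_trans (le_of_eq ?_) e
    congr 1
    simp only [hb, dtBar, hsu, sample, onGrid, natCast_add_one_mul,
      natCast_sub_one_mul h1]
    rfl
  have bpb : |p * opH J₁ J₂ b i j| ≤ B * (M * τ ^ 2) := by
    rw [abs_mul]
    exact mul_le_mul hPB bb (abs_nonneg _) hB0
  -- The differential equation eliminates f at all nine stencil points. The coefficient p is
  -- constant in space and so commutes with 𝓗.
  have ef : opH J₁ J₂ (sample J₁ J₂ τ f n) i j
      = opH J₁ J₂ (dt2 τ su n) i j + p * opH J₁ J₂ (dtBar τ su n) i j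
        - opH J₁ J₂ a i j - p * opH J₁ J₂ b i j + opH J₁ J₂ l i j := by
    have : opH J₁ J₂ (sample J₁ J₂ τ f n) i j = opH J₁ J₂ (fun i j =>
        1 * (fun i j => 1 * (fun i j => 1 * dt2 τ su n i j + p * dtBar τ su n i j) i j
          + -1 * (fun i j => 1 * a i j + p * b i j) i j) i j + 1 * l i j) i j := by
      refine opH_congr h fun i hi j hj => ?_
      change f (n * τ) (i * step J₁) (j * step J₂) = _
      rw [← hu.equation _ ht _ (mx i hi) _ (my j hj),
            lap_eq_partialDeriv T (fun t => lap (u t)) (n * τ)]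
      simp only [ha, hb, hl, onGrid]
      change partialDeriv T 2 0 0 u _ _ _ + p * partialDeriv T 1 0 0 u _ _ _ + _ = _
      ring
    rw [this, opH_linComb h, opH_linComb h, opH_linComb h, opH_linComb h]
    ring
  have e : opH J₁ J₂ (dt2 τ su n) i j + p * opH J₁ J₂ (dtBar τ su n) i j
      + opPhi J₁ J₂ (sv n) i j - opH J₁ J₂ (sample J₁ J₂ τ f n) i j
      = opH J₁ J₂ a i j + p * opH J₁ J₂ b i j
        - (opH J₁ J₂ l i j - opPhi J₁ J₂ (sv n) i j) := by
    rw [ef]; ring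
  change |opH J₁ J₂ (dt2 τ su n) i j + p * opH J₁ J₂ (dtBar τ su n) i j
      + opPhi J₁ J₂ (sv n) i j - opH J₁ J₂ (sample J₁ J₂ τ f n) i j| ≤ _
  rw [e]
  refine ((abs_sub _ _).trans (add_le_add (abs_add_le _ _) le_rfl)).trans ?_
  linarith

/-- The residual of the solution in the second equation of the scheme. -/
theorem RegularWith.abs_dtBar_residual_le (hM : RegularWith T M u) (h₁ : 1 ≤ J₁) (h₂ : 1 ≤ J₂)
    (h1 : 1 ≤ n) (hτ : 0 < τ) (ht1 : n * τ + τ ∈ Icc 0 T) (ht2 : n * τ - τ ∈ Icc 0 T)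
    (h : Interior J₁ J₂ i j) :
    |opH J₁ J₂ (dtBar τ (sample J₁ J₂ τ (fun t => lap (u t))) n) i j
      - opPhi J₁ J₂ (dtBar τ (sample J₁ J₂ τ u) n) i j|
      ≤ 3 * M * (step J₁ ^ 4 + step J₂ ^ 4) := by
  set su := sample J₁ J₂ τ u with hsu
  set sv := sample J₁ J₂ τ (fun t => lap (u t)) with hsv
  have hτ2 : 0 < 2 * τ := by positivity
  -- Lipschitz continuity in time bounds the spatial derivatives of the central quotient uniformly
  -- in τ, so compact consistency applies to the quotient itself.
  have quot : ∀ d : ℝ, |d| ≤ M * |n * τ + τ - (n * τ - τ)| → |d / (2 * τ)| ≤ M := fun d hd => by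
    rw [show n * τ + τ - (n * τ - τ) = 2 * τ by ring, abs_of_pos hτ2] at hd
    rw [abs_div, abs_of_pos hτ2, div_le_iff₀ hτ2]
    exact hd
  have comp := abs_opH_sub_opPhi_le (M := M)
    (w := fun x y => (u (n * τ + τ) x y - u (n * τ - τ) x y) / (2 * τ))
    (φ := fun k x y => (partialDeriv T 0 k 0 u (n * τ + τ) x y
      - partialDeriv T 0 k 0 u (n * τ - τ) x y) / (2 * τ))
    (ψ := fun k x y => (partialDeriv T 0 0 k u (n * τ + τ) x y
      - partialDeriv T 0 0 k u (n * τ - τ) x y) / (2 * τ))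
    rfl rfl
    (fun y hy => (hM.u_x _ ht1 y hy).quot (hM.u_x _ ht2 y hy) fun k hk x hx =>
      quot _ (hM.u_x_lipschitz k hk _ ht1 _ ht2 x hx y hy))
    (fun x hx => (hM.u_y _ ht1 x hx).quot (hM.u_y _ ht2 x hx) fun k hk y hy =>
      quot _ (hM.u_y_lipschitz k hk _ ht1 _ ht2 x hx y hy)) h₁ h₂ h
  have e1 : dtBar τ su n = onGrid J₁ J₂
      (fun x y => (u (n * τ + τ) x y - u (n * τ - τ) x y) / (2 * τ)) := by
    funext i j
    simp only [dtBar, hsu, sample, onGrid, natCast_add_one_mul,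
      natCast_sub_one_mul h1]
  have e2 : dtBar τ sv n = onGrid J₁ J₂ (fun x y => (partialDeriv T 0 2 0 u (n * τ + τ) x y
      - partialDeriv T 0 2 0 u (n * τ - τ) x y) / (2 * τ)
      + (partialDeriv T 0 0 2 u (n * τ + τ) x y
      - partialDeriv T 0 0 2 u (n * τ - τ) x y) / (2 * τ)) := by
    funext i j
    simp only [dtBar, hsv, sample, onGrid, natCast_add_one_mul,
      natCast_sub_one_mul h1, lap_eq_partialDeriv T u]
    ring
  rw [e1, e2]
  exact comp

end

end

end PlateScheme

/-! ### Choice of constants and proof of the error estimate. -/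

set_option maxHeartbeats 1000000 in
theorem theorem4p2
    (P : ℝ → ℝ) (p₀ p₁ z₀ L : ℝ)
    (hA1 : PlateScheme.DampingBounds P p₀ p₁ z₀)
    (hA2 : PlateScheme.DampingSlope P L)
    (T : ℝ) (hT : 0 < T)
    (f : ℝ → ℝ → ℝ → ℝ) (u₀ u₁ : ℝ → ℝ → ℝ) (u : ℝ → ℝ → ℝ → ℝ)
    (hu : PlateScheme.IsPlateSolution P T f u₀ u₁ u)
    (Q : ℝ)
    (hA4 : PlateScheme.SolutionBounds T Q u)
    (hC : PlateScheme.CompactBounds T Q u) :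
    ∃ C : ℝ, 0 < C ∧
      ∀ (J₁ J₂ N : ℕ) (τ : ℝ), 1 ≤ J₁ → 1 ≤ J₂ → 1 ≤ N → 0 < τ → ((N : ℝ) + 1) * τ ≤ T →
      ∀ U V : ℕ → ℕ → ℕ → ℝ, PlateScheme.IsSchemeSolution P f u₀ u₁ J₁ J₂ N τ U V →
      ∀ n : ℕ, 1 ≤ n → n ≤ N →
        √(PlateScheme.gridNorm J₁ J₂
              (PlateScheme.dt τ (PlateScheme.sample J₁ J₂ τ u - U) (n + 1)) ^ 2
            + PlateScheme.gridNorm J₁ J₂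
              (PlateScheme.sample J₁ J₂ τ (fun t => PlateScheme.lap (u t)) (n + 1)
                - V (n + 1)) ^ 2
            + PlateScheme.gridNorm J₁ J₂
              (PlateScheme.sample J₁ J₂ τ (fun t => PlateScheme.lap (u t)) n - V n) ^ 2)
          ≤ C * (τ ^ 2 + max (PlateScheme.step J₁) (PlateScheme.step J₂) ^ 4) := by
  open PlateScheme in
  obtain ⟨M, hM0, hM⟩ := exists_regularWith hT hA4 hC
  have hL := hA2.nonneg
  have hP : ∀ z, 0 ≤ z → 0 < P z := fun z hz => hA1.1.trans_le (hA1.2.2.2.2 z hz)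
  -- B bounds P(∫|Δu|²), as ∫|Δu|² ≤ M²; c bounds the starting values of the scheme, F bounds f, and
  -- R is the resulting a priori bound for ‖Vⁿ‖.
  set B : ℝ := P 0 + L * M ^ 2 with hB
  have hB0 : 0 ≤ B := by have := hP 0 le_rfl; positivity
  set c : ℝ := M * (1 + T + T ^ 2) with hc
  have hc0 : 0 ≤ c := by positivity
  set F : ℝ := M + B * M + M with hF
  have hF0 : 0 ≤ F := by positivity
  set R : ℝ := 3 * (2 * c + 3 * T * F) with hR
  have hR0 : 0 ≤ R := by positivity
  -- Here 6M is forced by the third difference 12Mτ³, BM by the damping residual, and the multiple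
  -- of L by Simpson's error (64M²) and by the difference of the Simpson norms (2M + 2R).
  set K : ℝ := 6 * M + B * M + L * (64 * M ^ 2 + 2 * M + 2 * R) with hK
  have hK0 : 0 ≤ K := by positivity
  have hKM : 6 * M ≤ K := by
    have : 0 ≤ B * M + L * (64 * M ^ 2 + 2 * M + 2 * R) := by positivity
    linarith
  obtain ⟨C, hC0, hmain⟩ := exists_error_bound K T hK0
  -- Three norms of size Cδ each, and δ ≤ 2(τ² + h⁴).
  refine ⟨6 * C, by positivity, ?_⟩
  intro J₁ J₂ N τ h₁ h₂ hN hτ hNT U V hUV n₀ hn₀ hn₀N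
  set δ : ℝ := τ ^ 2 + (step J₁ ^ 4 + step J₂ ^ 4) with hδ
  have q₁ := step_pos h₁
  have q₂ := step_pos h₂
  have hδ0 : 0 ≤ δ := by positivity
  have hδτ : τ ^ 2 ≤ δ := by
    have : 0 ≤ step J₁ ^ 4 + step J₂ ^ 4 := by positivity
    linarith
  have hδh : step J₁ ^ 4 + step J₂ ^ 4 ≤ δ := by
    have : 0 ≤ τ ^ 2 := by positivity
    linarith
  have t0 : (0 : ℝ) ∈ Icc 0 T := ⟨le_rfl, hT.le⟩
  have tm : ∀ n ≤ N + 1, (n : ℝ) * τ ∈ Icc 0 T := fun n hn => by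
    refine ⟨by positivity, le_trans ?_ hNT⟩
    have : (n : ℝ) ≤ N + 1 := by exact_mod_cast hn
    gcongr
  have τT : τ ∈ Icc 0 T := by simpa using tm 1 (by omega)
  have tadd : ∀ n : ℕ, ((n + 1 : ℕ) : ℝ) * τ = n * τ + τ := fun n => by push_cast; ring
  have tsub : ∀ n : ℕ, 1 ≤ n → ((n - 1 : ℕ) : ℝ) * τ = n * τ - τ := fun n hn => by
    rw [Nat.cast_sub hn]; push_cast; ring
  have tm1 : ∀ n ≤ N, (n : ℝ) * τ + τ ∈ Icc 0 T := fun n hn => by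
    rw [← tadd]; exact tm _ (by omega)
  have tm2 : ∀ n, 1 ≤ n → n ≤ N → (n : ℝ) * τ - τ ∈ Icc 0 T := fun n h1 hn => by
    rw [← tsub n h1]; exact tm _ (by omega)
  have mx : ∀ i ≤ 2 * J₁, (i : ℝ) * step J₁ ∈ Icc (0 : ℝ) 1 := fun i hi => mul_step_mem h₁ hi
  have my : ∀ j ≤ 2 * J₂, (j : ℝ) * step J₂ ∈ Icc (0 : ℝ) 1 := fun j hj => mul_step_mem h₂ hj
  -- the initial data
  have hu0 : ∀ x ∈ Icc (0 : ℝ) 1, ∀ y ∈ Icc (0 : ℝ) 1, u₀ x y = u 0 x y := fun x hx y hy =>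
    (hu.init x hx y hy).symm
  have hlap0 := lap_congr hu0
  have hsecond : ∀ x ∈ Icc (0 : ℝ) 1, ∀ y ∈ Icc (0 : ℝ) 1,
      secondInit P f u₀ u₁ x y = dT T (dT T u) 0 x y := fun x hx y hy => by
    have h := hu.equation 0 t0 x hx y hy
    rw [secondInit, sqIntegral_congr hlap0, lap_congr hlap0 x hx y hy,
      ← hu.init_deriv x hx y hy]
    linarith
  have hlap1 : ∀ x ∈ Icc (0 : ℝ) 1, ∀ y ∈ Icc (0 : ℝ) 1,
      lap (firstStep P f u₀ u₁ τ) x y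
      = lap (u 0) x y + τ * (partialDeriv T 1 2 0 u 0 x y + partialDeriv T 1 0 2 u 0 x y)
        + τ ^ 2 / 2 * (partialDeriv T 2 2 0 u 0 x y + partialDeriv T 2 0 2 u 0 x y) :=
    fun x hx y hy => by
      rw [← hM.lap_taylor τ x hx y hy]
      refine lap_congr (fun x hx y hy => ?_) x hx y hy
      rw [firstStep, hsecond x hx y hy, hu0 x hx y hy, ← hu.init_deriv x hx y hy]
  -- boundary values
  set su := sample J₁ J₂ τ u with hsu
  set sv := sample J₁ J₂ τ (fun t => lap (u t)) with hsv
  have vsu : ∀ n ≤ N + 1, VanishesOnBoundary J₁ J₂ (su n) := fun n hn =>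
    vanishesOnBoundary_onGrid h₁ h₂ fun x y h => (hu.hinged_Icc hT hM (tm n hn) h).1
  have vsv : ∀ n ≤ N + 1, VanishesOnBoundary J₁ J₂ (sv n) := fun n hn =>
    vanishesOnBoundary_onGrid h₁ h₂ fun x y h => (hu.hinged_Icc hT hM (tm n hn) h).2
  have vU : ∀ n ≤ N + 1, VanishesOnBoundary J₁ J₂ (U n) := fun n hn =>
    ⟨fun j hj => (hUV.bdry_x n hn j hj).1, fun j hj => (hUV.bdry_x n hn j hj).2.1,
      fun i hi => (hUV.bdry_y n hn i hi).1, fun i hi => (hUV.bdry_y n hn i hi).2.1⟩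
  have vV : ∀ n ≤ N + 1, VanishesOnBoundary J₁ J₂ (V n) := fun n hn =>
    ⟨fun j hj => (hUV.bdry_x n hn j hj).2.2.1, fun j hj => (hUV.bdry_x n hn j hj).2.2.2,
      fun i hi => (hUV.bdry_y n hn i hi).2.2.1, fun i hi => (hUV.bdry_y n hn i hi).2.2.2⟩
  -- a bound that holds at the interior points holds everywhere if the boundary values vanish
  have extend : ∀ {w : ℕ → ℕ → ℝ} {b : ℝ}, VanishesOnBoundary J₁ J₂ w → 0 ≤ b →
      (∀ i j, Interior J₁ J₂ i j → |w i j| ≤ b) → ∀ i ≤ 2 * J₁, ∀ j ≤ 2 * J₂, |w i j| ≤ b := by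
    intro w b hw hb h i hi j hj
    rcases Nat.eq_zero_or_pos i with rfl | hi0
    · rw [hw.left j hj, abs_zero]; exact hb
    rcases hi.eq_or_lt with rfl | hi1
    · rw [hw.right j hj, abs_zero]; exact hb
    rcases Nat.eq_zero_or_pos j with rfl | hj0
    · rw [hw.bottom i hi, abs_zero]; exact hb
    rcases hj.eq_or_lt with rfl | hj1
    · rw [hw.top i hi, abs_zero]; exact hb
    exact h i j ⟨Finset.mem_Icc.2 (by omega), Finset.mem_Icc.2 (by omega)⟩
  -- pointwise bounds for the solution
  have bu : ∀ k ≤ 4, ∀ t ∈ Icc 0 T, ∀ x ∈ Icc (0 : ℝ) 1, ∀ y ∈ Icc (0 : ℝ) 1,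
      |partialDeriv T k 0 0 u t x y| ≤ M := fun k hk t ht x hx y hy =>
    (hM.u_t x hx y hy).bound k hk t ht
  have bv : ∀ t ∈ Icc 0 T, ∀ x ∈ Icc (0 : ℝ) 1, ∀ y ∈ Icc (0 : ℝ) 1, |lap (u t) x y| ≤ M :=
    fun t ht x hx y hy => (hM.lap_t x hx y hy).bound 0 (by norm_num) t ht
  have bP : ∀ t ∈ Icc 0 T, |P (sqIntegral (lap (u t)))| ≤ B := fun t ht => by
    have n0 := sqIntegral_nonneg (lap (u t))
    have a := hA2.abs_sub_le n0 le_rfl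
    have b := sqIntegral_le (bv t ht)
    rw [sub_zero, abs_of_nonneg n0] at a
    have := mul_le_mul_of_nonneg_left b hL
    rw [abs_of_pos (hP _ n0)]
    linarith [le_abs_self (P (sqIntegral (lap (u t))) - P 0)]
  -- No bound on f is assumed; it follows from the equation.
  have hf : ∀ n ≤ N, ∀ i ≤ 2 * J₁, ∀ j ≤ 2 * J₂, |sample J₁ J₂ τ f n i j| ≤ F :=
    fun n hn i hi j hj => by
      have ht := tm n (by omega)
      have hx := mx i hi
      have hy := my j hj
      change |f (n * τ) (i * step J₁) (j * step J₂)| ≤ F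
      rw [← hu.equation _ ht _ hx _ hy]
      refine (abs_add_le _ _).trans (add_le_add ((abs_add_le _ _).trans
        (add_le_add (bu 2 (by norm_num) _ ht _ hx _ hy) ?_)) (hM.lap_lap _ ht _ hx _ hy))
      rw [abs_mul]
      exact mul_le_mul (bP _ ht) (bu 1 (by norm_num) _ ht _ hx _ hy) (abs_nonneg _) hB0
  -- initial values of the scheme
  have hτT : τ ≤ T := τT.2
  have initU : ∀ i j, Interior J₁ J₂ i j → dt τ U 1 i j
      = partialDeriv T 1 0 0 u 0 (i * step J₁) (j * step J₂)
        + τ / 2 * partialDeriv T 2 0 0 u 0 (i * step J₁) (j * step J₂) := fun i j h => by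
    obtain ⟨hi, hi', hj, hj'⟩ := h.bounds
    have hx := mx i (by omega)
    have hy := my j (by omega)
    rw [hUV.initU1 i h.1 j h.2, onGrid, onGrid, hsecond _ hx _ hy, ← hu.init_deriv _ hx _ hy]
    rfl
  have initV0 : ∀ i j, Interior J₁ J₂ i j →
      V 0 i j = lap (u 0) (i * step J₁) (j * step J₂) := fun i j h => by
    obtain ⟨hi, hi', hj, hj'⟩ := h.bounds
    rw [hUV.initV0 i h.1 j h.2, onGrid, hlap0 _ (mx i (by omega)) _ (my j (by omega))]
  have initV1 : ∀ i j, Interior J₁ J₂ i j → V 1 i j = lap (u 0) (i * step J₁) (j * step J₂)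
        + τ * (partialDeriv T 1 2 0 u 0 (i * step J₁) (j * step J₂)
          + partialDeriv T 1 0 2 u 0 (i * step J₁) (j * step J₂))
        + τ ^ 2 / 2 * (partialDeriv T 2 2 0 u 0 (i * step J₁) (j * step J₂)
          + partialDeriv T 2 0 2 u 0 (i * step J₁) (j * step J₂)) := fun i j h => by
    obtain ⟨hi, hi', hj, hj'⟩ := h.bounds
    rw [hUV.initV1 i h.1 j h.2, onGrid, hlap1 _ (mx i (by omega)) _ (my j (by omega))]
  have bU1 : ∀ i ≤ 2 * J₁, ∀ j ≤ 2 * J₂, |dt τ U 1 i j| ≤ c := by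
    refine extend ((vU 1 (by omega)).dt τ (vU 0 (by omega))) hc0 fun i j h => ?_
    obtain ⟨hi, hi', hj, hj'⟩ := h.bounds
    have hx := mx i (by omega)
    have hy := my j (by omega)
    rw [initU i j h]
    refine (abs_add_le _ _).trans ?_
    rw [abs_mul, abs_of_pos (by positivity : 0 < τ / 2)]
    have a := bu 1 (by norm_num) 0 t0 _ hx _ hy
    have b := mul_le_mul (by linarith : τ / 2 ≤ T) (bu 2 (by norm_num) 0 t0 _ hx _ hy)
      (abs_nonneg _) hT.le
    have : 0 ≤ M * T ^ 2 := by positivity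
    rw [hc]; linarith
  have bV0 : ∀ i ≤ 2 * J₁, ∀ j ≤ 2 * J₂, |V 0 i j| ≤ c := by
    refine extend (vV 0 (by omega)) hc0 fun i j h => ?_
    obtain ⟨hi, hi', hj, hj'⟩ := h.bounds
    rw [initV0 i j h]
    have a := bv 0 t0 _ (mx i (by omega)) _ (my j (by omega))
    have : 0 ≤ M * (T + T ^ 2) := by positivity
    rw [hc]; linarith
  have bV1 : ∀ i ≤ 2 * J₁, ∀ j ≤ 2 * J₂, |V 1 i j| ≤ c := by
    refine extend (vV 1 (by omega)) hc0 fun i j h => ?_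
    obtain ⟨hi, hi', hj, hj'⟩ := h.bounds
    have hx := mx i (by omega)
    have hy := my j (by omega)
    rw [initV1 i j h]
    have ch := hM.lap_t _ hx _ hy
    refine (abs_add_le _ _).trans ?_
    refine (add_le_add (abs_add_le _ _) le_rfl).trans ?_
    rw [abs_mul, abs_mul, abs_of_pos hτ, abs_of_pos (by positivity : 0 < τ ^ 2 / 2)]
    have a := bv 0 t0 _ hx _ hy
    have b := mul_le_mul hτT (ch.bound 1 (by norm_num) 0 t0) (abs_nonneg _) hT.le
    have τ2 : τ ^ 2 / 2 ≤ T ^ 2 := by nlinarith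
    have d := mul_le_mul τ2 (ch.bound 2 (by norm_num) 0 t0) (abs_nonneg _) (by positivity)
    rw [hc]; linarith
  -- the a priori bound
  have hVR : ∀ n ≤ N, gridNorm J₁ J₂ (V n) ≤ R := fun n hn => by
    have := norm_bound_of_scheme (N := N) h₁ h₂ hτ hc0 hF0 (f := sample J₁ J₂ τ f)
      (p := fun n => P (normF J₁ J₂ (V n) ^ 2)) vU vV (fun n => (hP _ (sq_nonneg _)).le)
      (fun n h1 hn i j h => hUV.eqU n (Finset.mem_Icc.2 ⟨h1, hn⟩) i h.1 j h.2)
      (fun n h1 hn i j h => hUV.eqV n (Finset.mem_Icc.2 ⟨h1, hn⟩) i h.1 j h.2)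
      hf bU1 bV0 bV1 n hn
    refine this.trans ?_
    have ht := (tm n (by omega)).2
    rw [hR]
    gcongr
  -- finite differences of the solution in time
  have hMτ : M * τ ^ 2 ≤ M * δ := mul_le_mul_of_nonneg_left hδτ hM0
  have hMδ : 0 ≤ M * δ := by positivity
  have hKδ : 6 * (M * δ) ≤ K * δ := by
    have := mul_le_mul_of_nonneg_right hKM hδ0
    linarith
  have main := hmain J₁ J₂ N τ δ su sv U V (fun n => opH J₁ J₂ (sample J₁ J₂ τ f n))
    (fun n => P (normF J₁ J₂ (V n) ^ 2)) (fun n => P (sqIntegral (lap (u (n * τ))))) h₁ h₂ hτ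
    (by linarith) hδ0 vsu vsv vU vV (fun n => (hP _ (sq_nonneg _)).le)
    (fun n h1 hn i j h => hUV.eqU n (Finset.mem_Icc.2 ⟨h1, hn⟩) i h.1 j h.2)
    (fun n h1 hn i j h => hUV.eqV n (Finset.mem_Icc.2 ⟨h1, hn⟩) i h.1 j h.2)
    (fun n h1 hn i j h => by
      refine (hM.abs_residual_le hu hB0 h₁ h₂ h1 hτ (tm n (by omega)) (tm1 n hn) (tm2 n h1 hn)
        (bP _ (tm n (by omega))) h).trans ?_
      have r1 := mul_le_mul_of_nonneg_left hMτ hB0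
      have r2 := mul_le_mul_of_nonneg_left hδh hM0
      have r3 : 0 ≤ L * (64 * M ^ 2 + 2 * M + 2 * R) * δ := by positivity
      rw [hK]
      linarith)
    (fun n h1 hn i j h => by
      refine (hM.abs_dtBar_residual_le h₁ h₂ h1 hτ (tm1 n hn) (tm2 n h1 hn) h).trans ?_
      have r2 := mul_le_mul_of_nonneg_left hδh hM0
      linarith)
    (fun n h1 hn i hi j hj => by
      have hτ2 : 0 < 2 * τ := by positivity
      have e := ((hM.u_t _ (mx i hi) _ (my j hj)).take 1 (by norm_num)).abs_sub_le (tm2 n h1 hn)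
        (tm1 n hn)
      rw [show n * τ + τ - (n * τ - τ) = 2 * τ by ring, abs_of_pos hτ2] at e
      simp only [dtBar, hsu, sample, onGrid, tadd, tsub n h1]
      rw [abs_div, abs_of_pos hτ2, div_le_iff₀ hτ2]
      refine le_trans e (mul_le_mul_of_nonneg_right (by linarith) hτ2.le))
    (fun n h1 hn i hi j hj => by
      have e := ((hM.lap_t _ (mx i hi) _ (my j hj)).take 2 (by norm_num)).abs_second_diff_le hτ
        (tm n (by omega)) (tm1 n hn) (tm2 n h1 hn)
      simp only [hsv, sample, onGrid, tadd, tsub n h1]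
      refine le_trans e ?_
      linarith)
    (fun n h1 hn i hi j hj => by
      have b1 : (n : ℝ) * τ + τ + τ ∈ Icc 0 T := by
        rw [← tadd, ← tadd]; exact tm _ (by omega)
      have b2 : (n : ℝ) * τ + τ - τ ∈ Icc 0 T := by
        rw [add_sub_cancel_right]; exact tm n (by omega)
      have b3 : (n : ℝ) * τ + τ - 2 * τ ∈ Icc 0 T := by
        have := tm2 n h1 (by omega)
        rwa [show (n : ℝ) * τ + τ - 2 * τ = n * τ - τ by ring]
      -- Centred at (n + 1)τ, so that the four points are (n − 1)τ, …, (n + 2)τ.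
      have e := (hM.lap_t _ (mx i hi) _ (my j hj)).abs_third_diff_le hτ (tm1 n (by omega)) b1 b2 b3
      rw [show (n : ℝ) * τ + τ - 2 * τ = n * τ - τ by ring, add_sub_cancel_right] at e
      simp only [hsv, sample, onGrid, tadd, tsub n h1]
      refine le_trans e ?_
      have := mul_le_mul_of_nonneg_left hKδ hτ.le
      have := mul_le_mul_of_nonneg_left hMτ hτ.le
      linarith)
    (fun n h1 hn => by
      have ht := tm n (by omega)
      have lip := hA2.abs_sub_le (sqIntegral_nonneg (lap (u (n * τ))))
        (sq_nonneg (normF J₁ J₂ (V n)))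
      have s1 := hM.abs_sqIntegral_sub_le ht (fun x y h => (hu.hinged_Icc hT hM ht h).2) h₁ h₂
      have s2 := abs_normF_sq_sub_le h₁ h₂ (vsv n (by omega)) (vV n (by omega))
      have nv : gridNorm J₁ J₂ (sv n) ≤ M := gridNorm_le_of_abs_le h₁ h₂ hM0 fun i j h => by
        obtain ⟨hi, hi', hj, hj'⟩ := h.bounds
        exact bv _ ht _ (mx i (by omega)) _ (my j (by omega))
      set d := gridNorm J₁ J₂ (fun i j => sv n i j - V n i j) with hd
      have d0 : 0 ≤ d := gridNorm_nonneg _ _ _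
      have s3 : |sqIntegral (lap (u (n * τ))) - normF J₁ J₂ (V n) ^ 2|
          ≤ 64 * M ^ 2 * δ + 2 * (d * (M + R)) := by
        refine (abs_sub_le _ (normF J₁ J₂ (sv n) ^ 2) _).trans (add_le_add (s1.trans ?_)
          (s2.trans ?_))
        · gcongr
        · have := hVR n hn
          gcongr
      refine lip.trans ((mul_le_mul_of_nonneg_left s3 hL).trans ?_)
      have r : 0 ≤ (6 * M + B * M) * (δ + d) + L * (64 * M ^ 2 * d + (2 * M + 2 * R) * δ) := by
        positivity
      rw [hK]
      linarith)
    (fun i hi j hj => by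
      have v := ((vsu 1 (by omega)).dt τ (vsu 0 (by omega))).sub
        ((vU 1 (by omega)).dt τ (vU 0 (by omega)))
      refine extend v (by positivity) (fun i j h => ?_) i hi j hj
      obtain ⟨hi, hi', hj, hj'⟩ := h.bounds
      have e := ((hM.u_t _ (mx i (by omega)) _ (my j (by omega))).take 3
        (by norm_num)).abs_forward_quot_sub_le hτ t0 (by rw [zero_add]; exact τT)
      rw [initU i j h]
      simp only [dt, hsu, sample, onGrid, Nat.cast_one, one_mul, Nat.sub_self, Nat.cast_zero,
        zero_mul]
      rw [zero_add, sub_sub] at e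
      exact le_trans e (by linarith))
    (fun i hi j hj => by
      refine extend ((vsv 0 (by omega)).sub (vV 0 (by omega))) (by positivity)
        (fun i j h => ?_) i hi j hj
      rw [initV0 i j h]
      simp only [hsv, sample, onGrid, Nat.cast_zero, zero_mul, sub_self, abs_zero]
      positivity)
    (fun i hi j hj => by
      refine extend ((vsv 1 (by omega)).sub (vV 1 (by omega))) (by positivity)
        (fun i j h => ?_) i hi j hj
      obtain ⟨hi, hi', hj, hj'⟩ := h.bounds
      have ch := hM.lap_t _ (mx i (by omega)) _ (my j (by omega))
      -- Order τ² suffices for V¹, so the first-order expansion is used and the term τ²/2 is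
      -- estimated separately.
      have e := (ch.take 2 (by norm_num)).abs_first_order_le hτ t0 (by rw [zero_add]; exact τT)
      have b := ch.bound 2 (by norm_num) 0 t0
      rw [zero_add] at e
      change |lap (u τ) _ _ - lap (u 0) _ _ - _| ≤ _ at e
      rw [initV1 i j h]
      simp only [hsv, sample, onGrid, Nat.cast_one, one_mul]
      have b' := mul_le_mul_of_nonneg_left b (by positivity : 0 ≤ τ ^ 2 / 2)
      rw [← abs_of_nonneg (by positivity : 0 ≤ τ ^ 2 / 2), ← abs_mul,
        abs_of_nonneg (by positivity : 0 ≤ τ ^ 2 / 2)] at b'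
      rw [← sub_sub, ← sub_sub]
      refine (abs_sub _ _).trans ((add_le_add e b').trans ?_)
      linarith)
    n₀ hn₀ hn₀N
  obtain ⟨a, b, d⟩ := main
  have a0 := gridNorm_nonneg J₁ J₂ (dt τ (su - U) (n₀ + 1))
  have b0 := gridNorm_nonneg J₁ J₂ (sv (n₀ + 1) - V (n₀ + 1))
  have d0 := gridNorm_nonneg J₁ J₂ (sv n₀ - V n₀)
  set m := max (step J₁) (step J₂) with hm
  have hδm : δ ≤ 2 * (τ ^ 2 + m ^ 4) := by
    have r1 : step J₁ ^ 4 ≤ m ^ 4 := pow_le_pow_left₀ q₁.le (le_max_left _ _) 4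
    have r2 : step J₂ ^ 4 ≤ m ^ 4 := pow_le_pow_left₀ q₂.le (le_max_right _ _) 4
    have : 0 ≤ τ ^ 2 := by positivity
    linarith
  have hCδ := mul_le_mul_of_nonneg_left hδm hC0.le
  refine Real.sqrt_le_iff.2 ⟨by positivity, ?_⟩
  have sum : gridNorm J₁ J₂ (dt τ (su - U) (n₀ + 1)) + gridNorm J₁ J₂ (sv (n₀ + 1) - V (n₀ + 1))
      + gridNorm J₁ J₂ (sv n₀ - V n₀) ≤ 6 * C * (τ ^ 2 + m ^ 4) := by linarith
  refine le_trans ?_ (pow_le_pow_left₀ (by positivity) sum 2)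
  nlinarith [mul_nonneg a0 b0, mul_nonneg a0 d0, mul_nonneg b0 d0]
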